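/- **Conventions.** Let $n\ge 0$, $\varepsilon=(-1)^n$. An $\varepsilon$-hermitian variation structure (HVS) on $U=\mathbb C^m$ is a quadruple $(U;b,h,V)$ of complex $m\times m$ matrices with $h$ invertible and $$\bar b^{T}=\varepsilon b,\qquad \bar h^{T}bh=b,\qquad \bar V^{T}=-\varepsilon V\bar h^{T},\qquad Vb=h-I .$$ An isomorphism $(U;b,h,V)\to(U';b',h',V')$ is an invertible $\varphi$ with $b=\bar\varphi^{T}b'\varphi$, $h=\varphi^{-1}h'\varphi$, $V=\varphi^{-1}V'(\bar\varphi^{T})^{-1}$; direct sums are taken blockwise. Let $J_k$ be the upper triangular $k\times k$ Jordan block with eigenvalue $1$. For $k\ge1$, $u=\pm1$ let $b^k_u$ denote a nondegenerate matrix with $\overline{b}^{T}=\varepsilon b$, $J_k^{T}bJ_k=b$ and $b_{1,k}=u\,i^{-n^2-k+1}$. The following structures (each determined up to isomorphism by the data given) are used: * for $|\lambda|=1$, $\lambda\ne1$: $\mathcal W^k_\lambda(u)=(\mathbb C^k;\,b^k_u,\,\lambda J_k,\,(\lambda J_k-I)(b^k_u)^{-1})$; * $\mathcal W^1_1(u)=(\mathbb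 C;\,0,\,1,\,u\,i^{n^2+1})$, and for $k\ge2$, $\mathcal W^k_1(u)$ is an HVS with $h=J_k$ and $b=0\oplus b^{k-1}_u$; * for $0<|\lambda|<1$: $$\mathcal V^{2k}_\lambda=\left(\mathbb C^{2k};\begin{pmatrix}0&I\\ \varepsilon I&0\end{pmatrix},\begin{pmatrix}\lambda J_k&0\\0&\bar\lambda^{-1}(J_k^{T})^{-1}\end{pmatrix},\begin{pmatrix}0&\varepsilon(\lambda J_k-I)\\ \bar\lambda^{-1}(J_k^{T})^{-1}-I&0\end{pmatrix}\right).$$ If an HVS $\mathcal V$ is isomorphic to $\bigoplus q^k_\lambda\cdot\mathcal V^{2k}_\lambda\oplus\bigoplus p^k_\lambda(u)\cdot\mathcal W^k_\lambda(u)$ (a finite sum over $k\ge1$, $u=\pm1$, with $0<|\lambda|<1$ in the first part and $|\lambda|=1$ in the second), then the $p^k_\lambda(u)$, $q^k_\lambda$ are called H-numbers of $\mathcal V$. Given H-numbers: * the mod 2 spectrum $Sp$ is the finite multiset in $(0,2]$ in which $\alpha$ occurs $\sum_{k\text{ odd},\,u}\frac{k-uv}{2}p^k_\lambda(u)+\sum_{k\text{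 even},\,u}\frac k2p^k_\lambda(u)$ times, where $\lambda=e^{2\pi i\alpha}$, $v=(-1)^{\lfloor\alpha\rfloor}$; * the extended spectrum is the multiset $ESp=Sp\cup ISp$ in $(0,2]\times i\mathbb R$, where $ISp$ consists of non-real numbers: for $0<|\lambda|<1$ and $x_0\in(0,1]$, $y_0>0$ with $e^{2\pi i(x_0+iy_0)}=\lambda$, both $x_0+iy_0$ and $1+x_0-iy_0$ occur $\sum_kk\,q^k_\lambda$ times, and nothing else occurs. All cardinalities $\#$ are counted with multiplicity. **Seifert matrices.** Let $S$ be a real square matrix (for example a Seifert matrix of an oriented link $L\subset S^3$). For $\zeta\in S^1\setminus\{1\}$ let $\sigma(\zeta)$ be the signature of the hermitian matrix $(1-\zeta)S+(1-\bar\zeta)S^{T}$; for a link this is its Tristram--Levine signature. Real S-equivalence is the equivalence relation on real square matrices generated by $S\sim ASA^{T}$ ($A$ real and invertible) and $$S\sim\begin{pmatrix}S&\xi&0\\0&0&1\\0&0&0\end{pmatrix},\qquad S\sim\begin{pmatrix}S&0&0\\ \xi^{T}&0&0\\0&1&0\end{pmatrix}.$$ A nondegenerate part of $S$ is a matrix $S_{\rm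 ndeg}$ with $\det S_{\rm ndeg}\ne0$ such that $S$ is real S-equivalent to $0\oplus S_{\rm ndeg}$, where $0$ is a square zero matrix (sizes $0$ are allowed). Its variation structure is the HVS with $\varepsilon=-1$ ($n=1$), $V=(S_{\rm ndeg}^{T})^{-1}$, $b=S_{\rm ndeg}-S_{\rm ndeg}^{T}$, $h=(S_{\rm ndeg}^{T})^{-1}S_{\rm ndeg}$; for a link $L$ it is denoted $\mathcal V_L$. **Corollary.** Every real square matrix $S$ has a nondegenerate part, and the variation structure of every nondegenerate part of $S$ has H-numbers. For every nondegenerate part of $S$ and all H-numbers of its variation structure, with $Sp$ and $ESp$ as above, and for every $x\in(0,1)$ and $\zeta=e^{2\pi ix}$: (a) $$\sigma(\zeta)=-\#Sp\cap(x,x+1)+\#Sp\setminus[x,x+1]+\sum_{k\text{ even},\,u=\pm1}u\,p^k_\zeta(u).$$ In particular, if $\zeta$ is not an eigenvalue of the monodromy $h$, then $\sigma(\zeta)=-\#Sp\cap(x,x+1)+\#Sp\setminus(x,x+1)$. (b) Let $H_x=(x,x+1)\times i\mathbb R$. If $ESp\cap\partial H_x=\emptyset$, then $$\sigma(\zeta)=-\#ESp\cap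 H_x+\#ESp\setminus H_x.$$ -/

import Mathlib

open scoped Matrix

noncomputable section

/-! ### Hermitian variation structures

Everything is written in coordinates: for `U = ℂ^ι` a linear map `U → U*` or `U* → U` is given by
its matrix in the standard basis and its dual basis, so that dualizing is transposing and
"conjugate of the dual map" is the conjugate transpose. -/

/-- An `ε`-hermitian variation structure `(U; b, h, V)` on `U = ℂ^ι`, where `ε = (-1)^n`. -/
structure HVS (n : ℕ) (ι : Type) [Fintype ι] [DecidableEq ι] where
  /-- the (possibly degenerate) `ε`-hermitian form -/
  b : Matrix ι ι ℂ
  /-- the monodromy operator -/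
  h : Matrix ι ι ℂ
  /-- the variation operator -/
  V : Matrix ι ι ℂ
  b_hermitian : bᴴ = ((-1 : ℂ) ^ n) • b
  h_isUnit : IsUnit h
  h_orthogonal : hᴴ * b * h = b
  V_conj : Vᴴ = -(((-1 : ℂ) ^ n) • (V * hᴴ))
  V_mul_b : V * b = h - 1

namespace HVS

/-- An isomorphism is an invertible `φ : U → U'` with `b = φ̄* b' φ`, `h = φ⁻¹ h' φ`,
`V = φ⁻¹ V' (φ̄*)⁻¹`; here `ψ` is the inverse of `φ`. -/
def Iso {n : ℕ} {ι κ : Type} [Fintype ι] [DecidableEq ι] [Fintype κ] [DecidableEq κ]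
    (A : HVS n ι) (B : HVS n κ) : Prop :=
  ∃ (φ : Matrix κ ι ℂ) (ψ : Matrix ι κ ℂ), ψ * φ = 1 ∧ φ * ψ = 1 ∧
    A.b = φᴴ * B.b * φ ∧ A.h = ψ * B.h * φ ∧ A.V = ψ * B.V * ψᴴ

/-- The direct sum of a finite family of variation structures (with the same sign). -/
def directSum {n r : ℕ} {κ : Fin r → Type} [∀ i, Fintype (κ i)] [∀ i, DecidableEq (κ i)]
    (W : ∀ i, HVS n (κ i)) : HVS n (Σ i, κ i) where
  b := Matrix.blockDiagonal' fun i => (W i).b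
  h := Matrix.blockDiagonal' fun i => (W i).h
  V := Matrix.blockDiagonal' fun i => (W i).V
  b_hermitian := by
    rw [Matrix.blockDiagonal'_conjTranspose, ← Matrix.blockDiagonal'_smul]
    congr 1; funext i; exact (W i).b_hermitian
  h_isUnit := by
    refine IsUnit.of_mul_eq_one (Matrix.blockDiagonal' fun i => ((W i).h)⁻¹) ?_
    rw [← Matrix.blockDiagonal'_mul, ← Matrix.blockDiagonal'_one]
    congr 1; funext i
    exact Matrix.mul_nonsing_inv _ ((Matrix.isUnit_iff_isUnit_det _).1 (W i).h_isUnit)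
  h_orthogonal := by
    rw [Matrix.blockDiagonal'_conjTranspose, ← Matrix.blockDiagonal'_mul,
      ← Matrix.blockDiagonal'_mul]
    congr 1; funext i; exact (W i).h_orthogonal
  V_conj := by
    rw [Matrix.blockDiagonal'_conjTranspose, Matrix.blockDiagonal'_conjTranspose,
      ← Matrix.blockDiagonal'_mul, ← Matrix.blockDiagonal'_smul, ← Matrix.blockDiagonal'_neg]
    congr 1; funext i; exact (W i).V_conj
  V_mul_b := by
    rw [← Matrix.blockDiagonal'_mul, ← Matrix.blockDiagonal'_one, ← Matrix.blockDiagonal'_sub]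
    congr 1; funext i; exact (W i).V_mul_b

end HVS

/-! ### The indecomposable simple structures -/

/-- The upper triangular `k × k` Jordan block `J_k` with eigenvalue `1`. -/
def jordanOne (k : ℕ) : Matrix (Fin k) (Fin k) ℂ :=
  Matrix.of fun i j => if j = i ∨ (j : ℕ) = i + 1 then 1 else 0

/-- `b` is a form `b^k_u` with `k = m + 1`: a nondegenerate `ε`-hermitian form, `ε = (-1)^n`,
preserved by `J_k`, whose upper right entry is `u i^(-n²-k+1)`. -/
def IsJordanForm (n m : ℕ) (u : ℤˣ) (b : Matrix (Fin (m + 1)) (Fin (m + 1)) ℂ) : Prop :=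
  IsUnit b ∧ bᴴ = ((-1 : ℂ) ^ n) • b ∧ (jordanOne (m + 1))ᴴ * b * jordanOne (m + 1) = b ∧
    b 0 (Fin.last m) = ((u : ℤ) : ℂ) * Complex.I ^ (-(n : ℤ) ^ 2 - (m + 1 : ℤ) + 1)

/-- `𝒱` is a copy of `𝒱^k_μ(u)`: `h = μ J_k`, `b = b^k_u` and `V = (h - 1) b⁻¹`. -/
def IsNondegBlock (n : ℕ) (μ : ℂ) (u : ℤˣ) : (k : ℕ) → HVS n (Fin k) → Prop
  | 0, _ => False
  | m + 1, 𝒱 => IsJordanForm n m u 𝒱.b ∧ 𝒱.h = μ • jordanOne (m + 1) ∧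
      𝒱.V = (μ • jordanOne (m + 1) - 1) * (𝒱.b)⁻¹

/-- `𝒱` is a copy of the degenerate structure with `h = J_k`: for `k = 1`,
`(ℂ; 0, 1, u i^(n²+1))`; for `k ≥ 2`, `h = J_k` and `b = 0 ⊕ b^(k-1)_u` (these data determine `V`
up to isomorphism). -/
def IsDegenBlock (n : ℕ) (u : ℤˣ) : (k : ℕ) → HVS n (Fin k) → Prop
  | 0, _ => False
  | 1, 𝒱 => 𝒱.b = 0 ∧ 𝒱.h = 1 ∧ 𝒱.V 0 0 = ((u : ℤ) : ℂ) * Complex.I ^ (n ^ 2 + 1)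
  | m + 2, 𝒱 => 𝒱.h = jordanOne (m + 2) ∧ (∀ j, 𝒱.b 0 j = 0) ∧ (∀ i, 𝒱.b i 0 = 0) ∧
      IsJordanForm n m u (𝒱.b.submatrix Fin.succ Fin.succ)

/-- Labels of the indecomposable simple structures: `circle μ k u` stands for `𝒲^k_μ(u)`,
`pair μ k` for `𝒱^{2k}_μ`. -/
inductive BlockLabel
  | circle (μ : ℂ) (k : ℕ) (u : ℤˣ)
  | pair (μ : ℂ) (k : ℕ)

namespace BlockLabel

/-- The index set of the coordinates of a block. -/
def Idx : BlockLabel → Type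
  | circle _ k _ => Fin k
  | pair _ k => Fin k ⊕ Fin k

instance (B : BlockLabel) : Fintype B.Idx :=
  match B with
  | circle _ k _ => inferInstanceAs (Fintype (Fin k))
  | pair _ k => inferInstanceAs (Fintype (Fin k ⊕ Fin k))

instance (B : BlockLabel) : DecidableEq B.Idx :=
  match B with
  | circle _ k _ => inferInstanceAs (DecidableEq (Fin k))
  | pair _ k => inferInstanceAs (DecidableEq (Fin k ⊕ Fin k))

/-- `𝒱` is a copy of `𝒱^{2k}_μ`, given by the standard block matrices. -/
def IsPairBlock (n : ℕ) (μ : ℂ) (k : ℕ) (𝒱 : HVS n (Fin k ⊕ Fin k)) : Prop :=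
  𝒱.b = Matrix.fromBlocks 0 1 (((-1 : ℂ) ^ n) • 1) 0 ∧
  𝒱.h = Matrix.fromBlocks (μ • jordanOne k) 0 0 ((starRingEnd ℂ μ)⁻¹ • ((jordanOne k)ᴴ)⁻¹) ∧
  𝒱.V = Matrix.fromBlocks 0 (((-1 : ℂ) ^ n) • (μ • jordanOne k - 1))
    ((starRingEnd ℂ μ)⁻¹ • ((jordanOne k)ᴴ)⁻¹ - 1) 0

/-- `𝒱` is the indecomposable structure with the given label, the label being admissible:
`|μ| = 1` and `k ≥ 1` for `𝒲^k_μ(u)`, `0 < |μ| < 1` and `k ≥ 1` for `𝒱^{2k}_μ`. -/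
def IsModel (n : ℕ) : (B : BlockLabel) → HVS n B.Idx → Prop
  | circle μ k u, 𝒱 => ‖μ‖ = 1 ∧ 1 ≤ k ∧
      (μ ≠ 1 → IsNondegBlock n μ u k 𝒱) ∧ (μ = 1 → IsDegenBlock n u k 𝒱)
  | pair μ k, 𝒱 => 0 < ‖μ‖ ∧ ‖μ‖ < 1 ∧ 1 ≤ k ∧ IsPairBlock n μ k 𝒱

end BlockLabel

/-! ### H-numbers -/

/-- `p (μ, k, u) = p^k_μ(u)` and `q (μ, k) = q^k_μ` are the H-numbers of `𝒱`: the multiplicities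
of `𝒲^k_μ(u)` and of `𝒱^{2k}_μ` in an expression of `𝒱` as a direct sum of indecomposable
structures. -/
def IsHNumbers {n : ℕ} {ι : Type} [Fintype ι] [DecidableEq ι] (𝒱 : HVS n ι)
    (p : ℂ × ℕ × ℤˣ →₀ ℕ) (q : ℂ × ℕ →₀ ℕ) : Prop :=
  ∃ (r : ℕ) (B : Fin r → BlockLabel) (W : ∀ i, HVS n (B i).Idx),
    (∀ i, (B i).IsModel n (W i)) ∧ 𝒱.Iso (HVS.directSum W) ∧
    (∀ μ k u, p (μ, k, u) = Nat.card {i : Fin r // B i = BlockLabel.circle μ k u}) ∧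
    (∀ μ k, q (μ, k) = Nat.card {i : Fin r // B i = BlockLabel.pair μ k})

/-! ### The mod 2 spectrum and the extended spectrum -/

/-- `e^{2πiz}` -/
def expTwoPiI (z : ℂ) : ℂ := Complex.exp (2 * Real.pi * Complex.I * z)

theorem finite_expTwoPiI_fiber (μ : ℂ) :
    {z : ℂ | 0 < z.re ∧ z.re ≤ 2 ∧ expTwoPiI z = μ}.Finite := by
  by_cases hne : ∃ w : ℂ, expTwoPiI w = μ
  · obtain ⟨w, hw⟩ := hne
    refine (Set.Finite.image (fun m : ℤ => w + m)
      (Set.finite_Icc (⌊-w.re⌋) (⌈2 - w.re⌉))).subset ?_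
    rintro z ⟨h0, h2, hz⟩
    have hzw : Complex.exp (2 * Real.pi * Complex.I * z)
        = Complex.exp (2 * Real.pi * Complex.I * w) := hz.trans hw.symm
    obtain ⟨m, hm⟩ := Complex.exp_eq_exp_iff_exists_int.1 hzw
    have hz' : z = w + m := by
      have h3 : (2 * Real.pi * Complex.I : ℂ) ≠ 0 := by
        simp [Complex.I_ne_zero, Real.pi_ne_zero]
      apply mul_left_cancel₀ h3
      rw [hm]; ring
    have hre : z.re = w.re + m := by rw [hz']; simp
    refine ⟨m, ⟨?_, ?_⟩, hz'.symm⟩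
    · have h5 : (⌊-w.re⌋ : ℝ) ≤ m := (Int.floor_le _).trans (by linarith)
      exact_mod_cast h5
    · have h5 : (m : ℝ) ≤ ⌈2 - w.re⌉ := le_trans (by linarith) (Int.le_ceil _)
      exact_mod_cast h5
  · refine Set.finite_empty.subset ?_
    rintro z ⟨_, _, hz⟩
    exact hne ⟨z, hz⟩

/-- The contribution of one block `𝒲^k_μ(u)` to the multiplicity of `α` in the spectrum, where
`e^{2πiα} = μ`: it is `(k - uv)/2` with `v = (-1)^⌊α⌋` if `k` is odd and `k/2` if `k` is even.
For `μ = 1` this gives `(k + u)/2` at `α = 1` and `(k - u)/2` at `α = 2` if `k` is odd. -/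
def spCoeff (k : ℕ) (u : ℤˣ) (α : ℝ) : ℕ :=
  if Odd k then (((k : ℤ) - (u : ℤ) * (((-1 : ℤˣ) ^ ⌊α⌋ : ℤˣ) : ℤ)) / 2).toNat else k / 2

open Classical in
/-- The multiplicity `s(α)` of `α` in the mod 2 spectrum. -/
def spMult (p : ℂ × ℕ × ℤˣ →₀ ℕ) (α : ℝ) : ℕ :=
  if 0 < α ∧ α ≤ 2 then
    p.sum fun x m => if x.1 = expTwoPiI α then spCoeff x.2.1 x.2.2 α * m else 0
  else 0

theorem finite_support_spMult (p : ℂ × ℕ × ℤˣ →₀ ℕ) : (Function.support (spMult p)).Finite := by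
  classical
  have hfin : (⋃ x ∈ (p.support : Set (ℂ × ℕ × ℤˣ)),
      {z : ℂ | 0 < z.re ∧ z.re ≤ 2 ∧ expTwoPiI z = x.1}).Finite :=
    p.support.finite_toSet.biUnion fun x _ => finite_expTwoPiI_fiber x.1
  refine (hfin.preimage (f := fun α : ℝ => (α : ℂ))
    (Complex.ofReal_injective.injOn)).subset ?_
  intro α hα
  rw [Function.mem_support, spMult] at hα
  split_ifs at hα with h
  · obtain ⟨x, hx, hne⟩ := Finset.exists_ne_zero_of_sum_ne_zero hα
    simp only [Set.mem_preimage, Set.mem_iUnion]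
    refine ⟨x, hx, by simpa using h.1, by simpa using h.2, ?_⟩
    by_contra hcon
    exact hne (if_neg fun h' => hcon h'.symm)
  · exact absurd rfl hα

/-- The mod 2 spectrum `Sp`: the finite multiset of reals in `(0,2]` in which each `α` occurs
`s(α)` times. -/
def modTwoSpectrum (p : ℂ × ℕ × ℤˣ →₀ ℕ) : Multiset ℝ :=
  Finsupp.toMultiset (Finsupp.ofSupportFinite (spMult p) (finite_support_spMult p))

open Classical in
/-- The multiplicity `s(z)` of `z` in the non-real part `ISp` of the extended spectrum. -/
def ispMult (q : ℂ × ℕ →₀ ℕ) (z : ℂ) : ℕ :=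
  if 0 < z.re ∧ z.re ≤ 1 ∧ 0 < z.im then
    q.sum fun x m => if expTwoPiI z = x.1 then x.2 * m else 0
  else if 1 < z.re ∧ z.re ≤ 2 ∧ z.im < 0 then
    q.sum fun x m => if expTwoPiI z = 1 / starRingEnd ℂ x.1 then x.2 * m else 0
  else 0

theorem finite_support_ispMult (q : ℂ × ℕ →₀ ℕ) : (Function.support (ispMult q)).Finite := by
  classical
  have hfin : (⋃ x ∈ (q.support : Set (ℂ × ℕ)),
      ({z : ℂ | 0 < z.re ∧ z.re ≤ 2 ∧ expTwoPiI z = x.1} ∪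
        {z : ℂ | 0 < z.re ∧ z.re ≤ 2 ∧ expTwoPiI z = 1 / starRingEnd ℂ x.1})).Finite :=
    q.support.finite_toSet.biUnion fun x _ =>
      (finite_expTwoPiI_fiber _).union (finite_expTwoPiI_fiber _)
  refine hfin.subset ?_
  intro z hz
  rw [Function.mem_support, ispMult] at hz
  simp only [Set.mem_iUnion]
  split_ifs at hz with h h'
  · obtain ⟨x, hx, hne⟩ := Finset.exists_ne_zero_of_sum_ne_zero hz
    refine ⟨x, hx, Or.inl ⟨h.1, by linarith [h.2.1], ?_⟩⟩
    by_contra hcon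
    exact hne (if_neg hcon)
  · obtain ⟨x, hx, hne⟩ := Finset.exists_ne_zero_of_sum_ne_zero hz
    refine ⟨x, hx, Or.inr ⟨by linarith [h'.1], h'.2.1, ?_⟩⟩
    by_contra hcon
    exact hne (if_neg hcon)
  · exact absurd rfl hz

/-- The extended spectrum `ESp = Sp ∪ ISp`, a finite multiset of complex numbers with real part
in `(0,2]`. -/
def extendedSpectrum (p : ℂ × ℕ × ℤˣ →₀ ℕ) (q : ℂ × ℕ →₀ ℕ) : Multiset ℂ :=
  (modTwoSpectrum p).map (fun α : ℝ => (α : ℂ)) +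
    Finsupp.toMultiset (Finsupp.ofSupportFinite (ispMult q) (finite_support_ispMult q))

/-- The open vertical strip `H_x = (x, x+1) × iℝ`. -/
def strip (x : ℝ) : Set ℂ := {z | x < z.re ∧ z.re < x + 1}

open Classical in
/-- `#M ∩ A`, counted with multiplicity. -/
def cardIn {α : Type} (M : Multiset α) (A : Set α) : ℕ := (M.filter (· ∈ A)).card

open Classical in
/-- `#M ∖ A`, counted with multiplicity. -/
def cardOut {α : Type} (M : Multiset α) (A : Set α) : ℕ := (M.filter (· ∉ A)).card

open Classical in
/-- `∑_{k even, u = ±1} u p^k_ζ(u)`. -/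
def evenTerm (p : ℂ × ℕ × ℤˣ →₀ ℕ) (ζ : ℂ) : ℤ :=
  p.sum fun x m => if x.1 = ζ ∧ Even x.2.1 then ((x.2.2 : ℤ)) * (m : ℤ) else 0

/-! ### Seifert matrices, S-equivalence and the signature function -/

/-- The elementary steps of real S-equivalence: congruence `S ↦ A S Aᵀ` with `A` invertible, and
the row and column enlargements
`[[S, ξ, 0], [0, 0, 1], [0, 0, 0]]` and `[[S, 0, 0], [ξᵀ, 0, 0], [0, 1, 0]]`. -/
inductive SStep : (Σ N : ℕ, Matrix (Fin N) (Fin N) ℝ) → (Σ N : ℕ, Matrix (Fin N) (Fin N) ℝ) → Prop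
  | congr {N : ℕ} (S A : Matrix (Fin N) (Fin N) ℝ) (hA : IsUnit A) :
      SStep ⟨N, S⟩ ⟨N, A * S * Aᵀ⟩
  | colEnlarge {N : ℕ} (S : Matrix (Fin N) (Fin N) ℝ) (ξ : Fin N → ℝ) :
      SStep ⟨N, S⟩ ⟨N + 2, Matrix.reindex finSumFinEquiv finSumFinEquiv
        (Matrix.fromBlocks S (Matrix.of fun i => ![ξ i, 0]) 0 !![0, 1; 0, 0])⟩
  | rowEnlarge {N : ℕ} (S : Matrix (Fin N) (Fin N) ℝ) (ξ : Fin N → ℝ) :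
      SStep ⟨N, S⟩ ⟨N + 2, Matrix.reindex finSumFinEquiv finSumFinEquiv
        (Matrix.fromBlocks S 0 (Matrix.of ![ξ, 0]) !![0, 0; 1, 0])⟩

/-- Real S-equivalence: the equivalence relation generated by the elementary steps. -/
def SEquivalent {M N : ℕ} (S : Matrix (Fin M) (Fin M) ℝ) (T : Matrix (Fin N) (Fin N) ℝ) : Prop :=
  Relation.EqvGen SStep ⟨M, S⟩ ⟨N, T⟩

/-- `T` is a nondegenerate part `S_ndeg` of `S`: `det T ≠ 0` and `S` is S-equivalent over `ℝ` to
`0 ⊕ T` with a square zero block of some size (both sizes may be `0`). -/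
def IsNondegPart {N m : ℕ} (S : Matrix (Fin N) (Fin N) ℝ) (T : Matrix (Fin m) (Fin m) ℝ) : Prop :=
  T.det ≠ 0 ∧ ∃ r : ℕ, SEquivalent S (Matrix.reindex finSumFinEquiv finSumFinEquiv
    (Matrix.fromBlocks (0 : Matrix (Fin r) (Fin r) ℝ) 0 0 T))

/-- The variation structure with sign `ε = -1` of an invertible real matrix `T`:
`V = (Tᵀ)⁻¹`, `b = T - Tᵀ`, `h = (Tᵀ)⁻¹ T`. -/
def variationStructure {m : ℕ} (T : Matrix (Fin m) (Fin m) ℝ) (hT : T.det ≠ 0) :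
    HVS 1 (Fin m) where
  b := (T - Tᵀ).map Complex.ofReal
  h := ((Tᵀ)⁻¹ * T).map Complex.ofReal
  V := ((Tᵀ)⁻¹).map Complex.ofReal
  b_hermitian := by
    ext i j
    simp
  h_isUnit := by
    have h1 : IsUnit ((Tᵀ)⁻¹ * T) := by
      rw [Matrix.isUnit_iff_isUnit_det, Matrix.det_mul, Matrix.det_nonsing_inv,
        Matrix.det_transpose]
      simp [hT]
    exact h1.map (Complex.ofRealHom.mapMatrix)
  h_orthogonal := by
    have hu : IsUnit T.det := isUnit_iff_ne_zero.2 hT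
    have hu' : IsUnit (Tᵀ).det := by rwa [Matrix.det_transpose]
    have key : ((Tᵀ)⁻¹ * T)ᵀ * (T - Tᵀ) * ((Tᵀ)⁻¹ * T) = T - Tᵀ := by
      have e : ((Tᵀ)⁻¹ * T)ᵀ = Tᵀ * T⁻¹ := by
        rw [Matrix.transpose_mul, Matrix.transpose_nonsing_inv, Matrix.transpose_transpose]
      rw [e, Matrix.mul_sub, Matrix.sub_mul, Matrix.mul_assoc Tᵀ T⁻¹ T,
        Matrix.nonsing_inv_mul _ hu, Matrix.mul_one, ← Matrix.mul_assoc Tᵀ (Tᵀ)⁻¹ T,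
        Matrix.mul_nonsing_inv _ hu', Matrix.one_mul, Matrix.mul_assoc (Tᵀ * T⁻¹) Tᵀ,
        ← Matrix.mul_assoc Tᵀ (Tᵀ)⁻¹ T, Matrix.mul_nonsing_inv _ hu', Matrix.one_mul,
        Matrix.mul_assoc, Matrix.nonsing_inv_mul _ hu, Matrix.mul_one]
    have hc : (((Tᵀ)⁻¹ * T).map Complex.ofReal)ᴴ = (((Tᵀ)⁻¹ * T)ᵀ).map Complex.ofReal := by
      ext i j; simp only [Matrix.conjTranspose_apply, Matrix.map_apply, Matrix.transpose_apply,
        Complex.star_def, Complex.conj_ofReal]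
    rw [hc]
    have := congrArg (Complex.ofRealHom.mapMatrix (m := Fin m)) key
    rw [map_mul, map_mul] at this
    exact this
  V_conj := by
    have hu : IsUnit T.det := isUnit_iff_ne_zero.2 hT
    have hu' : IsUnit (Tᵀ).det := by rwa [Matrix.det_transpose]
    have key : ((Tᵀ)⁻¹)ᵀ = (Tᵀ)⁻¹ * ((Tᵀ)⁻¹ * T)ᵀ := by
      rw [Matrix.transpose_mul, Matrix.transpose_nonsing_inv, Matrix.transpose_transpose,
        ← Matrix.mul_assoc, Matrix.nonsing_inv_mul _ hu', Matrix.one_mul]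
    have hc : ∀ M : Matrix (Fin m) (Fin m) ℝ,
        (M.map Complex.ofReal)ᴴ = (Mᵀ).map Complex.ofReal := by
      intro M; ext i j; simp [Matrix.conjTranspose_apply]
    rw [hc, hc, pow_one, neg_smul, one_smul, neg_neg]
    have := congrArg (Complex.ofRealHom.mapMatrix (m := Fin m)) key
    rw [map_mul] at this
    exact this
  V_mul_b := by
    have hu' : IsUnit (Tᵀ).det := by rw [Matrix.det_transpose]; exact isUnit_iff_ne_zero.2 hT
    have key : (Tᵀ)⁻¹ * (T - Tᵀ) = (Tᵀ)⁻¹ * T - 1 := by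
      rw [Matrix.mul_sub, Matrix.nonsing_inv_mul _ hu']
    have h2 := congrArg (Complex.ofRealHom.mapMatrix (m := Fin m)) key
    rw [map_mul, map_sub _ ((Tᵀ)⁻¹ * T) 1, map_one] at h2
    exact h2

/-- The matrix `M_S(ζ) = (1 - ζ) S + (1 - ζ̄) Sᵀ`. -/
def signatureMatrix {N : ℕ} (S : Matrix (Fin N) (Fin N) ℝ) (ζ : ℂ) : Matrix (Fin N) (Fin N) ℂ :=
  (1 - ζ) • S.map Complex.ofReal + (1 - starRingEnd ℂ ζ) • (Sᵀ).map Complex.ofReal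

theorem signatureMatrix_isHermitian {N : ℕ} (S : Matrix (Fin N) (Fin N) ℝ) (ζ : ℂ) :
    (signatureMatrix S ζ).IsHermitian := by
  ext i j
  simp [signatureMatrix, Matrix.conjTranspose_apply, add_comm]

/-- The signature of a hermitian matrix: the number of positive eigenvalues minus the number of
negative eigenvalues, with multiplicity. -/
def hermitianSignature {N : ℕ} {M : Matrix (Fin N) (Fin N) ℂ} (hM : M.IsHermitian) : ℤ :=
  (Nat.card {i // 0 < hM.eigenvalues i} : ℤ) - (Nat.card {i // hM.eigenvalues i < 0} : ℤ)

/-- The Tristram--Levine signature `σ(ζ)` of a Seifert matrix `S`. -/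
def tristramLevine {N : ℕ} (S : Matrix (Fin N) (Fin N) ℝ) (ζ : ℂ) : ℤ :=
  hermitianSignature (signatureMatrix_isHermitian S ζ)

end

open scoped Matrix

noncomputable section

set_option linter.unusedSectionVars false

/-! ### Sylvester's law of inertia for complex hermitian matrices -/

/-! For ζ ≠ 1 the signature is unchanged by real S-equivalence and by adding a zero block, so S may
be replaced by a nondegenerate part T. In the variation structure of T one has V⁻¹ = Tᵀ. Hence the
form L = (1 - ζ̄)(V⁻¹)ᴴ + (1 - ζ)V⁻¹ is the signature matrix of T at ζ̄, and σ(ζ̄) = σ(ζ). Since L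
is compatible with isomorphisms and direct sums, the law of inertia (`HasSignature.unique`) turns σ
into a sum over indecomposable blocks.

On one block the axioms give L(h - 1) = (1 - ζ̄)bh + (1 - ζ)b (`HVS.levineForm_mul`). With h = μJ
and μ ≠ 1 this forces L, like b, to vanish above the antidiagonal, and on the antidiagonal L is a
scalar multiple of b. If that scalar is nonzero, the signature is 0 in even size and the sign of the
middle entry in odd size. Write μ = e^{2πia} with a ∈ (0,1]. For a < 1 a block with k odd
contributes u·sign(a - x). A block with k even contributes 0, except that for a = x the antidiagonal
of L vanishes, the next one takes over, and u appears. For μ = 1 the contribution is -u for k odd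
and 0 for k even. A block 𝒱^{2k} has off-diagonal L and contributes 0.

On the spectral side the block 𝒲^k_μ(u) sits at a and a + 1 with multiplicities of sum k, which
agree for k even and differ by u up to sign for k odd. Exactly one of the two points lies in (x, x +
1) if a ≠ x, and both are boundary points if a = x; `BlockLabel.levineSign_eq` compares the two
sides. The points of 𝒱^{2k} split evenly between the inside and the outside of the strip, which
gives the version with the extended spectrum.

Existence of a nondegenerate part: a vector of ker S that is not in ker Sᵀ exhibits S as congruent
to an enlargement of a smaller matrix; if there is none, the kernel splits off as a zero block
(`exists_isNondegPart`).

Existence of H-numbers is the classification of nondegenerate sesquilinear forms A(x, y) = x̄ᵀV⁻¹y,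
whose asymmetry is h: A(x, hy) is the conjugate of A(y, x). The form pairs the generalized
eigenspaces of λ and 1/λ̄. A Jordan chain of maximal length (|λ| = 1), or a pair of dual chains (|λ|
≠ 1), spans an h-invariant subspace on which A is a model. Its orthogonal complement is again
h-invariant and nondegenerate, so induction on the dimension applies
(`IsAsymmetry.exists_orthogonal_frames`). -/

/-- `M` is congruent to a real diagonal matrix whose entries have signs adding up to `s`. -/
def HasSignature {ι : Type} [Fintype ι] [DecidableEq ι] (M : Matrix ι ι ℂ) (s : ℤ) : Prop :=
  ∃ (P : Matrix ι ι ℂ) (d : ι → ℝ), IsUnit P ∧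
    Pᴴ * M * P = Matrix.diagonal (fun i => (d i : ℂ)) ∧ ∑ i, (SignType.sign (d i) : ℤ) = s

section Signature

variable {ι κ : Type} [Fintype ι] [DecidableEq ι] [Fintype κ] [DecidableEq κ]

theorem star_mulVec_dotProduct_mulVec {μ : Type} [Fintype μ]
    (M : Matrix ι ι ℂ) (P : Matrix ι μ ℂ) (x y : μ → ℂ) :
    star (P *ᵥ x) ⬝ᵥ (M *ᵥ (P *ᵥ y)) = star x ⬝ᵥ ((Pᴴ * M * P) *ᵥ y) := by
  rw [Matrix.star_mulVec, Matrix.mulVec_mulVec, ← Matrix.dotProduct_mulVec, Matrix.mulVec_mulVec,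
    Matrix.mul_assoc]

theorem star_dotProduct_diagonal_mulVec_re (d : ι → ℝ) (x : ι → ℂ) :
    (star x ⬝ᵥ (Matrix.diagonal (fun i => (d i : ℂ)) *ᵥ x)).re = ∑ i, d i * ‖x i‖ ^ 2 := by
  simp only [dotProduct, Matrix.mulVec_diagonal, Complex.re_sum, Pi.star_apply]
  refine Finset.sum_congr rfl fun i _ => ?_
  have : star (x i) * ((d i : ℂ) * x i) = ((d i * ‖x i‖ ^ 2 : ℝ) : ℂ) := by
    have h := Complex.conj_mul' (x i)
    rw [Complex.star_def]
    push_cast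
    rw [← h]; ring
  rw [this, Complex.ofReal_re]

/-- Extension of a vector by zero from a subset of the coordinates. -/
def extendZero (p : ι → Prop) [DecidablePred p] : ({i // p i} → ℂ) →ₗ[ℂ] (ι → ℂ) where
  toFun c i := if h : p i then c ⟨i, h⟩ else 0
  map_add' a b := by ext i; by_cases h : p i <;> simp [h]
  map_smul' a b := by ext i; by_cases h : p i <;> simp [h]

theorem extendZero_apply_of_not {p : ι → Prop} [DecidablePred p] (c : {i // p i} → ℂ) {i : ι}
    (h : ¬ p i) : extendZero p c i = 0 := by simp [extendZero, h]

theorem extendZero_injective (p : ι → Prop) [DecidablePred p] :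
    Function.Injective (extendZero p) := by
  intro a b hab
  ext ⟨i, hi⟩
  have := congrFun hab i
  simpa [extendZero, hi] using this

theorem isUnit_mulVec_injective {P : Matrix ι ι ℂ} (hP : IsUnit P) :
    Function.Injective P.mulVec :=
  Matrix.mulVec_injective_iff_isUnit.2 hP

/-- The span of the positive directions meets `U` only in 0: on a common vector the form is a sum of
nonnegative terms and is at most 0, so every term vanishes. This dimension bound yields both the law
of inertia and the signatures of antitriangular matrices. -/
theorem card_pos_add_finrank_le {M P : Matrix ι ι ℂ} {d : ι → ℝ}
    (hM : Pᴴ * M * P = Matrix.diagonal (fun i => (d i : ℂ))) (U : Submodule ℂ (ι → ℂ))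
    (hU : ∀ x ∈ U, (star x ⬝ᵥ (M *ᵥ x)).re ≤ 0) :
    Fintype.card {i // 0 < d i} + Module.finrank ℂ U ≤ Fintype.card ι := by
  classical
  let f : (({i // 0 < d i} → ℂ) × U) →ₗ[ℂ] (ι → ℂ) :=
    LinearMap.coprod (P.mulVecLin ∘ₗ extendZero (fun i => 0 < d i)) U.subtype
  have hf : Function.Injective f := by
    rw [injective_iff_map_eq_zero]
    rintro ⟨c, u⟩ h
    have h1 : P *ᵥ (extendZero (fun i => 0 < d i) c) + (u : ι → ℂ) = 0 := h
    set y := extendZero (fun i => 0 < d i) c with hy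
    have hu : (u : ι → ℂ) = P *ᵥ (-y) := by
      rw [Matrix.mulVec_neg]; exact eq_neg_of_add_eq_zero_right h1
    have h2 := hU u u.2
    rw [hu, star_mulVec_dotProduct_mulVec, hM, star_dotProduct_diagonal_mulVec_re] at h2
    have hnn : ∀ i ∈ Finset.univ, 0 ≤ d i * ‖(-y) i‖ ^ 2 := by
      intro i _
      by_cases hi : 0 < d i
      · positivity
      · simp [hy, extendZero_apply_of_not c hi]
    have h3 := (Finset.sum_eq_zero_iff_of_nonneg hnn).1 (le_antisymm h2 (Finset.sum_nonneg hnn))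
    have hc : c = 0 := by
      apply extendZero_injective (fun i => 0 < d i)
      rw [map_zero, ← hy]
      ext i
      by_cases hi : 0 < d i
      · have := h3 i (Finset.mem_univ i)
        simpa [hi.ne'] using this
      · exact extendZero_apply_of_not c hi
    have hy0 : y = 0 := by rw [hy, hc, map_zero]
    have hu0 : u = 0 := by
      apply Subtype.ext
      rw [hu, hy0]; simp
    rw [hc, hu0]; rfl
  have := LinearMap.finrank_le_finrank_of_injective hf
  simpa [Module.finrank_prod] using this

theorem card_pos_le_card_pos {M P P' : Matrix ι ι ℂ} {d d' : ι → ℝ}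
    (hM : Pᴴ * M * P = Matrix.diagonal (fun i => (d i : ℂ))) (hP' : IsUnit P')
    (hM' : P'ᴴ * M * P' = Matrix.diagonal (fun i => (d' i : ℂ))) :
    Fintype.card {i // 0 < d i} ≤ Fintype.card {i // 0 < d' i} := by
  classical
  let g : ({i // ¬ 0 < d' i} → ℂ) →ₗ[ℂ] (ι → ℂ) :=
    P'.mulVecLin ∘ₗ extendZero (fun i => ¬ 0 < d' i)
  have hg : Function.Injective g :=
    (isUnit_mulVec_injective hP').comp (extendZero_injective _)
  -- The directions of the second diagonalization with `d' i ≤ 0` span a subspace on which the form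
  -- is nonpositive.
  have h1 := card_pos_add_finrank_le hM (LinearMap.range g) (by
    rintro _ ⟨c, rfl⟩
    change (star (P' *ᵥ _) ⬝ᵥ (M *ᵥ (P' *ᵥ _))).re ≤ 0
    rw [star_mulVec_dotProduct_mulVec, hM', star_dotProduct_diagonal_mulVec_re]
    refine Finset.sum_nonpos fun i _ => ?_
    by_cases hi : 0 < d' i
    · rw [extendZero_apply_of_not c (by simpa using hi)]; simp
    · exact mul_nonpos_of_nonpos_of_nonneg (not_lt.1 hi) (by positivity))
  rw [LinearMap.finrank_range_of_inj hg, Module.finrank_fintype_fun_eq_card,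
    Fintype.card_subtype_compl] at h1
  have := Fintype.card_subtype_le (fun i => 0 < d' i)
  omega

theorem sum_sign_eq_card_sub_card (d : ι → ℝ) :
    ∑ i, (SignType.sign (d i) : ℤ) =
      (Fintype.card {i // 0 < d i} : ℤ) - Fintype.card {i // 0 < -d i} := by
  classical
  rw [Fintype.card_subtype, Fintype.card_subtype, Finset.card_filter, Finset.card_filter]
  push_cast
  rw [← Finset.sum_sub_distrib]
  refine Finset.sum_congr rfl fun i _ => ?_
  rcases lt_trichotomy (d i) 0 with h | h | h
  · simp [h, h.not_gt]
  · simp [h]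
  · simp [h, h.not_gt]

theorem congr_neg_eq_diagonal {M P : Matrix ι ι ℂ} {d : ι → ℝ}
    (hM : Pᴴ * M * P = Matrix.diagonal (fun i => (d i : ℂ))) :
    Pᴴ * (-M) * P = Matrix.diagonal (fun i => ((-d i : ℝ) : ℂ)) := by
  rw [Matrix.mul_neg, Matrix.neg_mul, hM, Matrix.diagonal_neg]
  congr 1; ext i; simp

theorem HasSignature.unique {M : Matrix ι ι ℂ} {s t : ℤ} (hs : HasSignature M s)
    (ht : HasSignature M t) : s = t := by
  obtain ⟨P, d, hP, hM, rfl⟩ := hs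
  obtain ⟨P', d', hP', hM', rfl⟩ := ht
  rw [sum_sign_eq_card_sub_card, sum_sign_eq_card_sub_card,
    le_antisymm (card_pos_le_card_pos hM hP' hM') (card_pos_le_card_pos hM' hP hM),
    le_antisymm (card_pos_le_card_pos (congr_neg_eq_diagonal hM) hP' (congr_neg_eq_diagonal hM'))
      (card_pos_le_card_pos (congr_neg_eq_diagonal hM') hP (congr_neg_eq_diagonal hM))]

theorem Matrix.IsHermitian.exists_congr_diagonal_eigenvalues {M : Matrix ι ι ℂ}
    (hM : M.IsHermitian) : ∃ P : Matrix ι ι ℂ, IsUnit P ∧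
      Pᴴ * M * P = Matrix.diagonal (fun i => (hM.eigenvalues i : ℂ)) := by
  refine ⟨(hM.eigenvectorUnitary : Matrix ι ι ℂ), Unitary.isUnit_coe, ?_⟩
  have h := hM.conjStarAlgAut_star_eigenvectorUnitary
  rw [Unitary.conjStarAlgAut_apply] at h
  simpa [Matrix.star_eq_conjTranspose, Function.comp_def] using h

theorem Matrix.IsHermitian.exists_hasSignature {M : Matrix ι ι ℂ} (hM : M.IsHermitian) :
    ∃ s, HasSignature M s := by
  obtain ⟨P, hP, h⟩ := hM.exists_congr_diagonal_eigenvalues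
  exact ⟨_, P, _, hP, h, rfl⟩

theorem hasSignature_hermitianSignature {N : ℕ} {M : Matrix (Fin N) (Fin N) ℂ}
    (hM : M.IsHermitian) : HasSignature M (hermitianSignature hM) := by
  obtain ⟨P, hP, h⟩ := hM.exists_congr_diagonal_eigenvalues
  refine ⟨P, _, hP, h, ?_⟩
  rw [sum_sign_eq_card_sub_card, hermitianSignature, Nat.card_eq_fintype_card,
    Nat.card_eq_fintype_card]
  simp

theorem HasSignature.neg {M : Matrix ι ι ℂ} {s : ℤ} (h : HasSignature M s) :
    HasSignature (-M) (-s) := by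
  obtain ⟨P, d, hP, hM, rfl⟩ := h
  refine ⟨P, _, hP, congr_neg_eq_diagonal hM, ?_⟩
  simp [Left.sign_neg, ← Finset.sum_neg_distrib]

theorem HasSignature.of_congr {M Q : Matrix ι ι ℂ} {s : ℤ} (hQ : IsUnit Q)
    (h : HasSignature (Qᴴ * M * Q) s) : HasSignature M s := by
  obtain ⟨P, d, hP, hM, hs⟩ := h
  refine ⟨Q * P, d, hQ.mul hP, ?_, hs⟩
  rw [← hM, Matrix.conjTranspose_mul]
  simp only [Matrix.mul_assoc]

theorem HasSignature.submatrix {M : Matrix ι ι ℂ} {s : ℤ} (e : κ ≃ ι) (h : HasSignature M s) :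
    HasSignature (M.submatrix e e) s := by
  obtain ⟨P, d, hP, hM, rfl⟩ := h
  refine ⟨P.submatrix e e, d ∘ e, ?_, ?_, ?_⟩
  · exact (Matrix.isUnit_submatrix_equiv e e).2 hP
  · rw [Matrix.conjTranspose_submatrix, Matrix.submatrix_mul_equiv, Matrix.submatrix_mul_equiv, hM,
      Matrix.submatrix_diagonal_equiv]
    rfl
  · exact Equiv.sum_comp e (fun i => (SignType.sign (d i) : ℤ))

theorem HasSignature.of_submatrix {M : Matrix ι ι ℂ} {s : ℤ} (e : κ ≃ ι)
    (h : HasSignature (M.submatrix e e) s) : HasSignature M s := by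
  simpa using h.submatrix e.symm

/-- Allows different index types, as in an isomorphism from `Fin m` to the index type of a direct
sum. -/
theorem HasSignature.of_congr_rect {M : Matrix ι ι ℂ} {Q : Matrix ι κ ℂ} {R : Matrix κ ι ℂ} {s : ℤ}
    (hRQ : R * Q = 1) (hQR : Q * R = 1) (h : HasSignature (Qᴴ * M * Q) s) : HasSignature M s := by
  have hcard : Fintype.card ι = Fintype.card κ := Matrix.square_of_invertible Q R hQR hRQ
  let e : ι ≃ κ := Fintype.equivOfCardEq hcard
  refine HasSignature.of_congr (Q := Q.submatrix id e) ?_ ?_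
  · refine IsUnit.of_mul_eq_one (R.submatrix e id) ?_
    rw [Matrix.submatrix_mul_equiv, hQR, Matrix.submatrix_id_id]
  · have := h.submatrix e
    rw [Matrix.submatrix_mul _ _ e id e Function.bijective_id,
      Matrix.submatrix_mul _ _ e id id Function.bijective_id] at this
    exact this

theorem HasSignature.blockDiagonal' {r : ℕ} {τ : Fin r → Type} [∀ i, Fintype (τ i)]
    [∀ i, DecidableEq (τ i)] {M : ∀ i, Matrix (τ i) (τ i) ℂ} {s : Fin r → ℤ}
    (h : ∀ i, HasSignature (M i) (s i)) :
    HasSignature (Matrix.blockDiagonal' M) (∑ i, s i) := by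
  choose P d hP hM hs using h
  refine ⟨Matrix.blockDiagonal' P, fun x => d x.1 x.2, ?_, ?_, ?_⟩
  · refine IsUnit.of_mul_eq_one (Matrix.blockDiagonal' fun i => (P i)⁻¹) ?_
    rw [← Matrix.blockDiagonal'_mul, ← Matrix.blockDiagonal'_one]
    congr 1; funext i
    exact Matrix.mul_nonsing_inv _ ((Matrix.isUnit_iff_isUnit_det _).1 (hP i))
  · rw [Matrix.blockDiagonal'_conjTranspose, ← Matrix.blockDiagonal'_mul,
      ← Matrix.blockDiagonal'_mul,
      ← Matrix.blockDiagonal'_diagonal (fun i j => ((d i j : ℝ) : ℂ))]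
    congr 1; funext i; exact hM i
  · rw [Fintype.sum_sigma]
    exact Finset.sum_congr rfl fun i _ => hs i

theorem isUnit_fromBlocks_zero_zero {P : Matrix ι ι ℂ} {P' : Matrix κ κ ℂ} (hP : IsUnit P)
    (hP' : IsUnit P') : IsUnit (Matrix.fromBlocks P 0 0 P') :=
  Matrix.isUnit_fromBlocks_zero₂₁.2 ⟨hP, hP'⟩

theorem HasSignature.fromBlocks {A : Matrix ι ι ℂ} {D : Matrix κ κ ℂ} {s t : ℤ}
    (hA : HasSignature A s) (hD : HasSignature D t) :
    HasSignature (Matrix.fromBlocks A 0 0 D) (s + t) := by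
  obtain ⟨P, d, hP, hM, rfl⟩ := hA
  obtain ⟨P', d', hP', hM', rfl⟩ := hD
  refine ⟨Matrix.fromBlocks P 0 0 P', Sum.elim d d', isUnit_fromBlocks_zero_zero hP hP', ?_, ?_⟩
  · rw [Matrix.fromBlocks_conjTranspose, Matrix.fromBlocks_multiply, Matrix.fromBlocks_multiply]
    simp only [Matrix.conjTranspose_zero, Matrix.mul_zero, Matrix.zero_mul, add_zero, zero_add, hM,
      hM', Matrix.fromBlocks_diagonal]
    congr 1; ext i; cases i <;> rfl
  · rw [Fintype.sum_sum_type]; rfl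

theorem hasSignature_zero : HasSignature (0 : Matrix ι ι ℂ) 0 :=
  ⟨1, 0, isUnit_one, by ext i j; simp [Matrix.diagonal], by simp⟩

/-- Congruence by diag(1, -1) changes the matrix into its negative, so the signature equals its own
negative. -/
theorem hasSignature_offDiagonal (X : Matrix ι κ ℂ) :
    HasSignature (Matrix.fromBlocks 0 X Xᴴ 0) 0 := by
  have hH : (Matrix.fromBlocks 0 X Xᴴ 0).IsHermitian := by
    rw [Matrix.IsHermitian, Matrix.fromBlocks_conjTranspose]; simp
  obtain ⟨s, hs⟩ := hH.exists_hasSignature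
  have hneg : HasSignature (-(Matrix.fromBlocks 0 X Xᴴ 0)) s := by
    refine HasSignature.of_congr (Q := Matrix.fromBlocks 1 0 0 (-1))
      (isUnit_fromBlocks_zero_zero isUnit_one isUnit_one.neg) ?_
    convert hs using 1
    rw [Matrix.fromBlocks_conjTranspose, Matrix.fromBlocks_neg, Matrix.fromBlocks_multiply,
      Matrix.fromBlocks_multiply]
    simp
  have h := hs.neg.unique hneg
  have : s = 0 := by omega
  exact this ▸ hs

theorem HasSignature.of_zero_border {m : ℕ} {M : Matrix (Fin (m + 1)) (Fin (m + 1)) ℂ} {s : ℤ}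
    (hr : ∀ j, M 0 j = 0) (hc : ∀ i, M i 0 = 0)
    (h : HasSignature (M.submatrix Fin.succ Fin.succ) s) : HasSignature M s := by
  have h1 := h.fromBlocks (hasSignature_zero (ι := Unit))
  rw [add_zero] at h1
  let e : Fin m ⊕ Unit ≃ Fin (m + 1) :=
    (Equiv.optionEquivSumPUnit (Fin m)).symm.trans (finSuccEquiv m).symm
  refine HasSignature.of_submatrix e ?_
  convert h1 using 1
  ext i j
  rcases i with i | i <;> rcases j with j | j <;> simp [e, hr, hc]

end Signature

/-! ### Signatures of antitriangular matrices -/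

section Antitriangular

variable {k : ℕ}

/-- A square matrix all of whose entries strictly above the antidiagonal vanish, while those on
the antidiagonal do not. -/
def IsAntitriangular (M : Matrix (Fin k) (Fin k) ℂ) : Prop :=
  (∀ i j : Fin k, (i : ℕ) + j + 1 < k → M i j = 0) ∧
    ∀ i j : Fin k, (i : ℕ) + j + 1 = k → M i j ≠ 0

/-- Reversing the order of the columns makes the matrix triangular with nonzero diagonal. -/
theorem IsAntitriangular.isUnit {M : Matrix (Fin k) (Fin k) ℂ} (hM : IsAntitriangular M) :
    IsUnit M := by
  rw [← Matrix.isUnit_submatrix_equiv (Equiv.refl _) Fin.revPerm, Matrix.isUnit_iff_isUnit_det,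
    isUnit_iff_ne_zero, Matrix.det_of_isLowerTriangular]
  · refine Finset.prod_ne_zero_iff.2 fun i _ => hM.2 _ _ ?_
    simp only [Equiv.refl_apply, Fin.revPerm_apply, Fin.val_rev]
    omega
  · intro i j hij
    refine hM.1 _ _ ?_
    have : (i : ℕ) < j := hij
    simp only [Equiv.refl_apply, Fin.revPerm_apply, Fin.val_rev]
    omega

theorem card_pos_add_card_neg_of_isUnit {M P : Matrix (Fin k) (Fin k) ℂ} {d : Fin k → ℝ}
    (hM : IsUnit M) (hP : IsUnit P) (h : Pᴴ * M * P = Matrix.diagonal (fun i => (d i : ℂ))) :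
    Fintype.card {i // 0 < d i} + Fintype.card {i // 0 < -d i} = k := by
  classical
  have hu : IsUnit (Matrix.diagonal (fun i => (d i : ℂ))) := by
    rw [← h]
    exact (((Matrix.isUnit_conjTranspose P).2 hP).mul hM).mul hP
  rw [Matrix.isUnit_diagonal, Pi.isUnit_iff] at hu
  have hd : ∀ i, d i ≠ 0 := fun i h0 => by simpa [h0] using hu i
  have hc := Fintype.card_subtype_compl (fun i => 0 < d i)
  have he : Fintype.card {i // ¬ 0 < d i} = Fintype.card {i // 0 < -d i} :=
    Fintype.card_congr (Equiv.subtypeEquivRight fun i => by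
      have := hd i
      constructor
      · intro h; have := lt_of_le_of_ne (not_lt.1 h) this; linarith
      · intro h; linarith)
  have hle := Fintype.card_subtype_le (fun i => 0 < d i)
  rw [Fintype.card_fin] at hc hle
  omega

theorem star_dotProduct_mulVec_extendZero_of_lt {M : Matrix (Fin k) (Fin k) ℂ}
    (hM : IsAntitriangular M) {l : ℕ} (hl : 2 * l ≤ k) (c : {i : Fin k // (i : ℕ) < l} → ℂ) :
    star (extendZero (fun i : Fin k => (i : ℕ) < l) c) ⬝ᵥ
      (M *ᵥ extendZero (fun i : Fin k => (i : ℕ) < l) c) = 0 := by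
  refine Finset.sum_eq_zero fun i _ => ?_
  by_cases hi : (i : ℕ) < l
  · refine mul_eq_zero_of_right _ ?_
    rw [Matrix.mulVec, dotProduct]
    refine Finset.sum_eq_zero fun j _ => ?_
    by_cases hj : (j : ℕ) < l
    · rw [hM.1 i j (by omega), zero_mul]
    · rw [extendZero_apply_of_not c hj, mul_zero]
  · rw [Pi.star_apply, extendZero_apply_of_not c hi, star_zero, zero_mul]

theorem star_dotProduct_mulVec_extendZero_of_le {M : Matrix (Fin k) (Fin k) ℂ}
    (hM : IsAntitriangular M) {l : Fin k} (hl : 2 * (l : ℕ) + 1 = k)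
    (c : {i : Fin k // (i : ℕ) < l + 1} → ℂ) :
    star (extendZero (fun i : Fin k => (i : ℕ) < l + 1) c) ⬝ᵥ
      (M *ᵥ extendZero (fun i : Fin k => (i : ℕ) < l + 1) c) =
      M l l * (‖extendZero (fun i : Fin k => (i : ℕ) < l + 1) c l‖ ^ 2 : ℝ) := by
  set x := extendZero (fun i : Fin k => (i : ℕ) < l + 1) c with hx
  have hx0 : ∀ j : Fin k, (l : ℕ) < j → x j = 0 := fun j hj =>
    extendZero_apply_of_not c (by omega)
  have hne : ∀ i j : Fin k, i ≠ j → (i : ℕ) ≠ j := fun i j h h' => h (Fin.ext h')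
  rw [dotProduct, Finset.sum_eq_single l]
  · rw [Matrix.mulVec, dotProduct, Finset.sum_eq_single l]
    · push_cast
      rw [← Complex.conj_mul', Pi.star_apply, Complex.star_def]; ring
    · intro j _ hj
      rcases lt_or_gt_of_ne (hne _ _ hj) with h | h
      · rw [hM.1 l j (by omega), zero_mul]
      · rw [hx0 j h, mul_zero]
    · simp
  · intro i _ hi
    rcases lt_or_gt_of_ne (hne _ _ hi) with h | h
    · refine mul_eq_zero_of_right _ ?_
      rw [Matrix.mulVec, dotProduct]
      refine Finset.sum_eq_zero fun j _ => ?_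
      rcases le_or_gt (j : ℕ) l with hj | hj
      · rw [hM.1 i j (by omega), zero_mul]
      · rw [hx0 j hj, mul_zero]
    · rw [Pi.star_apply, hx0 i h, star_zero, zero_mul]
  · simp

theorem finrank_range_extendZero_lt {l : ℕ} (hl : l ≤ k) :
    Module.finrank ℂ (LinearMap.range (extendZero (fun i : Fin k => (i : ℕ) < l))) = l := by
  rw [LinearMap.finrank_range_of_inj (extendZero_injective _), Module.finrank_fintype_fun_eq_card]
  simpa using Fintype.card_congr (Fin.castLEquiv hl).symm

/-- The first k/2 coordinates span an isotropic subspace, so neither the positive nor the negative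
part exceeds k/2; nondegeneracy forces equality. -/
theorem IsAntitriangular.hasSignature_of_even {M : Matrix (Fin k) (Fin k) ℂ}
    (hM : IsAntitriangular M) (hH : M.IsHermitian) (hk : Even k) : HasSignature M 0 := by
  obtain ⟨l, hl⟩ := hk
  obtain ⟨P, hP, h⟩ := hH.exists_congr_diagonal_eigenvalues
  refine ⟨P, _, hP, h, ?_⟩
  have h0 := card_pos_add_card_neg_of_isUnit hM.isUnit hP h
  have h1 := card_pos_add_finrank_le h
    (LinearMap.range (extendZero (fun i : Fin k => (i : ℕ) < l))) (by
      rintro _ ⟨c, rfl⟩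
      rw [star_dotProduct_mulVec_extendZero_of_lt hM (by omega)]; simp)
  have h2 := card_pos_add_finrank_le (congr_neg_eq_diagonal h)
    (LinearMap.range (extendZero (fun i : Fin k => (i : ℕ) < l))) (by
      rintro _ ⟨c, rfl⟩
      rw [Matrix.neg_mulVec, dotProduct_neg,
        star_dotProduct_mulVec_extendZero_of_lt hM (by omega)]; simp)
  rw [finrank_range_extendZero_lt (by omega), Fintype.card_fin] at h1 h2
  rw [sum_sign_eq_card_sub_card]
  omega

/-- On the first l + 1 coordinates only the middle entry survives, so the form is nonpositive there
and the positive part is at most l. The first l coordinates are isotropic, so the negative part is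
at most l + 1. The two parts add up to 2l + 1. -/
theorem IsAntitriangular.hasSignature_neg_one {M : Matrix (Fin k) (Fin k) ℂ}
    (hM : IsAntitriangular M) (hH : M.IsHermitian) {l : Fin k} (hl : 2 * (l : ℕ) + 1 = k)
    {c : ℝ} (hc : M l l = c) (hc0 : c < 0) : HasSignature M (-1) := by
  obtain ⟨P, hP, h⟩ := hH.exists_congr_diagonal_eigenvalues
  refine ⟨P, _, hP, h, ?_⟩
  have h0 := card_pos_add_card_neg_of_isUnit hM.isUnit hP h
  have h1 := card_pos_add_finrank_le h
    (LinearMap.range (extendZero (fun i : Fin k => (i : ℕ) < l + 1))) (by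
      rintro _ ⟨x, rfl⟩
      rw [star_dotProduct_mulVec_extendZero_of_le hM hl, hc, ← Complex.ofReal_mul,
        Complex.ofReal_re]
      exact mul_nonpos_of_nonpos_of_nonneg hc0.le (by positivity))
  have h2 := card_pos_add_finrank_le (congr_neg_eq_diagonal h)
    (LinearMap.range (extendZero (fun i : Fin k => (i : ℕ) < l))) (by
      rintro _ ⟨c, rfl⟩
      rw [Matrix.neg_mulVec, dotProduct_neg,
        star_dotProduct_mulVec_extendZero_of_lt hM (by omega)]; simp)
  rw [finrank_range_extendZero_lt (by omega), Fintype.card_fin] at h1 h2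
  rw [sum_sign_eq_card_sub_card]
  omega

theorem IsAntitriangular.neg {M : Matrix (Fin k) (Fin k) ℂ} (hM : IsAntitriangular M) :
    IsAntitriangular (-M) :=
  ⟨fun i j h => by rw [Matrix.neg_apply, hM.1 i j h, neg_zero],
    fun i j h => by rw [Matrix.neg_apply]; exact neg_ne_zero.2 (hM.2 i j h)⟩

theorem IsAntitriangular.hasSignature_sign {M : Matrix (Fin k) (Fin k) ℂ}
    (hM : IsAntitriangular M) (hH : M.IsHermitian) {l : Fin k} (hl : 2 * (l : ℕ) + 1 = k)
    {c : ℝ} (hc : M l l = c) : HasSignature M (SignType.sign c) := by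
  have hc0 : c ≠ 0 := by
    rintro rfl
    exact hM.2 l l (by omega) (by simpa using hc)
  rcases lt_or_gt_of_ne hc0 with h | h
  · simpa [h] using hM.hasSignature_neg_one hH hl hc h
  · have h1 := hM.neg.hasSignature_neg_one hH.neg hl (c := -c) (by simp [hc]) (by linarith)
    simpa [h] using h1.neg

end Antitriangular

/-! ### Invariance of the Tristram--Levine signature under S-equivalence -/

section SEquivalence

/-- The border B is cleared by a unipotent congruence with block X satisfying Xᴴ H = -B. The nonzero
column of B and the nonzero row of X have different positions, so BX = 0 and A receives no
correction. What remains is A ⊕ H with H a hyperbolic plane. -/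
theorem hasSignature_enlarge {ι : Type} [Fintype ι] [DecidableEq ι] {A : Matrix ι ι ℂ} {s : ℤ}
    (hA : HasSignature A s) (v : ι → ℂ) {c : ℂ} (hc : c ≠ 0) :
    HasSignature (Matrix.fromBlocks A (Matrix.of fun i => ![v i, 0])
      (Matrix.of fun i => ![v i, 0])ᴴ !![0, c; starRingEnd ℂ c, 0]) s := by
  have hH : HasSignature !![0, c; starRingEnd ℂ c, 0] 0 := by
    have h := hasSignature_offDiagonal (!![c] : Matrix (Fin 1) (Fin 1) ℂ)
    refine HasSignature.of_submatrix finSumFinEquiv (κ := Fin 1 ⊕ Fin 1) ?_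
    convert h using 1
    ext i j
    rcases i with i | i <;> rcases j with j | j <;> fin_cases i <;> fin_cases j <;> rfl
  set B : Matrix ι (Fin 2) ℂ := Matrix.of fun i => ![v i, 0] with hB
  set H : Matrix (Fin 2) (Fin 2) ℂ := !![0, c; starRingEnd ℂ c, 0] with hHdef
  let X : Matrix (Fin 2) ι ℂ := Matrix.of ![0, fun i => -(starRingEnd ℂ (v i) / c)]
  have hXH : Xᴴ * H = -B := by
    ext i j
    fin_cases j
    · simp [X, H, B, Matrix.mul_apply, Fin.sum_univ_two, hc]
    · simp [X, H, B, Matrix.mul_apply, Fin.sum_univ_two]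
  have hBX : B * X = 0 := by
    ext i j; simp [X, B, Matrix.mul_apply, Fin.sum_univ_two]
  have hXB : Xᴴ * Bᴴ = 0 := by
    rw [← Matrix.conjTranspose_mul, hBX, Matrix.conjTranspose_zero]
  have hHh : Hᴴ = H := by
    ext i j; fin_cases i <;> fin_cases j <;> simp [H]
  have hHX : H * X = -Bᴴ := by
    have := congrArg Matrix.conjTranspose hXH
    rwa [Matrix.conjTranspose_mul, Matrix.conjTranspose_conjTranspose, hHh,
      Matrix.conjTranspose_neg] at this
  refine HasSignature.of_congr (Q := Matrix.fromBlocks 1 0 X 1)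
    (Matrix.isUnit_fromBlocks_zero₁₂.2 ⟨isUnit_one, isUnit_one⟩) ?_
  have h := hA.fromBlocks hH
  rw [add_zero] at h
  convert h using 1
  rw [Matrix.fromBlocks_conjTranspose, Matrix.fromBlocks_multiply, Matrix.fromBlocks_multiply]
  simp [hXH, hXB, hHX]

theorem HasSignature.tristramLevine_eq {N : ℕ} {S : Matrix (Fin N) (Fin N) ℝ} {ζ : ℂ} {s : ℤ}
    (h : HasSignature (signatureMatrix S ζ) s) : tristramLevine S ζ = s :=
  (hasSignature_hermitianSignature _).unique h

theorem hasSignature_tristramLevine {N : ℕ} (S : Matrix (Fin N) (Fin N) ℝ) (ζ : ℂ) :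
    HasSignature (signatureMatrix S ζ) (tristramLevine S ζ) :=
  hasSignature_hermitianSignature _

theorem signatureMatrix_congr {N : ℕ} (S A : Matrix (Fin N) (Fin N) ℝ) (ζ : ℂ) :
    signatureMatrix (A * S * Aᵀ) ζ =
      A.map Complex.ofReal * signatureMatrix S ζ * (A.map Complex.ofReal)ᴴ := by
  have hA : (A.map Complex.ofReal)ᴴ = Aᵀ.map Complex.ofReal := by
    ext i j; simp [Matrix.conjTranspose_apply]
  have hmul : ∀ X Y : Matrix (Fin N) (Fin N) ℝ,
      (X * Y).map Complex.ofReal = X.map Complex.ofReal * Y.map Complex.ofReal :=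
    fun X Y => map_mul Complex.ofRealHom.mapMatrix X Y
  rw [hA, signatureMatrix, signatureMatrix, Matrix.transpose_mul, Matrix.transpose_mul,
    Matrix.transpose_transpose, hmul, hmul, hmul, hmul]
  simp only [Matrix.mul_add, Matrix.add_mul, Matrix.mul_smul, Matrix.smul_mul, Matrix.mul_assoc]

/-- Enlarging S enlarges the signature matrix by a hyperbolic plane with corner entry 1 - ζ or 1 -
ζ̄, which is nonzero precisely because ζ ≠ 1. -/
theorem tristramLevine_eq_of_sStep {ζ : ℂ} (hζ : ζ ≠ 1)
    {a b : Σ N : ℕ, Matrix (Fin N) (Fin N) ℝ} (h : SStep a b) :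
    tristramLevine a.2 ζ = tristramLevine b.2 ζ := by
  have h1 : (1 - ζ) ≠ 0 := sub_ne_zero.2 hζ.symm
  have h2 : 1 - starRingEnd ℂ ζ ≠ 0 := by
    have := (map_ne_zero (starRingEnd ℂ)).2 h1
    simpa using this
  cases h with
  | @congr N S A hA =>
    refine HasSignature.tristramLevine_eq (HasSignature.of_congr (Q := (A.map Complex.ofReal)ᴴ)
      ?_ ?_)
    · exact (Matrix.isUnit_conjTranspose _).2 (hA.map Complex.ofRealHom.mapMatrix)
    · rw [Matrix.conjTranspose_conjTranspose, ← signatureMatrix_congr]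
      exact hasSignature_tristramLevine _ _
  | @colEnlarge N S ξ =>
    symm
    refine HasSignature.tristramLevine_eq (HasSignature.of_submatrix finSumFinEquiv ?_)
    have h := hasSignature_enlarge (hasSignature_tristramLevine S ζ)
      (fun i => (1 - ζ) * ξ i) h1
    convert h using 1
    ext i j
    rcases i with i | i <;> rcases j with j | j
    · simp [signatureMatrix]
    · fin_cases j <;> simp [signatureMatrix]
    · fin_cases i <;> simp [signatureMatrix]
    · fin_cases i <;> fin_cases j <;> simp [signatureMatrix]
  | @rowEnlarge N S ξ =>
    symm
    refine HasSignature.tristramLevine_eq (HasSignature.of_submatrix finSumFinEquiv ?_)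
    have h := hasSignature_enlarge (hasSignature_tristramLevine S ζ)
      (fun i => (1 - starRingEnd ℂ ζ) * ξ i) h2
    convert h using 1
    ext i j
    rcases i with i | i <;> rcases j with j | j
    · simp [signatureMatrix]
    · fin_cases j <;> simp [signatureMatrix]
    · fin_cases i <;> simp [signatureMatrix]
    · fin_cases i <;> fin_cases j <;> simp [signatureMatrix]

theorem SEquivalent.tristramLevine_eq {M N : ℕ} {S : Matrix (Fin M) (Fin M) ℝ}
    {T : Matrix (Fin N) (Fin N) ℝ} (h : SEquivalent S T) {ζ : ℂ} (hζ : ζ ≠ 1) :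
    tristramLevine S ζ = tristramLevine T ζ := by
  have key : ∀ a b : (Σ N : ℕ, Matrix (Fin N) (Fin N) ℝ), Relation.EqvGen SStep a b →
      tristramLevine a.2 ζ = tristramLevine b.2 ζ := by
    intro a b hab
    induction hab with
    | rel _ _ h => exact tristramLevine_eq_of_sStep hζ h
    | refl _ => rfl
    | symm _ _ _ ih => exact ih.symm
    | trans _ _ _ _ _ ih1 ih2 => exact ih1.trans ih2
  exact key _ _ h

theorem IsNondegPart.tristramLevine_eq {N m : ℕ} {S : Matrix (Fin N) (Fin N) ℝ}
    {T : Matrix (Fin m) (Fin m) ℝ} (h : IsNondegPart S T) {ζ : ℂ} (hζ : ζ ≠ 1) :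
    tristramLevine S ζ = tristramLevine T ζ := by
  obtain ⟨_, r, hr⟩ := h
  rw [hr.tristramLevine_eq hζ]
  refine HasSignature.tristramLevine_eq (HasSignature.of_submatrix finSumFinEquiv ?_)
  have h := (hasSignature_zero (ι := Fin r)).fromBlocks (hasSignature_tristramLevine T ζ)
  rw [zero_add] at h
  convert h using 1
  ext i j
  rcases i with i | i <;> rcases j with j | j <;> simp [signatureMatrix]

/-- Entrywise conjugation of a diagonalization keeps the real diagonal. It is needed because the
form of the variation structure is the signature matrix at ζ̄ and not at ζ. -/
theorem tristramLevine_conj {N : ℕ} (S : Matrix (Fin N) (Fin N) ℝ) (ζ : ℂ) :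
    tristramLevine S (starRingEnd ℂ ζ) = tristramLevine S ζ := by
  obtain ⟨P, d, hP, hM, hs⟩ := hasSignature_tristramLevine S ζ
  refine HasSignature.tristramLevine_eq ⟨P.map (starRingEnd ℂ), d, hP.map
    (starRingEnd ℂ).mapMatrix, ?_, hs⟩
  have h1 := congrArg (starRingEnd ℂ).mapMatrix hM
  rw [map_mul, map_mul] at h1
  have h2 : (starRingEnd ℂ).mapMatrix (signatureMatrix S ζ) =
      signatureMatrix S (starRingEnd ℂ ζ) := by
    ext i j; simp [signatureMatrix]
  have h3 : (starRingEnd ℂ).mapMatrix Pᴴ = (P.map (starRingEnd ℂ))ᴴ := by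
    ext i j; simp [Matrix.conjTranspose_apply]
  rw [h2, h3] at h1
  refine Eq.trans h1 ?_
  ext i j
  by_cases hij : i = j
  · subst hij; simp
  · simp [hij]

end SEquivalence

/-! ### Entries of forms preserved by a Jordan block -/

section JordanForm

theorem mul_jordanOne_zero {ι : Type} {m : ℕ} (X : Matrix ι (Fin (m + 1)) ℂ) (i : ι) :
    (X * jordanOne (m + 1)) i 0 = X i 0 := by
  rw [Matrix.mul_apply, Finset.sum_eq_single 0]
  · simp [jordanOne]
  · intro j _ hj
    have : ¬ ((0 : Fin (m + 1)) = j) := fun h => hj h.symm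
    simp [jordanOne, this]
  · simp

theorem mul_jordanOne_succ {ι : Type} {m : ℕ} (X : Matrix ι (Fin (m + 1)) ℂ) (i : ι) (j : Fin m) :
    (X * jordanOne (m + 1)) i j.succ = X i j.succ + X i j.castSucc := by
  have hne : j.succ ≠ j.castSucc := fun h => by simp [Fin.ext_iff] at h
  rw [Matrix.mul_apply, Finset.sum_eq_add j.succ j.castSucc hne]
  · simp [jordanOne]
  · intro l _ hl
    have h1 : ¬ (j.succ = l) := fun h => hl.1 h.symm
    have h2 : ¬ ((j : ℕ) = l) := fun h => hl.2 (Fin.ext h.symm)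
    simp [jordanOne, h1, h2]
  · simp
  · simp

theorem conjTranspose_jordanOne_mul_zero {ι : Type} {m : ℕ} (X : Matrix (Fin (m + 1)) ι ℂ) (j : ι) :
    ((jordanOne (m + 1))ᴴ * X) 0 j = X 0 j := by
  have h := mul_jordanOne_zero Xᴴ j
  have h2 : ((jordanOne (m + 1))ᴴ * X)ᴴ = Xᴴ * jordanOne (m + 1) := by
    rw [Matrix.conjTranspose_mul, Matrix.conjTranspose_conjTranspose]
  rw [← h2] at h
  exact star_injective h

theorem conjTranspose_jordanOne_mul_succ {ι : Type} {m : ℕ} (X : Matrix (Fin (m + 1)) ι ℂ)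
    (i : Fin m) (j : ι) :
    ((jordanOne (m + 1))ᴴ * X) i.succ j = X i.succ j + X i.castSucc j := by
  have h := mul_jordanOne_succ Xᴴ j i
  have h2 : ((jordanOne (m + 1))ᴴ * X)ᴴ = Xᴴ * jordanOne (m + 1) := by
    rw [Matrix.conjTranspose_mul, Matrix.conjTranspose_conjTranspose]
  rw [← h2] at h
  exact star_injective (h.trans (star_add _ _).symm)

variable {n m : ℕ} {u : ℤˣ} {b : Matrix (Fin (m + 1)) (Fin (m + 1)) ℂ}

/-- The (i+1, j+1) entry of JᴴbJ = b reads b(i+1,j) + b(i,j+1) + b(i,j) = 0, which carries the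
vanishing from row i to row i + 1. -/
theorem apply_eq_zero_of_isometry
    (hb : (jordanOne (m + 1))ᴴ * b * jordanOne (m + 1) = b) (i j : Fin (m + 1))
    (hij : (i : ℕ) + j < m) : b i j = 0 := by
  rw [Matrix.mul_assoc] at hb
  induction i using Fin.induction generalizing j with
  | zero =>
    have hj : (j : ℕ) < m := by simpa using hij
    have h := congrFun (congrFun hb 0) (Fin.succ ⟨j, hj⟩)
    rw [conjTranspose_jordanOne_mul_zero, mul_jordanOne_succ] at h
    simpa using h
  | succ i ih =>
    have hj : (j : ℕ) < m := by simp at hij; omega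
    have hij' : (i : ℕ) + 1 + j < m := by simpa using hij
    have h := congrFun (congrFun hb i.succ) (Fin.succ ⟨j, hj⟩)
    rw [conjTranspose_jordanOne_mul_succ, mul_jordanOne_succ, mul_jordanOne_succ] at h
    have h1 := ih (Fin.succ ⟨j, hj⟩) (by simp; omega)
    have h2 := ih (Fin.castSucc ⟨j, hj⟩) (by simp; omega)
    rw [h1, h2] at h
    simpa using h

/-- In the same three-term relation the term above the antidiagonal is already zero, so the sign
alternates from row to row. -/
theorem apply_antidiagonal_of_isometry
    (hb : (jordanOne (m + 1))ᴴ * b * jordanOne (m + 1) = b) (i j : Fin (m + 1))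
    (hij : (i : ℕ) + j = m) : b i j = (-1) ^ (i : ℕ) * b 0 (Fin.last m) := by
  have hb' := hb
  rw [Matrix.mul_assoc] at hb
  induction i using Fin.induction generalizing j with
  | zero =>
    have hj : j = Fin.last m := Fin.ext (by simpa using hij)
    simp [hj]
  | succ i ih =>
    have hij' : (i : ℕ) + 1 + j = m := by simpa using hij
    have hj : (j : ℕ) < m := by omega
    have h := congrFun (congrFun hb i.succ) (Fin.succ ⟨j, hj⟩)
    rw [conjTranspose_jordanOne_mul_succ, mul_jordanOne_succ, mul_jordanOne_succ] at h
    have h1 := ih (Fin.succ ⟨j, hj⟩) (by simp; omega)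
    have h2 := apply_eq_zero_of_isometry hb' i.castSucc (Fin.castSucc ⟨j, hj⟩) (by simp; omega)
    rw [h1, h2] at h
    have h3 : Fin.castSucc ⟨j, hj⟩ = j := rfl
    rw [h3] at h
    simp only [Fin.val_castSucc, Fin.val_succ] at h ⊢
    rw [pow_succ]
    linear_combination h

theorem IsJordanForm.apply_antidiagonal_ne_zero (hb : IsJordanForm n m u b) (i j : Fin (m + 1))
    (hij : (i : ℕ) + j = m) : b i j ≠ 0 := by
  rw [apply_antidiagonal_of_isometry hb.2.2.1 i j hij, hb.2.2.2]
  have h1 : (((u : ℤ) : ℂ)) ≠ 0 := Int.cast_ne_zero.2 u.ne_zero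
  exact mul_ne_zero (pow_ne_zero _ (by norm_num)) (mul_ne_zero h1 (zpow_ne_zero _ Complex.I_ne_zero))

theorem I_zpow_neg_two_mul (l : ℕ) : Complex.I ^ (-(2 * l : ℤ)) = (-1) ^ l := by
  rw [zpow_neg, zpow_mul, zpow_natCast]
  simp [← inv_pow]

theorem neg_one_pow_mul_self (l : ℕ) : (-1 : ℂ) ^ l * (-1) ^ l = 1 := by
  rw [← mul_pow]; simp

/-- For n = 1 and m = 2i the normalization is u·I^(-2i-1) = (-1)^i·(-uI), and the sign (-1)^i
cancels that of the antidiagonal. The next two lemmas treat even size in the same way. -/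
theorem IsJordanForm.apply_middle (hb : IsJordanForm 1 m u b) (i : Fin (m + 1))
    (hi : 2 * (i : ℕ) = m) : b i i = -((u : ℤ) : ℂ) * Complex.I := by
  rw [apply_antidiagonal_of_isometry hb.2.2.1 i i (by omega), hb.2.2.2]
  have he : (-((1 : ℕ) : ℤ) ^ 2 - (m + 1 : ℤ) + 1) = -(2 * ((i : ℕ) : ℤ)) + (-1) := by
    have : (m : ℤ) = 2 * ((i : ℕ) : ℤ) := by omega
    rw [this]; push_cast; ring
  rw [he, zpow_add₀ Complex.I_ne_zero, I_zpow_neg_two_mul, zpow_neg_one, Complex.inv_I]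
  linear_combination (-((u : ℤ) : ℂ) * Complex.I) * neg_one_pow_mul_self i

theorem IsJordanForm.apply_below_middle (hb : IsJordanForm 1 m u b) (i j : Fin (m + 1))
    (hij : (i : ℕ) = j + 1) (hi : 2 * (j : ℕ) + 1 = m) : b i j = ((u : ℤ) : ℂ) := by
  rw [apply_antidiagonal_of_isometry hb.2.2.1 i j (by omega), hb.2.2.2]
  have he : (-((1 : ℕ) : ℤ) ^ 2 - (m + 1 : ℤ) + 1) = -(2 * ((i : ℕ) : ℤ)) := by
    have : (m : ℤ) = 2 * ((i : ℕ) : ℤ) - 1 := by omega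
    rw [this]; push_cast; ring
  rw [he, I_zpow_neg_two_mul]
  linear_combination (((u : ℤ) : ℂ)) * neg_one_pow_mul_self i

theorem IsJordanForm.apply_above_middle (hb : IsJordanForm 1 m u b) (i j : Fin (m + 1))
    (hij : (j : ℕ) = i + 1) (hi : 2 * (i : ℕ) + 1 = m) : b i j = -((u : ℤ) : ℂ) := by
  rw [apply_antidiagonal_of_isometry hb.2.2.1 i j (by omega), hb.2.2.2]
  have he : (-((1 : ℕ) : ℤ) ^ 2 - (m + 1 : ℤ) + 1) = -(2 * ((j : ℕ) : ℤ)) := by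
    have : (m : ℤ) = 2 * ((j : ℕ) : ℤ) - 1 := by omega
    rw [this]; push_cast; ring
  rw [he, I_zpow_neg_two_mul, hij, pow_succ]
  linear_combination (-((u : ℤ) : ℂ)) * neg_one_pow_mul_self i

end JordanForm

/-! ### The hermitian form of a variation structure -/

namespace HVS

section LevineForm

variable {ι κ : Type} [Fintype ι] [DecidableEq ι] [Fintype κ] [DecidableEq κ]

/-- The hermitian matrix `(1 - ζ̄) (V⁻¹)ᴴ + (1 - ζ) V⁻¹`. -/
def levineForm (W : HVS 1 ι) (ζ : ℂ) : Matrix ι ι ℂ :=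
  (1 - starRingEnd ℂ ζ) • (W.V⁻¹)ᴴ + (1 - ζ) • W.V⁻¹

theorem levineForm_isHermitian (W : HVS 1 ι) (ζ : ℂ) : (W.levineForm ζ).IsHermitian := by
  ext i j
  simp [levineForm, Matrix.conjTranspose_apply, add_comm]

/-- The axiom Vᴴ = V hᴴ has adjoint V = h Vᴴ. Thus h is the asymmetry of the form V⁻¹. -/
theorem conjTranspose_inv_V {W : HVS 1 ι} (hV : IsUnit W.V) : (W.V⁻¹)ᴴ = W.V⁻¹ * W.h := by
  have hd := (Matrix.isUnit_iff_isUnit_det _).1 hV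
  have hdh : IsUnit (W.V)ᴴ.det := (Matrix.isUnit_iff_isUnit_det _).1
    ((Matrix.isUnit_conjTranspose _).2 hV)
  have h1 : W.Vᴴ = W.V * W.hᴴ := by
    have := W.V_conj
    simpa using this
  have h2 : W.V = W.h * W.Vᴴ := by
    have := congrArg Matrix.conjTranspose h1
    simpa [Matrix.conjTranspose_mul] using this
  rw [Matrix.conjTranspose_nonsing_inv]
  have h3 : W.V⁻¹ * W.h * W.Vᴴ = 1 := by
    rw [Matrix.mul_assoc, ← h2, Matrix.nonsing_inv_mul _ hd]
  exact Matrix.inv_eq_left_inv h3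

theorem inv_V_mul {W : HVS 1 ι} (hV : IsUnit W.V) : W.V⁻¹ * (W.h - 1) = W.b := by
  rw [← W.V_mul_b, ← Matrix.mul_assoc,
    Matrix.nonsing_inv_mul _ ((Matrix.isUnit_iff_isUnit_det _).1 hV), Matrix.one_mul]

theorem levineForm_eq {W : HVS 1 ι} (hV : IsUnit W.V) (ζ : ℂ) :
    W.levineForm ζ = (1 - starRingEnd ℂ ζ) • (W.V⁻¹ * W.h) + (1 - ζ) • W.V⁻¹ := by
  rw [levineForm, conjTranspose_inv_V hV]

/-- Multiplication by h - 1 removes V: L = V⁻¹((1 - ζ̄)h + (1 - ζ)), h commutes with h - 1, and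
V⁻¹(h - 1) = b. -/
theorem levineForm_mul {W : HVS 1 ι} (hV : IsUnit W.V) (ζ : ℂ) :
    W.levineForm ζ * (W.h - 1) = (1 - starRingEnd ℂ ζ) • (W.b * W.h) + (1 - ζ) • W.b := by
  have hc : W.h * (W.h - 1) = (W.h - 1) * W.h := by
    rw [Matrix.mul_sub, Matrix.sub_mul, Matrix.mul_one, Matrix.one_mul]
  rw [levineForm_eq hV, Matrix.add_mul, Matrix.smul_mul, Matrix.smul_mul, Matrix.mul_assoc W.V⁻¹,
    hc, ← Matrix.mul_assoc, inv_V_mul hV]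

theorem Iso.isUnit_V {A : HVS 1 ι} {B : HVS 1 κ} (h : A.Iso B) (hA : IsUnit A.V) :
    IsUnit B.V := by
  obtain ⟨φ, ψ, h1, h2, _, _, hV⟩ := h
  have hd := (Matrix.isUnit_iff_isUnit_det _).1 hA
  have h2' : φᴴ * ψᴴ = 1 := by
    rw [← Matrix.conjTranspose_mul, h1, Matrix.conjTranspose_one]
  have h3 : ψᴴ * φᴴ = 1 := by
    rw [← Matrix.conjTranspose_mul, h2, Matrix.conjTranspose_one]
  have hB : B.V = φ * A.V * φᴴ := by
    rw [hV]
    calc B.V = (φ * ψ) * B.V * (ψᴴ * φᴴ) := by rw [h2, h3, Matrix.one_mul, Matrix.mul_one]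
      _ = _ := by simp only [Matrix.mul_assoc]
  refine IsUnit.of_mul_eq_one (ψᴴ * A.V⁻¹ * ψ) ?_
  calc B.V * (ψᴴ * A.V⁻¹ * ψ) = φ * (A.V * ((φᴴ * ψᴴ) * A.V⁻¹)) * ψ := by
        rw [hB]; simp only [Matrix.mul_assoc]
    _ = 1 := by rw [h2', Matrix.one_mul, Matrix.mul_nonsing_inv _ hd, Matrix.mul_one, h2]

theorem Iso.hasSignature {A : HVS 1 ι} {B : HVS 1 κ} (h : A.Iso B) (hB : IsUnit B.V) {ζ : ℂ}
    {s : ℤ} (hs : HasSignature (B.levineForm ζ) s) : HasSignature (A.levineForm ζ) s := by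
  obtain ⟨φ, ψ, h1, h2, _, _, hV⟩ := h
  have hd := (Matrix.isUnit_iff_isUnit_det _).1 hB
  have h3 : ψᴴ * φᴴ = 1 := by
    rw [← Matrix.conjTranspose_mul, h2, Matrix.conjTranspose_one]
  have h4 : φᴴ * ψᴴ = 1 := by
    rw [← Matrix.conjTranspose_mul, h1, Matrix.conjTranspose_one]
  have hinv : A.V⁻¹ = φᴴ * B.V⁻¹ * φ := by
    refine Matrix.inv_eq_left_inv ?_
    calc φᴴ * B.V⁻¹ * φ * A.V = φᴴ * (B.V⁻¹ * ((φ * ψ) * B.V)) * ψᴴ := by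
          rw [hV]; simp only [Matrix.mul_assoc]
      _ = 1 := by rw [h2, Matrix.one_mul, Matrix.nonsing_inv_mul _ hd, Matrix.mul_one, h4]
  refine HasSignature.of_congr_rect h2 h1 ?_
  convert hs using 1
  have h5 : ψᴴ * A.V⁻¹ * ψ = B.V⁻¹ := by
    calc ψᴴ * A.V⁻¹ * ψ = (ψᴴ * φᴴ) * B.V⁻¹ * (φ * ψ) := by
          rw [hinv]; simp only [Matrix.mul_assoc]
      _ = _ := by rw [h2, h3, Matrix.one_mul, Matrix.mul_one]
  have h6 : ψᴴ * (A.V⁻¹)ᴴ * ψ = (B.V⁻¹)ᴴ := by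
    rw [← h5, Matrix.conjTranspose_mul, Matrix.conjTranspose_mul,
      Matrix.conjTranspose_conjTranspose, Matrix.mul_assoc]
  rw [levineForm, levineForm, Matrix.mul_add, Matrix.add_mul, Matrix.mul_smul, Matrix.smul_mul,
    Matrix.mul_smul, Matrix.smul_mul, h5, h6]

/-- The corresponding diagonal block of an inverse of the sum inverts the summand. -/
theorem isUnit_V_of_directSum {r : ℕ} {τ : Fin r → Type} [∀ i, Fintype (τ i)]
    [∀ i, DecidableEq (τ i)] {W : ∀ i, HVS 1 (τ i)} (h : IsUnit (directSum W).V) (i : Fin r) :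
    IsUnit (W i).V := by
  obtain ⟨X, hX⟩ := h.exists_right_inv
  change (Matrix.blockDiagonal' fun i => (W i).V) * X = 1 at hX
  refine IsUnit.of_mul_eq_one (X.submatrix (Sigma.mk i) (Sigma.mk i)) ?_
  ext a c
  have h1 := congrFun (congrFun hX ⟨i, a⟩) ⟨i, c⟩
  rw [Matrix.mul_apply, Fintype.sum_sigma, Finset.sum_eq_single i] at h1
  · simp only [Matrix.blockDiagonal'_apply_eq] at h1
    rw [Matrix.mul_apply]
    refine h1.trans ?_
    by_cases hac : a = c
    · subst hac; simp
    · rw [Matrix.one_apply_ne hac, Matrix.one_apply_ne (fun h => hac (by simpa using h))]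
  · intro j _ hj
    exact Finset.sum_eq_zero fun x _ => by
      rw [Matrix.blockDiagonal'_apply_ne _ _ _ (Ne.symm hj), zero_mul]
  · simp

theorem levineForm_directSum {r : ℕ} {τ : Fin r → Type} [∀ i, Fintype (τ i)]
    [∀ i, DecidableEq (τ i)] {W : ∀ i, HVS 1 (τ i)} (h : ∀ i, IsUnit (W i).V) (ζ : ℂ) :
    (directSum W).levineForm ζ = Matrix.blockDiagonal' fun i => (W i).levineForm ζ := by
  have hinv : (directSum W).V⁻¹ = Matrix.blockDiagonal' fun i => (W i).V⁻¹ := by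
    refine Matrix.inv_eq_left_inv ?_
    change _ * (Matrix.blockDiagonal' fun i => (W i).V) = 1
    rw [← Matrix.blockDiagonal'_mul, ← Matrix.blockDiagonal'_one]
    congr 1; funext i
    exact Matrix.nonsing_inv_mul _ ((Matrix.isUnit_iff_isUnit_det _).1 (h i))
  rw [levineForm, hinv, Matrix.blockDiagonal'_conjTranspose, ← Matrix.blockDiagonal'_smul,
    ← Matrix.blockDiagonal'_smul, ← Matrix.blockDiagonal'_add]
  rfl

end LevineForm

end HVS

theorem isUnit_variationStructure_V {m : ℕ} (T : Matrix (Fin m) (Fin m) ℝ) (hT : T.det ≠ 0) :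
    IsUnit (variationStructure T hT).V := by
  have hu : IsUnit (Tᵀ) := by
    rw [Matrix.isUnit_iff_isUnit_det, Matrix.det_transpose]; exact isUnit_iff_ne_zero.2 hT
  have hu' : IsUnit ((Tᵀ)⁻¹) := Matrix.isUnit_nonsing_inv_iff.2 hu
  exact hu'.map Complex.ofRealHom.mapMatrix

theorem inv_variationStructure_V {m : ℕ} (T : Matrix (Fin m) (Fin m) ℝ) (hT : T.det ≠ 0) :
    (variationStructure T hT).V⁻¹ = Tᵀ.map Complex.ofReal := by
  have hu : IsUnit (Tᵀ).det := by rw [Matrix.det_transpose]; exact isUnit_iff_ne_zero.2 hT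
  refine Matrix.inv_eq_left_inv ?_
  have := congrArg Complex.ofRealHom.mapMatrix (Matrix.mul_nonsing_inv _ hu)
  rw [map_mul, map_one] at this
  exact this

theorem levineForm_variationStructure {m : ℕ} (T : Matrix (Fin m) (Fin m) ℝ) (hT : T.det ≠ 0)
    (ζ : ℂ) : (variationStructure T hT).levineForm ζ = signatureMatrix T (starRingEnd ℂ ζ) := by
  rw [HVS.levineForm, inv_variationStructure_V, signatureMatrix]
  ext i j
  simp [Matrix.conjTranspose_apply]

/-! ### Signatures of the indecomposable structures -/

section BlockSignature

variable {m : ℕ} {u : ℤˣ} {μ ζ : ℂ}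

theorem levineForm_col_zero {W : HVS 1 (Fin (m + 1))} (hV : IsUnit W.V)
    (hh : W.h = μ • jordanOne (m + 1)) (i : Fin (m + 1)) :
    (μ - 1) * W.levineForm ζ i 0 = ((1 - starRingEnd ℂ ζ) * μ + (1 - ζ)) * W.b i 0 := by
  have h := congrFun (congrFun (HVS.levineForm_mul hV ζ) i) 0
  rw [hh, Matrix.mul_sub, Matrix.mul_smul, Matrix.mul_smul] at h
  simp only [Matrix.sub_apply, Matrix.add_apply, Matrix.smul_apply, mul_jordanOne_zero,
    Matrix.mul_one, smul_eq_mul] at h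
  linear_combination h

theorem levineForm_col_succ {W : HVS 1 (Fin (m + 1))} (hV : IsUnit W.V)
    (hh : W.h = μ • jordanOne (m + 1)) (i : Fin (m + 1)) (j : Fin m) :
    (μ - 1) * W.levineForm ζ i j.succ + μ * W.levineForm ζ i j.castSucc =
      ((1 - starRingEnd ℂ ζ) * μ + (1 - ζ)) * W.b i j.succ +
        (1 - starRingEnd ℂ ζ) * μ * W.b i j.castSucc := by
  have h := congrFun (congrFun (HVS.levineForm_mul hV ζ) i) j.succ
  rw [hh, Matrix.mul_sub, Matrix.mul_smul, Matrix.mul_smul] at h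
  simp only [Matrix.sub_apply, Matrix.add_apply, Matrix.smul_apply, mul_jordanOne_succ,
    Matrix.mul_one, smul_eq_mul] at h
  linear_combination h

section Nondeg

variable {W : HVS 1 (Fin (m + 1))} (hV : IsUnit W.V) (hh : W.h = μ • jordanOne (m + 1))
  (hb : IsJordanForm 1 m u W.b) (hμ : μ ≠ 1)
include hV hh hb hμ

/-- Above the antidiagonal the right side of the column relation vanishes together with b; as μ ≠ 1,
the zeros of L propagate from each column to the next. -/
theorem levineForm_eq_zero_above (i j : Fin (m + 1)) (hij : (i : ℕ) + j < m) :
    W.levineForm ζ i j = 0 := by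
  have hμ' : μ - 1 ≠ 0 := sub_ne_zero.2 hμ
  have hz := fun i j => apply_eq_zero_of_isometry hb.2.2.1 i j
  induction j using Fin.induction with
  | zero =>
    have h := levineForm_col_zero (ζ := ζ) hV hh i
    rw [hz i 0 hij, mul_zero] at h
    exact (mul_eq_zero.1 h).resolve_left hμ'
  | succ j ih =>
    have hij' : (i : ℕ) + (j + 1) < m := by simpa using hij
    have h := levineForm_col_succ (ζ := ζ) hV hh i j
    rw [hz i _ hij, hz i j.castSucc (by simp; omega), ih (by simp; omega)] at h
    simpa [hμ'] using h

theorem levineForm_antidiagonal (i j : Fin (m + 1)) (hij : (i : ℕ) + j = m) :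
    (μ - 1) * W.levineForm ζ i j = ((1 - starRingEnd ℂ ζ) * μ + (1 - ζ)) * W.b i j := by
  induction j using Fin.cases with
  | zero => exact levineForm_col_zero hV hh i
  | succ j =>
    have hij' : (i : ℕ) + (j + 1) = m := by simpa using hij
    have h := levineForm_col_succ (ζ := ζ) hV hh i j
    rw [levineForm_eq_zero_above hV hh hb hμ i j.castSucc (by simp; omega),
      apply_eq_zero_of_isometry hb.2.2.1 i j.castSucc (by simp; omega)] at h
    linear_combination h

theorem isAntitriangular_levineForm (hg : (1 - starRingEnd ℂ ζ) * μ + (1 - ζ) ≠ 0) :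
    IsAntitriangular (W.levineForm ζ) := by
  refine ⟨fun i j hij => levineForm_eq_zero_above hV hh hb hμ i j (by omega),
    fun i j hij h0 => ?_⟩
  have h := levineForm_antidiagonal (ζ := ζ) hV hh hb hμ i j (by omega)
  rw [h0, mul_zero] at h
  exact mul_ne_zero hg (hb.apply_antidiagonal_ne_zero i j (by omega)) h.symm

theorem hasSignature_levineForm_of_even (hg : (1 - starRingEnd ℂ ζ) * μ + (1 - ζ) ≠ 0)
    (hm : Even (m + 1)) : HasSignature (W.levineForm ζ) 0 :=
  (isAntitriangular_levineForm hV hh hb hμ hg).hasSignature_of_even (W.levineForm_isHermitian ζ) hm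

/-- The middle entry of b is -uI, so `hc` turns the middle entry of L into the real number u·c. -/
theorem hasSignature_levineForm_of_odd {c : ℝ} (hc0 : c ≠ 0)
    (hc : ((1 - starRingEnd ℂ ζ) * μ + (1 - ζ)) * (-Complex.I) = c * (μ - 1))
    (hm : Odd (m + 1)) : HasSignature (W.levineForm ζ) ((u : ℤ) * SignType.sign c) := by
  have hμ' : μ - 1 ≠ 0 := sub_ne_zero.2 hμ
  have hg : (1 - starRingEnd ℂ ζ) * μ + (1 - ζ) ≠ 0 := by
    intro h0
    rw [h0, zero_mul] at hc
    exact mul_ne_zero (Complex.ofReal_ne_zero.2 hc0) hμ' hc.symm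
  obtain ⟨l, hl⟩ := hm
  have h := levineForm_antidiagonal (ζ := ζ) hV hh hb hμ ⟨l, by omega⟩ ⟨l, by omega⟩
    (by simp; omega)
  rw [hb.apply_middle _ (by simp; omega)] at h
  have hval : W.levineForm ζ ⟨l, by omega⟩ ⟨l, by omega⟩ = (((u : ℤ) * c : ℝ) : ℂ) := by
    apply mul_left_cancel₀ hμ'
    rw [h]
    push_cast
    linear_combination ((u : ℤ) : ℂ) * hc
  have := (isAntitriangular_levineForm hV hh hb hμ hg).hasSignature_sign
    (W.levineForm_isHermitian ζ) (by simp; omega) hval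
  convert this using 1
  rcases Int.units_eq_one_or u with rfl | rfl <;> simp [Left.sign_neg]

theorem levineForm_self_col_zero (hg : (1 - starRingEnd ℂ ζ) * μ + (1 - ζ) = 0) (i : Fin (m + 1)) :
    W.levineForm ζ i 0 = 0 := by
  have h := levineForm_col_zero (ζ := ζ) hV hh i
  rw [hg, zero_mul] at h
  exact (mul_eq_zero.1 h).resolve_left (sub_ne_zero.2 hμ)

theorem levineForm_self_eq_zero (hg : (1 - starRingEnd ℂ ζ) * μ + (1 - ζ) = 0)
    (i j : Fin (m + 1)) (hij : (i : ℕ) + j ≤ m) : W.levineForm ζ i j = 0 := by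
  rcases hij.lt_or_eq with h | h
  · exact levineForm_eq_zero_above hV hh hb hμ i j h
  · have h := levineForm_antidiagonal (ζ := ζ) hV hh hb hμ i j h
    rw [hg, zero_mul] at h
    exact (mul_eq_zero.1 h).resolve_left (sub_ne_zero.2 hμ)

/-- For μ = ζ the coefficient of b(i,j+1) in the column relation vanishes and that of b(i,j) becomes
μ - 1, so here L is b shifted by one column. -/
theorem levineForm_self_succ (hg : (1 - starRingEnd ℂ ζ) * μ + (1 - ζ) = 0)
    (hζ : (1 - starRingEnd ℂ ζ) * μ = μ - 1) (i : Fin (m + 1)) (j : Fin m)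
    (hij : (i : ℕ) + j ≤ m) : W.levineForm ζ i j.succ = W.b i j.castSucc := by
  have h := levineForm_col_succ (ζ := ζ) hV hh i j
  rw [hg, hζ, levineForm_self_eq_zero hV hh hb hμ hg i j.castSucc (by simpa using hij)] at h
  apply mul_left_cancel₀ (sub_ne_zero.2 hμ)
  linear_combination h

/-- The first row and column of L vanish. The remaining matrix of size k - 1 is antitriangular, with
the entries of b below its corner as antidiagonal; for k even its middle entry is u. -/
theorem hasSignature_levineForm_self (hζ : (1 - starRingEnd ℂ ζ) * μ = μ - 1) (hζμ : ζ = μ) :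
    HasSignature (W.levineForm ζ) (if Odd (m + 1) then 0 else (u : ℤ)) := by
  have hg : (1 - starRingEnd ℂ ζ) * μ + (1 - ζ) = 0 := by rw [hζ, hζμ]; ring
  have hat : IsAntitriangular ((W.levineForm ζ).submatrix Fin.succ Fin.succ) := by
    refine ⟨fun i j hij => ?_, fun i j hij => ?_⟩
    · exact levineForm_self_eq_zero hV hh hb hμ hg _ _ (by simp; omega)
    · rw [Matrix.submatrix_apply, levineForm_self_succ hV hh hb hμ hg hζ _ _ (by simp; omega)]
      exact hb.apply_antidiagonal_ne_zero _ _ (by simp; omega)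
  have hH := (W.levineForm_isHermitian ζ).submatrix (Fin.succ : Fin m → Fin (m + 1))
  refine HasSignature.of_zero_border
    (fun j => levineForm_self_eq_zero hV hh hb hμ hg 0 j (by simp; omega))
    (levineForm_self_col_zero hV hh hb hμ hg) ?_
  split_ifs with hm
  · exact hat.hasSignature_of_even hH (by simpa [Nat.odd_add_one] using hm)
  · have hm' : Odd m := by simpa [Nat.odd_add_one] using hm
    obtain ⟨l, hl⟩ := hm'
    have h := hat.hasSignature_sign hH (l := ⟨l, by omega⟩) (c := ((u : ℤ) : ℝ))
      (by simp; omega) (by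
        rw [Matrix.submatrix_apply,
          levineForm_self_succ hV hh hb hμ hg hζ _ _ (by simp; omega)]
        rw [hb.apply_below_middle _ _ (by simp) (by simp; omega)]
        simp)
    convert h using 1
    rcases Int.units_eq_one_or u with rfl | rfl <;> simp

end Nondeg

theorem sign_unit_mul_pos (u : ℤˣ) {c : ℝ} (hc : 0 < c) :
    (SignType.sign ((u : ℤ) * c : ℝ) : ℤ) = u := by
  rcases Int.units_eq_one_or u with rfl | rfl <;> simp [hc]

theorem hasSignature_levineForm_degen_one {W : HVS 1 (Fin 1)} (hV : IsUnit W.V)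
    (hW : IsDegenBlock 1 u 1 W) {c : ℝ} (hc0 : 0 < c)
    (hc : (1 - starRingEnd ℂ ζ) + (1 - ζ) = c) : HasSignature (W.levineForm ζ) (-(u : ℤ)) := by
  obtain ⟨_, _, hV0⟩ := hW
  have hu : ((u : ℤ) : ℂ) * ((u : ℤ) : ℂ) = 1 := by
    rw [← Int.cast_mul, ← Units.val_mul, Int.units_mul_self]; simp
  -- For n = 1 the factor i^(n²+1) is -1.
  have hV1 : W.V 0 0 = -((u : ℤ) : ℂ) := by
    rw [hV0]; norm_num
  have hA : W.V⁻¹ 0 0 = -((u : ℤ) : ℂ) := by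
    have h := congrFun (congrFun (Matrix.nonsing_inv_mul _
      ((Matrix.isUnit_iff_isUnit_det _).1 hV)) 0) 0
    rw [Matrix.mul_apply, Fin.sum_univ_one, hV1, Matrix.one_apply_eq] at h
    linear_combination (-((u : ℤ) : ℂ)) * h - W.V⁻¹ 0 0 * hu
  have hval : W.levineForm ζ 0 0 = ((((-u : ℤˣ) : ℤ) * c : ℝ) : ℂ) := by
    simp only [HVS.levineForm, Matrix.add_apply, Matrix.smul_apply, Matrix.conjTranspose_apply, hA,
      smul_eq_mul, Complex.star_def, map_neg, map_intCast]
    push_cast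
    rw [← hc]; ring
  have hne : (((-u : ℤˣ) : ℤ) * c : ℝ) ≠ 0 :=
    mul_ne_zero (Int.cast_ne_zero.2 (Units.ne_zero _)) hc0.ne'
  have hat : IsAntitriangular (W.levineForm ζ) := by
    refine ⟨fun i j hij => by omega, fun i j _ => ?_⟩
    rw [Subsingleton.elim i 0, Subsingleton.elim j 0, hval]
    exact Complex.ofReal_ne_zero.2 hne
  have h := hat.hasSignature_sign (W.levineForm_isHermitian ζ) (by simp) hval
  rwa [sign_unit_mul_pos _ hc0, Units.val_neg] at h

section Degen

variable {W : HVS 1 (Fin (m + 2))} (hV : IsUnit W.V) (hW : IsDegenBlock 1 u (m + 2) W)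
include hV hW

theorem IsDegenBlock.b_eq_zero (i j : Fin (m + 2)) (hij : (i : ℕ) + j < m + 2) : W.b i j = 0 := by
  obtain ⟨_, hr, hc, hJ⟩ := hW
  induction i using Fin.cases with
  | zero => exact hr j
  | succ i =>
    induction j using Fin.cases with
    | zero => exact hc _
    | succ j =>
      exact apply_eq_zero_of_isometry hJ.2.2.1 i j (by simp at hij; omega)

/-- For μ = 1 the term with μ - 1 drops out of the column relation, which then determines every
column of L except the last. -/
theorem levineForm_degen_castSucc (i : Fin (m + 2)) (j : Fin (m + 1)) :
    W.levineForm ζ i j.castSucc = ((1 - starRingEnd ℂ ζ) + (1 - ζ)) * W.b i j.succ +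
      (1 - starRingEnd ℂ ζ) * W.b i j.castSucc := by
  have h := levineForm_col_succ (ζ := ζ) (μ := 1) hV (by rw [hW.1, one_smul]) i j
  linear_combination h

theorem levineForm_degen_antidiagonal (i j : Fin (m + 1)) (hij : (i : ℕ) + j = m) :
    W.levineForm ζ i.succ j.castSucc =
      ((1 - starRingEnd ℂ ζ) + (1 - ζ)) * W.b.submatrix Fin.succ Fin.succ i j := by
  rw [levineForm_degen_castSucc hV hW,
    IsDegenBlock.b_eq_zero hV hW _ j.castSucc (by simp; omega)]
  simp

theorem hasSignature_levineForm_degen {c : ℝ} (hc0 : 0 < c)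
    (hc : (1 - starRingEnd ℂ ζ) + (1 - ζ) = c) :
    HasSignature (W.levineForm ζ) (if Odd (m + 2) then -(u : ℤ) else 0) := by
  have hH := W.levineForm_isHermitian ζ
  have hcne : (c : ℂ) ≠ 0 := Complex.ofReal_ne_zero.2 hc0.ne'
  have hanti : ∀ i j : Fin (m + 1), (i : ℕ) + j = m → W.levineForm ζ i.succ j.castSucc ≠ 0 := by
    intro i j hij
    rw [levineForm_degen_antidiagonal hV hW i j hij, hc]
    exact mul_ne_zero hcne (hW.2.2.2.apply_antidiagonal_ne_zero i j hij)
  have hat : IsAntitriangular (W.levineForm ζ) := by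
    constructor
    · intro i j hij
      obtain ⟨j, rfl⟩ : ∃ j' : Fin (m + 1), j = j'.castSucc := ⟨⟨j, by omega⟩, rfl⟩
      simp only [Fin.val_castSucc] at hij
      rw [levineForm_degen_castSucc hV hW,
        IsDegenBlock.b_eq_zero hV hW _ _ (by simp; omega),
        IsDegenBlock.b_eq_zero hV hW _ _ (by simp; omega)]
      simp
    · intro i j hij
      induction i using Fin.cases with
      | zero =>
        -- The upper right corner lies in the last column, which the column relation does not reach;
        -- hermitian symmetry moves the question to the lower left corner.
        have hj : j = (Fin.last m).succ := Fin.ext (by simp at hij ⊢; omega)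
        intro h0
        have h1 := hanti (Fin.last m) 0 (by simp)
        have h2 := hH.apply ((Fin.last m).succ) (Fin.castSucc 0)
        rw [hj] at h0
        apply h1
        rw [← h2]
        simp only [Fin.castSucc_zero, h0, star_zero]
      | succ i =>
        simp only [Fin.val_succ] at hij
        exact hanti i ⟨j, by omega⟩ (by simp; omega)
  split_ifs with hm
  · obtain ⟨l, hl⟩ := hm
    have hval : W.levineForm ζ ⟨l, by omega⟩ ⟨l, by omega⟩ = ((((-u : ℤˣ) : ℤ) * c : ℝ) : ℂ) := by
      -- The middle entry of L comes from the entry of b^(k-1) just above its middle, which is -u.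
      have h := levineForm_degen_antidiagonal (ζ := ζ) hV hW ⟨l - 1, by omega⟩ ⟨l, by omega⟩
        (by simp; omega)
      have hs : (⟨l - 1, by omega⟩ : Fin (m + 1)).succ = ⟨l, by omega⟩ :=
        Fin.ext (by simp; omega)
      rw [hs, hW.2.2.2.apply_above_middle _ _ (by simp; omega) (by simp; omega), hc] at h
      refine h.trans ?_
      push_cast; ring
    have h := hat.hasSignature_sign hH (by simp; omega) hval
    rwa [sign_unit_mul_pos _ hc0, Units.val_neg] at h
  · exact hat.hasSignature_of_even hH (Nat.not_odd_iff_even.1 hm)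

end Degen

/-- V, hence V⁻¹ and L, are block off-diagonal. -/
theorem hasSignature_levineForm_pair {k : ℕ} {W : HVS 1 (Fin k ⊕ Fin k)} (hV : IsUnit W.V)
    (hW : BlockLabel.IsPairBlock 1 μ k W) : HasSignature (W.levineForm ζ) 0 := by
  obtain ⟨_, _, hVW⟩ := hW
  set X : Matrix (Fin k) (Fin k) ℂ := ((-1 : ℂ) ^ 1) • (μ • jordanOne k - 1)
  set Y : Matrix (Fin k) (Fin k) ℂ := (starRingEnd ℂ μ)⁻¹ • ((jordanOne k)ᴴ)⁻¹ - 1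
  obtain ⟨Z, hZ⟩ := hV.exists_right_inv
  rw [hVW, ← Matrix.fromBlocks_toBlocks Z, Matrix.fromBlocks_multiply,
    ← Matrix.fromBlocks_one, Matrix.fromBlocks_inj] at hZ
  simp only [Matrix.zero_mul, zero_add, add_zero] at hZ
  have hX := mul_eq_one_comm.1 hZ.1
  have hY := mul_eq_one_comm.1 hZ.2.2.2
  have hinv : W.V⁻¹ = Matrix.fromBlocks 0 Z.toBlocks₁₂ Z.toBlocks₂₁ 0 := by
    refine Matrix.inv_eq_left_inv ?_
    rw [hVW, Matrix.fromBlocks_multiply, ← Matrix.fromBlocks_one]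
    simp [hX, hY]
  have h := hasSignature_offDiagonal
    ((1 - starRingEnd ℂ ζ) • (Z.toBlocks₂₁)ᴴ + (1 - ζ) • Z.toBlocks₁₂)
  convert h using 1
  rw [HVS.levineForm, hinv, Matrix.fromBlocks_conjTranspose, Matrix.fromBlocks_smul,
    Matrix.fromBlocks_smul, Matrix.fromBlocks_add]
  simp [Matrix.conjTranspose_add, Matrix.conjTranspose_smul, add_comm]

end BlockSignature

/-! ### Values on the unit circle -/

section Circle

theorem expTwoPiI_eq_sq (t : ℝ) :
    expTwoPiI t = Complex.exp (Real.pi * t * Complex.I) * Complex.exp (Real.pi * t * Complex.I) := by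
  rw [expTwoPiI, ← Complex.exp_add]; congr 1; ring

theorem expTwoPiI_eq_cos_add_sin (t : ℝ) :
    expTwoPiI t = ((Real.cos (Real.pi * t) : ℂ) + Real.sin (Real.pi * t) * Complex.I) ^ 2 := by
  rw [expTwoPiI_eq_sq, sq, ← Complex.ofReal_mul, Complex.exp_mul_I, Complex.ofReal_cos,
    Complex.ofReal_sin]

theorem conj_expTwoPiI (t : ℝ) :
    starRingEnd ℂ (expTwoPiI t) =
      ((Real.cos (Real.pi * t) : ℂ) - Real.sin (Real.pi * t) * Complex.I) ^ 2 := by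
  rw [expTwoPiI_eq_cos_add_sin, map_pow, map_add, map_mul, Complex.conj_ofReal,
    Complex.conj_ofReal, Complex.conj_I]
  ring

theorem cos_sq_add_sin_sq_cast (t : ℝ) :
    (Real.cos t : ℂ) ^ 2 + (Real.sin t : ℂ) ^ 2 = 1 := by
  have := Real.cos_sq_add_sin_sq t
  exact_mod_cast this

theorem one_sub_conj_add_one_sub (x : ℝ) :
    (1 - starRingEnd ℂ (expTwoPiI x)) + (1 - expTwoPiI x) =
      ((4 * Real.sin (Real.pi * x) ^ 2 : ℝ) : ℂ) := by
  rw [conj_expTwoPiI, expTwoPiI_eq_cos_add_sin]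
  push_cast
  have h := cos_sq_add_sin_sq_cast (Real.pi * x)
  push_cast at h
  linear_combination (-2) * h + (-2 * Complex.sin (Real.pi * x) ^ 2) * Complex.I_sq

/-- Half angles: e^{2πiα} - 1 = 2i sin(πα) e^{iπα}, and likewise for 1 - ζ and 1 - ζ̄. After
factoring out phases the quotient is real, so it can serve as the constant in
`hasSignature_levineForm_of_odd`. -/
theorem jump_formula (x α : ℝ) (hα : Real.sin (Real.pi * α) ≠ 0) :
    ((1 - starRingEnd ℂ (expTwoPiI x)) * expTwoPiI α + (1 - expTwoPiI x)) * (-Complex.I) =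
      ((2 * Real.sin (Real.pi * x) * Real.sin (Real.pi * (α - x)) / Real.sin (Real.pi * α) : ℝ) : ℂ)
        * (expTwoPiI α - 1) := by
  have h1 : ((2 * Real.sin (Real.pi * x) * Real.sin (Real.pi * (α - x)) /
      Real.sin (Real.pi * α) : ℝ) : ℂ) * (Real.sin (Real.pi * α) : ℂ) =
      2 * Real.sin (Real.pi * x) * (Real.sin (Real.pi * α) * Real.cos (Real.pi * x) -
        Real.cos (Real.pi * α) * Real.sin (Real.pi * x)) := by
    rw [← Complex.ofReal_mul, div_mul_cancel₀ _ hα, mul_sub, Real.sin_sub]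
    push_cast; ring
  have hI := Complex.I_sq
  have hx := cos_sq_add_sin_sq_cast (Real.pi * x)
  have ha := cos_sq_add_sin_sq_cast (Real.pi * α)
  rw [conj_expTwoPiI, expTwoPiI_eq_cos_add_sin, expTwoPiI_eq_cos_add_sin]
  set c := (Real.cos (Real.pi * x) : ℂ)
  set s := (Real.sin (Real.pi * x) : ℂ)
  set C := (Real.cos (Real.pi * α) : ℂ)
  set S := (Real.sin (Real.pi * α) : ℂ)
  have e1 : (C + S * Complex.I) ^ 2 - 1 = 2 * S * Complex.I * (C + S * Complex.I) := by
    linear_combination ha - S ^ 2 * hI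
  have e2 : 1 - (c - s * Complex.I) ^ 2 = 2 * s * Complex.I * (c - s * Complex.I) := by
    linear_combination (-1 : ℂ) * hx + s ^ 2 * hI
  have e3 : 1 - (c + s * Complex.I) ^ 2 = -2 * s * Complex.I * (c + s * Complex.I) := by
    linear_combination (-1 : ℂ) * hx + s ^ 2 * hI
  have e4 : (c - s * Complex.I) * (C + S * Complex.I) ^ 2 =
      (c + s * Complex.I) + (2 * (S * c - C * s) * Complex.I) * (C + S * Complex.I) := by
    linear_combination (c + s * Complex.I) * (ha - S ^ 2 * hI)
  rw [e1, e2, e3]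
  linear_combination (-2 * s * Complex.I ^ 2) * e4 - (2 * Complex.I * (C + S * Complex.I)) * h1 -
    4 * s * (S * c - C * s) * (C + S * Complex.I) * Complex.I * hI

end Circle

/-! ### Logarithms in the strip `0 < re z ≤ 1` -/

section StripLog

theorem expTwoPiI_add_intCast (z : ℂ) (m : ℤ) : expTwoPiI (z + m) = expTwoPiI z := by
  rw [expTwoPiI, expTwoPiI, Complex.exp_eq_exp_iff_exists_int]
  exact ⟨m, by ring⟩

theorem expTwoPiI_add_one (z : ℂ) : expTwoPiI (z + 1) = expTwoPiI z := by
  simpa using expTwoPiI_add_intCast z 1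

theorem norm_expTwoPiI (z : ℂ) : ‖expTwoPiI z‖ = Real.exp (-(2 * Real.pi * z.im)) := by
  rw [expTwoPiI, Complex.norm_exp]
  simp

theorem expTwoPiI_eq_iff {z w : ℂ} : expTwoPiI z = expTwoPiI w ↔ ∃ m : ℤ, z = w + m := by
  constructor
  · intro h
    obtain ⟨m, hm⟩ := Complex.exp_eq_exp_iff_exists_int.1 h
    refine ⟨m, mul_left_cancel₀ (a := (2 * Real.pi * Complex.I : ℂ)) ?_ ?_⟩
    · simp [Complex.I_ne_zero, Real.pi_ne_zero]
    · rw [hm]; ring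
  · rintro ⟨m, rfl⟩; exact expTwoPiI_add_intCast w m

theorem exists_expTwoPiI_eq {μ : ℂ} (hμ : μ ≠ 0) :
    ∃ z : ℂ, 0 < z.re ∧ z.re ≤ 1 ∧ expTwoPiI z = μ := by
  set w : ℂ := Complex.log μ / (2 * Real.pi * Complex.I)
  have hw : expTwoPiI w = μ := by
    rw [expTwoPiI, mul_div_cancel₀ _ (by simp [Complex.I_ne_zero, Real.pi_ne_zero]),
      Complex.exp_log hμ]
  refine ⟨w + ((1 - ⌈w.re⌉ : ℤ) : ℂ), ?_, ?_, ?_⟩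
  · have := Int.ceil_lt_add_one w.re
    simp; linarith
  · have := Int.le_ceil w.re
    simp; linarith
  · rw [expTwoPiI_add_intCast, hw]

/-- The logarithm `z` of `μ ≠ 0` in the strip `0 < re z ≤ 1`, normalized by `e^{2πiz} = μ`. -/
def stripLog (μ : ℂ) : ℂ := Classical.epsilon fun z => 0 < z.re ∧ z.re ≤ 1 ∧ expTwoPiI z = μ

theorem stripLog_spec {μ : ℂ} (hμ : μ ≠ 0) :
    0 < (stripLog μ).re ∧ (stripLog μ).re ≤ 1 ∧ expTwoPiI (stripLog μ) = μ :=
  Classical.epsilon_spec (exists_expTwoPiI_eq hμ)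

theorem ne_zero_of_norm_eq_one {μ : ℂ} (hμ : ‖μ‖ = 1) : μ ≠ 0 := by
  rintro rfl; simp at hμ

theorem stripLog_im_eq_zero {μ : ℂ} (hμ : ‖μ‖ = 1) : (stripLog μ).im = 0 := by
  have h := norm_expTwoPiI (stripLog μ)
  rw [(stripLog_spec (ne_zero_of_norm_eq_one hμ)).2.2, hμ, eq_comm, Real.exp_eq_one_iff,
    neg_eq_zero] at h
  exact (mul_eq_zero.1 h).resolve_left (by positivity)

theorem stripLog_im_pos {μ : ℂ} (hμ : μ ≠ 0) (hμ1 : ‖μ‖ < 1) : 0 < (stripLog μ).im := by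
  have h := norm_expTwoPiI (stripLog μ)
  rw [(stripLog_spec hμ).2.2] at h
  rw [h, Real.exp_lt_one_iff, neg_lt_zero] at hμ1
  exact (pos_iff_pos_of_mul_pos hμ1).1 (by positivity)

theorem stripLog_eq_ofReal {μ : ℂ} (hμ : ‖μ‖ = 1) : stripLog μ = ((stripLog μ).re : ℂ) :=
  Complex.ext (by simp) (by simp [stripLog_im_eq_zero hμ])

theorem expTwoPiI_stripLog_re {μ : ℂ} (hμ : ‖μ‖ = 1) :
    expTwoPiI ((stripLog μ).re : ℂ) = μ := by
  rw [← stripLog_eq_ofReal hμ, (stripLog_spec (ne_zero_of_norm_eq_one hμ)).2.2]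

/-- The logarithms differ by an integer strictly between -1 and 2. -/
theorem expTwoPiI_eq_iff_of_strip {z w : ℂ} (hw0 : 0 < w.re) (hw1 : w.re ≤ 1) (hz0 : 0 < z.re)
    (hz2 : z.re ≤ 2) : expTwoPiI z = expTwoPiI w ↔ z = w ∨ z = w + 1 := by
  rw [expTwoPiI_eq_iff]
  constructor
  · rintro ⟨m, rfl⟩
    have h1 : (-1 : ℝ) < m := by simp at hz0; linarith
    have h2 : (m : ℝ) < 2 := by simp at hz2; linarith
    have h1' : (-1 : ℤ) < m := by exact_mod_cast h1
    have h2' : m < (2 : ℤ) := by exact_mod_cast h2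
    have : m = 0 ∨ m = 1 := by omega
    rcases this with rfl | rfl <;> simp
  · rintro (rfl | rfl)
    · exact ⟨0, by simp⟩
    · exact ⟨1, by simp⟩

theorem stripLog_eq_iff {μ : ℂ} (hμ : ‖μ‖ = 1) {x : ℝ} (hx0 : 0 < x) (hx1 : x ≤ 1) :
    (stripLog μ).re = x ↔ μ = expTwoPiI x := by
  have hs := stripLog_spec (ne_zero_of_norm_eq_one hμ)
  constructor
  · rintro rfl; exact (expTwoPiI_stripLog_re hμ).symm
  · intro h
    have h2 := (expTwoPiI_eq_iff_of_strip (z := stripLog μ) (w := x) (by simpa) (by simpa) hs.1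
      (by linarith)).1 (hs.2.2.trans h)
    rcases h2 with h2 | h2
    · rw [h2]; simp
    · have := congrArg Complex.re h2
      simp at this
      linarith [hs.2.1]

theorem expTwoPiI_one_add_conj (z : ℂ) :
    expTwoPiI (1 + starRingEnd ℂ z) = 1 / starRingEnd ℂ (expTwoPiI z) := by
  rw [add_comm, expTwoPiI_add_one, expTwoPiI, expTwoPiI, ← Complex.exp_conj, one_div,
    ← Complex.exp_neg]
  congr 1
  rw [map_mul, map_mul, map_mul, Complex.conj_I, Complex.conj_ofReal, map_ofNat]
  ring

end StripLog

/-! ### The spectra as sums over blocks -/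

namespace BlockLabel

/-- The contribution of a block to the mod 2 spectrum. -/
def sp : BlockLabel → Multiset ℝ
  | circle μ k u => Multiset.replicate (spCoeff k u (stripLog μ).re) (stripLog μ).re +
      Multiset.replicate (spCoeff k u ((stripLog μ).re + 1)) ((stripLog μ).re + 1)
  | pair _ _ => 0

/-- The contribution of a block to the non-real part of the extended spectrum. -/
def isp : BlockLabel → Multiset ℂ
  | circle _ _ _ => 0
  | pair μ k => Multiset.replicate k (stripLog μ) +
      Multiset.replicate k (1 + starRingEnd ℂ (stripLog μ))

/-- A function of the parameters of the blocks `𝒲^k_μ(u)`, extended by zero to all labels. -/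
def onCircle {M : Type} [Zero M] (g : ℂ × ℕ × ℤˣ → M) : BlockLabel → M
  | circle μ k u => g (μ, k, u)
  | pair _ _ => 0

/-- A function of the parameters of the blocks `𝒱^{2k}_μ`, extended by zero to all labels. -/
def onPair {M : Type} [Zero M] (g : ℂ × ℕ → M) : BlockLabel → M
  | circle _ _ _ => 0
  | pair μ k => g (μ, k)

/-- The admissibility of a label. -/
def Admissible : BlockLabel → Prop
  | circle μ k _ => ‖μ‖ = 1 ∧ 1 ≤ k
  | pair μ k => 0 < ‖μ‖ ∧ ‖μ‖ < 1 ∧ 1 ≤ k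

theorem IsModel.admissible {n : ℕ} {B : BlockLabel} {𝒱 : HVS n B.Idx} (h : B.IsModel n 𝒱) :
    B.Admissible := by
  cases B with
  | circle μ k u => exact ⟨h.1, h.2.1⟩
  | pair μ k => exact ⟨h.1, h.2.1, h.2.2.1⟩

open Classical in
theorem count_sp_circle {μ : ℂ} (hμ : ‖μ‖ = 1) (k : ℕ) (u : ℤˣ) (α : ℝ) :
    (sp (circle μ k u)).count α =
      if 0 < α ∧ α ≤ 2 then (if μ = expTwoPiI α then spCoeff k u α else 0) else 0 := by
  have hs := stripLog_spec (ne_zero_of_norm_eq_one hμ)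
  set a := (stripLog μ).re with ha
  rw [sp, Multiset.count_add, Multiset.count_replicate, Multiset.count_replicate, ← ha]
  have hea : expTwoPiI (a : ℂ) = μ := expTwoPiI_stripLog_re hμ
  by_cases h : (0 < α ∧ α ≤ 2) ∧ μ = expTwoPiI α
  · have h2 := (expTwoPiI_eq_iff_of_strip (z := α) (w := a) (by simpa using hs.1)
      (by simpa using hs.2.1) (by simpa using h.1.1) (by simpa using h.1.2)).1 (h.2.symm.trans hea.symm)
    rw [if_pos h.1, if_pos h.2]
    rcases h2 with h2 | h2
    · have h3 : α = a := by exact_mod_cast h2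
      simp [h3]
    · have h3 : α = a + 1 := by exact_mod_cast h2
      simp [h3]
  · have h1 : a ≠ α := by
      rintro rfl
      exact h ⟨⟨hs.1, by linarith [hs.2.1]⟩, hea.symm⟩
    have h2 : a + 1 ≠ α := by
      rintro rfl
      refine h ⟨⟨by linarith [hs.1], by linarith [hs.2.1]⟩, ?_⟩
      push_cast
      rw [expTwoPiI_add_one, hea]
    rw [if_neg h1, if_neg h2]
    split_ifs with h3 h4
    · exact absurd ⟨h3, h4⟩ h
    · rfl
    · rfl

open Classical in
theorem count_isp_pair {μ : ℂ} (hμ0 : μ ≠ 0) (hμ : ‖μ‖ < 1) (k : ℕ) (z : ℂ) :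
    (isp (pair μ k)).count z =
      if 0 < z.re ∧ z.re ≤ 1 ∧ 0 < z.im then (if expTwoPiI z = μ then k else 0)
      else if 1 < z.re ∧ z.re ≤ 2 ∧ z.im < 0 then
        (if expTwoPiI z = 1 / starRingEnd ℂ μ then k else 0)
      else 0 := by
  have hs := stripLog_spec hμ0
  have hi := stripLog_im_pos hμ0 hμ
  set a := stripLog μ with ha
  have hb : expTwoPiI (1 + starRingEnd ℂ a) = 1 / starRingEnd ℂ μ := by
    rw [expTwoPiI_one_add_conj, hs.2.2]
  have h1 : (0 < z.re ∧ z.re ≤ 1 ∧ 0 < z.im) ∧ expTwoPiI z = μ ↔ a = z := by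
    constructor
    · rintro ⟨⟨h0, h1, _⟩, he⟩
      rcases (expTwoPiI_eq_iff_of_strip hs.1 hs.2.1 h0 (by linarith)).1 (he.trans hs.2.2.symm)
        with h | h
      · exact h.symm
      · have := congrArg Complex.re h
        simp at this
        linarith [hs.1]
    · rintro rfl
      exact ⟨⟨hs.1, hs.2.1, hi⟩, hs.2.2⟩
  have h2 : (1 < z.re ∧ z.re ≤ 2 ∧ z.im < 0) ∧ expTwoPiI z = 1 / starRingEnd ℂ μ ↔
      1 + starRingEnd ℂ a = z := by
    constructor
    · rintro ⟨⟨h0, h1, _⟩, he⟩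
      -- The base logarithm is ā, with real part in (0,1]; since re z > 1, only its translate 1 + ā
      -- is possible.
      rcases (expTwoPiI_eq_iff_of_strip (z := z) (w := 1 + starRingEnd ℂ a - 1)
        (by simpa using hs.1) (by simpa using hs.2.1) (by linarith) h1).1 (by
          rw [he, ← hb, ← expTwoPiI_add_one (1 + starRingEnd ℂ a - 1), sub_add_cancel])
        with h | h
      · have := congrArg Complex.re h
        simp at this
        linarith [hs.2.1]
      · rw [h]; ring
    · rintro rfl
      refine ⟨⟨by simpa using hs.1, ?_, by simpa using hi⟩, hb⟩
      have := hs.2.1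
      simp; linarith
  rw [isp, Multiset.count_add, Multiset.count_replicate, Multiset.count_replicate, ← ha]
  simp only [← h1, ← h2]
  by_cases hr : 0 < z.re ∧ z.re ≤ 1 ∧ 0 < z.im
  · have hr' : ¬ (1 < z.re ∧ z.re ≤ 2 ∧ z.im < 0) := fun h => by linarith [h.1, hr.2.1]
    simp [hr, hr']
  · simp only [hr, false_and, if_false, zero_add]
    by_cases hr' : 1 < z.re ∧ z.re ≤ 2 ∧ z.im < 0
    · simp [hr']
    · simp [hr']

section Sums

variable {r : ℕ} {B : Fin r → BlockLabel}

/-- The counting function p is the sum of unit masses at the labels of the circle blocks, so every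
weighted sum over p becomes a sum over blocks. -/
theorem sum_circle {p : ℂ × ℕ × ℤˣ →₀ ℕ}
    (hp : ∀ μ k u, p (μ, k, u) = Nat.card {i : Fin r // B i = circle μ k u})
    {M : Type} [AddCommMonoid M] (g : ℂ × ℕ × ℤˣ → M) :
    p.sum (fun x m => m • g x) = ∑ i, onCircle g (B i) := by
  classical
  have h : p = ∑ i, onCircle (fun x => Finsupp.single x 1) (B i) := by
    ext ⟨μ, k, u⟩
    rw [hp, Finsupp.finsetSum_apply, Nat.card_eq_fintype_card, Fintype.card_subtype,
      Finset.card_filter]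
    refine Finset.sum_congr rfl fun i _ => ?_
    rcases B i with ⟨μ', k', u'⟩ | ⟨μ', k'⟩
    · simp [onCircle, Finsupp.single_apply]
    · simp [onCircle]
  rw [h, ← Finsupp.sum_finsetSum_index (by simp) (by simp [add_smul])]
  refine Finset.sum_congr rfl fun i _ => ?_
  rcases B i with ⟨μ', k', u'⟩ | ⟨μ', k'⟩
  · simp [onCircle]
  · simp [onCircle]

theorem sum_pair {q : ℂ × ℕ →₀ ℕ}
    (hq : ∀ μ k, q (μ, k) = Nat.card {i : Fin r // B i = pair μ k})
    {M : Type} [AddCommMonoid M] (g : ℂ × ℕ → M) :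
    q.sum (fun x m => m • g x) = ∑ i, onPair g (B i) := by
  classical
  have h : q = ∑ i, onPair (fun x => Finsupp.single x 1) (B i) := by
    ext ⟨μ, k⟩
    rw [hq, Finsupp.finsetSum_apply, Nat.card_eq_fintype_card, Fintype.card_subtype,
      Finset.card_filter]
    refine Finset.sum_congr rfl fun i _ => ?_
    rcases B i with ⟨μ', k', u'⟩ | ⟨μ', k'⟩
    · simp [onPair]
    · simp [onPair, Finsupp.single_apply]
  rw [h, ← Finsupp.sum_finsetSum_index (by simp) (by simp [add_smul])]
  refine Finset.sum_congr rfl fun i _ => ?_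
  rcases B i with ⟨μ', k', u'⟩ | ⟨μ', k'⟩
  · simp [onPair]
  · simp [onPair]

theorem modTwoSpectrum_eq_sum {p : ℂ × ℕ × ℤˣ →₀ ℕ} (hB : ∀ i, (B i).Admissible)
    (hp : ∀ μ k u, p (μ, k, u) = Nat.card {i : Fin r // B i = circle μ k u}) :
    modTwoSpectrum p = ∑ i, (B i).sp := by
  classical
  ext α
  rw [modTwoSpectrum, Finsupp.count_toMultiset, Finsupp.ofSupportFinite_coe, Multiset.count_sum',
    spMult]
  have h := sum_circle hp (fun x => if x.1 = expTwoPiI α then spCoeff x.2.1 x.2.2 α else 0)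
  have hc : ∀ i, (B i).sp.count α = if 0 < α ∧ α ≤ 2 then
      onCircle (fun x => if x.1 = expTwoPiI α then spCoeff x.2.1 x.2.2 α else 0) (B i) else 0 := by
    intro i
    have hi := hB i
    generalize B i = b at hi ⊢
    rcases b with ⟨μ', k', u'⟩ | ⟨μ', k'⟩
    · rw [count_sp_circle hi.1]; rfl
    · simp [sp, onCircle]
  simp only [hc]
  split_ifs
  · rw [← h]
    refine Finsupp.sum_congr fun x _ => ?_
    split_ifs <;> simp [mul_comm]
  · simp

theorem ispMult_eq_count {q : ℂ × ℕ →₀ ℕ} (hB : ∀ i, (B i).Admissible)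
    (hq : ∀ μ k, q (μ, k) = Nat.card {i : Fin r // B i = pair μ k}) :
    Finsupp.toMultiset (Finsupp.ofSupportFinite (ispMult q) (finite_support_ispMult q)) =
      ∑ i, (B i).isp := by
  classical
  ext z
  rw [Finsupp.count_toMultiset, Finsupp.ofSupportFinite_coe, Multiset.count_sum', ispMult]
  have h1 := sum_pair hq (fun x => if expTwoPiI z = x.1 then x.2 else 0)
  have h2 := sum_pair hq (fun x => if expTwoPiI z = 1 / starRingEnd ℂ x.1 then x.2 else 0)
  have hc : ∀ i, (B i).isp.count z = if 0 < z.re ∧ z.re ≤ 1 ∧ 0 < z.im then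
      onPair (fun x => if expTwoPiI z = x.1 then x.2 else 0) (B i)
      else if 1 < z.re ∧ z.re ≤ 2 ∧ z.im < 0 then
        onPair (fun x => if expTwoPiI z = 1 / starRingEnd ℂ x.1 then x.2 else 0) (B i)
      else 0 := by
    intro i
    have hi := hB i
    generalize B i = b at hi ⊢
    rcases b with ⟨μ', k', u'⟩ | ⟨μ', k'⟩
    · simp [isp, onPair]
    · rw [count_isp_pair (norm_pos_iff.1 hi.1) hi.2.1]; rfl
  simp only [hc]
  split_ifs
  · rw [← h1]
    refine Finsupp.sum_congr fun x _ => ?_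
    split_ifs <;> simp [mul_comm]
  · rw [← h2]
    refine Finsupp.sum_congr fun x _ => ?_
    split_ifs <;> simp [mul_comm]
  · simp

open Classical in
theorem evenTerm_eq_sum {p : ℂ × ℕ × ℤˣ →₀ ℕ}
    (hp : ∀ μ k u, p (μ, k, u) = Nat.card {i : Fin r // B i = circle μ k u}) (ζ : ℂ) :
    evenTerm p ζ = ∑ i, onCircle
      (fun x => if x.1 = ζ ∧ Even x.2.1 then ((x.2.2 : ℤˣ) : ℤ) else 0) (B i) := by
  rw [← sum_circle hp, evenTerm]
  refine Finsupp.sum_congr fun x _ => ?_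
  split_ifs <;> simp [mul_comm]

end Sums

end BlockLabel

/-! ### Block signatures matched with block spectra -/

namespace BlockLabel

open Classical in
/-- The signature of the hermitian form of the block at `e^{2πix}`. -/
def levineSign (x : ℝ) : BlockLabel → ℤ
  | circle μ k u =>
      if Odd k then
        (u : ℤ) * (if (stripLog μ).re = 1 then (-1 : ℤ) else (SignType.sign ((stripLog μ).re - x) : ℤ))
      else if (stripLog μ).re = x then u else 0
  | pair _ _ => 0

/-- The sines of πx and πa are positive, and π(a - x) lies in (-π, π), where the sine has the sign
of its argument. -/
theorem sign_jump {x a : ℝ} (hx0 : 0 < x) (hx1 : x < 1) (ha0 : 0 < a) (ha1 : a < 1) :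
    SignType.sign (2 * Real.sin (Real.pi * x) * Real.sin (Real.pi * (a - x)) /
      Real.sin (Real.pi * a)) = SignType.sign (a - x) := by
  have hπ := Real.pi_pos
  have h1 : 0 < Real.sin (Real.pi * x) := Real.sin_pos_of_pos_of_lt_pi (by positivity) (by nlinarith)
  have h2 : 0 < Real.sin (Real.pi * a) := Real.sin_pos_of_pos_of_lt_pi (by positivity) (by nlinarith)
  rcases lt_trichotomy a x with h | h | h
  · have h3 : Real.sin (Real.pi * (a - x)) < 0 :=
      Real.sin_neg_of_neg_of_neg_pi_lt (by nlinarith) (by nlinarith)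
    rw [sign_neg (show a - x < 0 by linarith), sign_neg]
    exact div_neg_of_neg_of_pos (mul_neg_of_pos_of_neg (by positivity) h3) h2
  · simp [h]
  · have h3 : 0 < Real.sin (Real.pi * (a - x)) :=
      Real.sin_pos_of_pos_of_lt_pi (by nlinarith) (by nlinarith)
    rw [sign_pos (show 0 < a - x by linarith), sign_pos]
    positivity

theorem hasSignature_circle {x : ℝ} (hx0 : 0 < x) (hx1 : x < 1) {μ : ℂ} {k : ℕ} {u : ℤˣ}
    {W : HVS 1 (Fin k)} (hμ : ‖μ‖ = 1) (hk : 1 ≤ k)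
    (h1 : μ ≠ 1 → IsNondegBlock 1 μ u k W) (h2 : μ = 1 → IsDegenBlock 1 u k W)
    (hV : IsUnit W.V) :
    HasSignature (W.levineForm (expTwoPiI x)) (levineSign x (circle μ k u)) := by
  have hs := stripLog_spec (ne_zero_of_norm_eq_one hμ)
  have hπ := Real.pi_pos
  have hone : (stripLog μ).re = 1 ↔ μ = 1 := by
    rw [stripLog_eq_iff hμ one_pos le_rfl]
    have : expTwoPiI ((1 : ℝ) : ℂ) = 1 := by
      simp [expTwoPiI]
    rw [this]
  obtain ⟨m, rfl⟩ : ∃ m, k = m + 1 := ⟨k - 1, by omega⟩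
  simp only [levineSign]
  by_cases hμ1 : μ = 1
  · have ha := hone.2 hμ1
    have hsin : 0 < Real.sin (Real.pi * x) :=
      Real.sin_pos_of_pos_of_lt_pi (by positivity) (by nlinarith)
    have hc0 : 0 < 4 * Real.sin (Real.pi * x) ^ 2 := by positivity
    have hc := one_sub_conj_add_one_sub x
    rw [ha, if_pos rfl, if_neg hx1.ne', mul_neg_one]
    rcases m with _ | m
    · have := hasSignature_levineForm_degen_one hV (h2 hμ1) hc0 hc
      simpa using this
    · exact hasSignature_levineForm_degen hV (h2 hμ1) hc0 hc
  · have ha : (stripLog μ).re ≠ 1 := fun h => hμ1 (hone.1 h)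
    have ha1 : (stripLog μ).re < 1 := lt_of_le_of_ne hs.2.1 ha
    obtain ⟨hb, hh, _⟩ := h1 hμ1
    rw [if_neg ha]
    by_cases hax : (stripLog μ).re = x
    · have hμx : μ = expTwoPiI x := (stripLog_eq_iff hμ hx0 hx1.le).1 hax
      have hconj : (1 - starRingEnd ℂ (expTwoPiI x)) * μ = μ - 1 := by
        -- Since |μ| = 1, μ̄μ = 1, which is what makes the shifted antidiagonal of L equal to that
        -- of b.
        rw [← hμx, sub_mul, one_mul, Complex.conj_mul', hμ]; simp
      have := hasSignature_levineForm_self hV hh hb hμ1 hconj hμx.symm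
      convert this using 1
      simp [hax]
    · have hsa : 0 < Real.sin (Real.pi * (stripLog μ).re) :=
        Real.sin_pos_of_pos_of_lt_pi (mul_pos hπ hs.1) (by nlinarith)
      have hj := jump_formula x (stripLog μ).re hsa.ne'
      rw [expTwoPiI_stripLog_re hμ] at hj
      have hsign := sign_jump hx0 hx1 hs.1 ha1
      have hc0 : 2 * Real.sin (Real.pi * x) * Real.sin (Real.pi * ((stripLog μ).re - x)) /
          Real.sin (Real.pi * (stripLog μ).re) ≠ 0 := by
        rw [← sign_ne_zero, hsign, sign_ne_zero]
        exact sub_ne_zero.2 hax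
      rw [if_neg hax]
      split_ifs with hm
      · rw [← hsign]
        exact hasSignature_levineForm_of_odd hV hh hb hμ1 hc0 hj hm
      · refine hasSignature_levineForm_of_even hV hh hb hμ1 ?_ (Nat.not_odd_iff_even.1 hm)
        intro h0
        rw [h0, zero_mul] at hj
        exact mul_ne_zero (Complex.ofReal_ne_zero.2 hc0) (sub_ne_zero.2 hμ1) hj.symm

theorem IsModel.hasSignature {x : ℝ} (hx0 : 0 < x) (hx1 : x < 1) {B : BlockLabel}
    {W : HVS 1 B.Idx} (hB : B.IsModel 1 W) (hV : IsUnit W.V) :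
    HasSignature (W.levineForm (expTwoPiI x)) (B.levineSign x) := by
  cases B with
  | circle μ k u => exact hasSignature_circle hx0 hx1 hB.1 hB.2.1 hB.2.2.1 hB.2.2.2 hV
  | pair μ k => exact hasSignature_levineForm_pair hV hB.2.2.2

/-! ### Counting the spectrum of a block -/

section Count

variable {α : Type}

theorem cardIn_add (M M' : Multiset α) (A : Set α) :
    cardIn (M + M') A = cardIn M A + cardIn M' A := by
  simp [cardIn, Multiset.filter_add]

theorem cardOut_add (M M' : Multiset α) (A : Set α) :
    cardOut (M + M') A = cardOut M A + cardOut M' A := by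
  simp [cardOut, Multiset.filter_add]

theorem cardIn_sum {r : ℕ} (M : Fin r → Multiset α) (A : Set α) :
    cardIn (∑ i, M i) A = ∑ i, cardIn (M i) A :=
  map_sum ({ toFun := fun M => cardIn M A, map_zero' := by simp [cardIn],
             map_add' := fun M M' => cardIn_add M M' A } : Multiset α →+ ℕ) M _

theorem cardOut_sum {r : ℕ} (M : Fin r → Multiset α) (A : Set α) :
    cardOut (∑ i, M i) A = ∑ i, cardOut (M i) A :=
  map_sum ({ toFun := fun M => cardOut M A, map_zero' := by simp [cardOut],
             map_add' := fun M M' => cardOut_add M M' A } : Multiset α →+ ℕ) M _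

open Classical in
theorem cardIn_replicate (n : ℕ) (a : α) (A : Set α) :
    cardIn (Multiset.replicate n a) A = if a ∈ A then n else 0 := by
  split_ifs with h
  · rw [cardIn, Multiset.filter_eq_self.2 (fun b hb => by rwa [Multiset.eq_of_mem_replicate hb])]
    simp
  · rw [cardIn, Multiset.filter_eq_nil.2 (fun b hb => by rwa [Multiset.eq_of_mem_replicate hb])]
    simp

open Classical in
theorem cardOut_replicate (n : ℕ) (a : α) (A : Set α) :
    cardOut (Multiset.replicate n a) A = if a ∈ A then 0 else n := by
  split_ifs with h
  · rw [cardOut, Multiset.filter_eq_nil.2 (fun b hb => by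
      rw [Multiset.eq_of_mem_replicate hb]; exact not_not.2 h)]
    simp
  · rw [cardOut, Multiset.filter_eq_self.2 (fun b hb => by rwa [Multiset.eq_of_mem_replicate hb])]
    simp

theorem cardOut_congr {M : Multiset α} {A A' : Set α} (h : ∀ a ∈ M, a ∈ A ↔ a ∈ A') :
    cardOut M A = cardOut M A' := by
  classical
  rw [cardOut, cardOut, Multiset.filter_congr (fun a ha => not_congr (h a ha))]

end Count

theorem spCoeff_of_even {k : ℕ} (hk : ¬ Odd k) (u : ℤˣ) (a : ℝ) : spCoeff k u a = k / 2 := by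
  rw [spCoeff, if_neg hk]

theorem spCoeff_of_odd {k : ℕ} (hk : Odd k) (u : ℤˣ) (a : ℝ) :
    2 * (spCoeff k u a : ℤ) = k - (u : ℤ) * (((-1 : ℤˣ) ^ ⌊a⌋ : ℤˣ) : ℤ) := by
  obtain ⟨l, rfl⟩ := hk
  rw [spCoeff, if_pos ⟨l, rfl⟩]
  -- As k is odd and the product of the two signs is ±1, k - uv is even and nonnegative, so neither
  -- the division nor `toNat` loses anything.
  rcases Int.units_eq_one_or u with rfl | rfl <;>
    rcases Int.units_eq_one_or ((-1 : ℤˣ) ^ ⌊a⌋) with h | h <;> rw [h] <;> simp <;> omega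

/-- Passing from a to a + 1 reverses v. This difference is the signature contribution of the block,
up to the choice of which of the two points lies in the interval. -/
theorem spCoeff_sub_of_odd {k : ℕ} (hk : Odd k) (u : ℤˣ) (a : ℝ) :
    (spCoeff k u (a + 1) : ℤ) - spCoeff k u a = (u : ℤ) * (((-1 : ℤˣ) ^ ⌊a⌋ : ℤˣ) : ℤ) := by
  have h1 := spCoeff_of_odd hk u a
  have h2 := spCoeff_of_odd hk u (a + 1)
  have h3 : ((-1 : ℤˣ) ^ ⌊a + 1⌋ : ℤˣ) = -((-1 : ℤˣ) ^ ⌊a⌋ : ℤˣ) := by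
    rw [Int.floor_add_one, zpow_add, zpow_one]; simp
  rw [h3, Units.val_neg] at h2
  linarith

theorem spCoeff_add_of_odd {k : ℕ} (hk : Odd k) (u : ℤˣ) (a : ℝ) :
    spCoeff k u a + spCoeff k u (a + 1) = k := by
  have h1 := spCoeff_of_odd hk u a
  have h2 := spCoeff_of_odd hk u (a + 1)
  have h3 : ((-1 : ℤˣ) ^ ⌊a + 1⌋ : ℤˣ) = -((-1 : ℤˣ) ^ ⌊a⌋ : ℤˣ) := by
    rw [Int.floor_add_one, zpow_add, zpow_one]; simp
  rw [h3, Units.val_neg] at h2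
  have : (spCoeff k u a : ℤ) + spCoeff k u (a + 1) = k := by linarith
  exact_mod_cast this

theorem spCoeff_add {k : ℕ} (u : ℤˣ) (a : ℝ) : spCoeff k u a + spCoeff k u (a + 1) = k := by
  by_cases hk : Odd k
  · exact spCoeff_add_of_odd hk u a
  · rw [spCoeff_of_even hk, spCoeff_of_even hk]
    obtain ⟨l, rfl⟩ := Nat.not_odd_iff_even.1 hk
    omega

open Classical in
-- For a < x only a + 1 lies in (x, x + 1), for a > x only a does, and for a = x both are endpoints
-- and leave only the even term. At a = 1 the floor makes v = -1, which accounts for the reversed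
-- sign of the degenerate blocks.
theorem levineSign_eq {x : ℝ} (hx0 : 0 < x) (hx1 : x < 1) {B : BlockLabel} (hB : B.Admissible) :
    B.levineSign x = -(cardIn B.sp (Set.Ioo x (x + 1)) : ℤ) + cardOut B.sp (Set.Icc x (x + 1)) +
      onCircle (fun y => if y.1 = expTwoPiI x ∧ Even y.2.1 then ((y.2.2 : ℤˣ) : ℤ) else 0) B := by
  rcases B with ⟨μ, k, u⟩ | ⟨μ, k⟩
  · have hs := stripLog_spec (ne_zero_of_norm_eq_one hB.1)
    have hμx := stripLog_eq_iff hB.1 hx0 hx1.le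
    simp only [levineSign, sp, onCircle, cardIn_add, cardOut_add, cardIn_replicate,
      cardOut_replicate, Set.mem_Ioo, Set.mem_Icc, ← hμx]
    set a := (stripLog μ).re
    obtain ⟨ha0, ha1, _⟩ := hs
    have hdiff : (spCoeff k u (a + 1) : ℤ) - spCoeff k u a =
        if Odd k then (u : ℤ) * (if a = 1 then -1 else 1) else 0 := by
      split_ifs with hk h1
      · rw [spCoeff_sub_of_odd hk, h1]; simp
      · have hfl : ⌊a⌋ = 0 := Int.floor_eq_zero_iff.2 ⟨ha0.le, lt_of_le_of_ne ha1 h1⟩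
        rw [spCoeff_sub_of_odd hk, hfl]; simp
      · rw [spCoeff_of_even hk, spCoeff_of_even hk, sub_self]
    rcases lt_trichotomy a x with h | h | h
    · have e1 : ¬ (x < a ∧ a < x + 1) := fun h' => by linarith [h'.1]
      have e2 : x < a + 1 ∧ a + 1 < x + 1 := ⟨by linarith, by linarith⟩
      have e3 : ¬ (x ≤ a ∧ a ≤ x + 1) := fun h' => by linarith [h'.1]
      have e4 : x ≤ a + 1 ∧ a + 1 ≤ x + 1 := ⟨by linarith, by linarith⟩
      have e5 : a ≠ 1 := by linarith
      rw [if_neg e1, if_pos e2, if_neg e3, if_pos e4, if_neg e5, if_neg h.ne,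
        sign_neg (by linarith), if_neg (show ¬ (a = x ∧ Even k) from fun h' => h.ne h'.1)]
      rw [if_neg e5] at hdiff
      push_cast
      split_ifs at hdiff ⊢ <;> simp at hdiff ⊢ <;> linarith
    · have e1 : ¬ (x < a ∧ a < x + 1) := fun h' => by linarith [h'.1]
      have e2 : ¬ (x < a + 1 ∧ a + 1 < x + 1) := fun h' => by linarith [h'.2]
      have e3 : x ≤ a ∧ a ≤ x + 1 := ⟨by linarith, by linarith⟩
      have e4 : x ≤ a + 1 ∧ a + 1 ≤ x + 1 := ⟨by linarith, by linarith⟩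
      have e5 : a ≠ 1 := by linarith
      rw [if_neg e1, if_neg e2, if_pos e3, if_pos e4, if_neg e5, if_pos h, h]
      by_cases hk : Odd k
      · simp [hk, Nat.not_even_iff_odd.2 hk]
      · simp [hk, Nat.not_odd_iff_even.1 hk]
    · have e1 : x < a ∧ a < x + 1 := ⟨h, by linarith⟩
      have e2 : ¬ (x < a + 1 ∧ a + 1 < x + 1) := fun h' => by linarith [h'.2]
      have e3 : x ≤ a ∧ a ≤ x + 1 := ⟨by linarith, by linarith⟩
      have e4 : ¬ (x ≤ a + 1 ∧ a + 1 ≤ x + 1) := fun h' => by linarith [h'.2]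
      rw [if_pos e1, if_neg e2, if_pos e3, if_neg e4, if_neg h.ne',
        sign_pos (by linarith), if_neg (show ¬ (a = x ∧ Even k) from fun h' => h.ne' h'.1)]
      push_cast
      split_ifs at hdiff ⊢ <;> simp at hdiff ⊢ <;> linarith
  · simp [levineSign, sp, onCircle, cardIn, cardOut]

theorem mem_sp_circle {μ : ℂ} {k : ℕ} {u : ℤˣ} {α : ℝ} (h : α ∈ (circle μ k u).sp) :
    α = (stripLog μ).re ∨ α = (stripLog μ).re + 1 := by
  rw [sp, Multiset.mem_add] at h
  exact h.imp Multiset.eq_of_mem_replicate Multiset.eq_of_mem_replicate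

theorem exists_mem_sp_circle (μ : ℂ) {k : ℕ} (hk : 1 ≤ k) (u : ℤˣ) :
    (stripLog μ).re ∈ (circle μ k u).sp ∨ (stripLog μ).re + 1 ∈ (circle μ k u).sp := by
  have h := spCoeff_add (k := k) u (stripLog μ).re
  by_cases h0 : spCoeff k u (stripLog μ).re = 0
  · right
    rw [sp, Multiset.mem_add]
    exact Or.inr (Multiset.mem_replicate.2 ⟨by omega, rfl⟩)
  · left
    rw [sp, Multiset.mem_add]
    exact Or.inl (Multiset.mem_replicate.2 ⟨h0, rfl⟩)

theorem ne_of_mem_sp {x : ℝ} (hx0 : 0 < x) (hx1 : x < 1) {B : BlockLabel} (hB : B.Admissible)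
    (hne : ∀ k u, B ≠ circle (expTwoPiI x) k u) {α : ℝ} (hα : α ∈ B.sp) : α ≠ x ∧ α ≠ x + 1 := by
  rcases B with ⟨μ, k, u⟩ | ⟨μ, k⟩
  · have hs := stripLog_spec (ne_zero_of_norm_eq_one hB.1)
    have hμx := stripLog_eq_iff hB.1 hx0 hx1.le
    have hax : (stripLog μ).re ≠ x := fun h => hne k u (by rw [hμx.1 h])
    rcases mem_sp_circle hα with rfl | rfl
    · exact ⟨hax, by linarith [hs.2.1]⟩
    · exact ⟨by linarith [hs.1], fun h => hax (by linarith)⟩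
  · simp [sp] at hα

/-- The two points have real parts a and a + 1 and the same multiplicity; off the boundary exactly
one of them lies in the strip of width 1. -/
theorem cardIn_isp_eq_cardOut_isp {x : ℝ} (hx0 : 0 < x) (hx1 : x < 1) {B : BlockLabel}
    (hB : B.Admissible) (hne : ∀ z ∈ B.isp, z.re ≠ x ∧ z.re ≠ x + 1) :
    cardIn B.isp (strip x) = cardOut B.isp (strip x) := by
  classical
  rcases B with ⟨μ, k, u⟩ | ⟨μ, k⟩
  · simp [isp, cardIn, cardOut]
  · obtain ⟨hμ0, _, hk⟩ := hB
    have hs := stripLog_spec (norm_pos_iff.1 hμ0)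
    have hm : stripLog μ ∈ (pair μ k).isp := by
      rw [isp, Multiset.mem_add]
      exact Or.inl (Multiset.mem_replicate.2 ⟨by omega, rfl⟩)
    have hax := (hne _ hm).1
    simp only [isp, cardIn_add, cardOut_add, cardIn_replicate, cardOut_replicate, strip,
      Set.mem_ofPred_eq, Complex.add_re, Complex.one_re, Complex.conj_re]
    rcases lt_or_gt_of_ne hax with h | h
    · rw [if_neg (fun h' => by linarith [h'.1]), if_pos ⟨by linarith, by linarith⟩,
        if_neg (fun h' => by linarith [h'.1]), if_pos ⟨by linarith, by linarith⟩, add_comm]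
    · rw [if_pos ⟨by linarith, by linarith⟩, if_neg (fun h' => by linarith [h'.2]),
        if_pos ⟨by linarith, by linarith⟩, if_neg (fun h' => by linarith [h'.2]), add_comm]

end BlockLabel

/-! ### The boundary of the strip and eigenvalues of the monodromy -/

theorem frontier_strip (x : ℝ) : frontier (strip x) = {z : ℂ | z.re = x ∨ z.re = x + 1} := by
  have h : strip x = Complex.re ⁻¹' (Set.Ioo x (x + 1)) := rfl
  rw [h, Complex.frontier_preimage_re, frontier_Ioo (by linarith)]
  ext z; simp

theorem expTwoPiI_ne_one {x : ℝ} (hx0 : 0 < x) (hx1 : x < 1) : expTwoPiI x ≠ 1 := by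
  have h1 : expTwoPiI (1 : ℂ) = 1 := by simp [expTwoPiI]
  intro h
  rcases (expTwoPiI_eq_iff_of_strip (z := x) (w := 1) (by simp) (by simp) (by simpa)
    (by simp; linarith)).1 (h.trans h1.symm) with h | h
  · have : x = 1 := by exact_mod_cast h
    linarith
  · have : x = 1 + 1 := by exact_mod_cast h
    linarith

theorem HVS.Iso.hasEigenvalue {n : ℕ} {ι κ : Type} [Fintype ι] [DecidableEq ι] [Fintype κ]
    [DecidableEq κ] {A : HVS n ι} {B : HVS n κ} (h : A.Iso B) {μ : ℂ}
    (hμ : Module.End.HasEigenvalue (Matrix.toLin' B.h) μ) :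
    Module.End.HasEigenvalue (Matrix.toLin' A.h) μ := by
  obtain ⟨φ, ψ, h1, h2, _, hh, _⟩ := h
  obtain ⟨v, hv, hv0⟩ := hμ.exists_hasEigenvector
  rw [Module.End.mem_eigenspace_iff, Matrix.toLin'_apply] at hv
  refine Module.End.hasEigenvalue_of_hasEigenvector (x := ψ *ᵥ v) ⟨?_, ?_⟩
  · rw [Module.End.mem_eigenspace_iff, Matrix.toLin'_apply, hh, Matrix.mulVec_mulVec,
      Matrix.mul_assoc, h2, Matrix.mul_one, ← Matrix.mulVec_mulVec, hv, Matrix.mulVec_smul]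
  · intro h0
    apply hv0
    have : φ *ᵥ (ψ *ᵥ v) = v := by rw [Matrix.mulVec_mulVec, h2, Matrix.one_mulVec]
    rw [← this, h0, Matrix.mulVec_zero]

/-- The first basis vector of a circle block is an eigenvector for μ, in the degenerate case too.
Hence, if ζ is not an eigenvalue, no block has μ = ζ. -/
theorem BlockLabel.hasEigenvalue_circle {n : ℕ} {μ : ℂ} {k : ℕ} {u : ℤˣ} {W : HVS n (Fin k)}
    (hk : 1 ≤ k) (h1 : μ ≠ 1 → IsNondegBlock n μ u k W) (h2 : μ = 1 → IsDegenBlock n u k W) :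
    ∃ a : Fin k, ∀ b, W.h b a = if b = a then μ else 0 := by
  obtain ⟨m, rfl⟩ : ∃ m, k = m + 1 := ⟨k - 1, by omega⟩
  have hJ : ∀ b, jordanOne (m + 1) b 0 = if b = 0 then 1 else 0 := by
    intro b
    have := mul_jordanOne_zero (1 : Matrix (Fin (m + 1)) (Fin (m + 1)) ℂ) b
    rw [Matrix.one_mul] at this
    rw [this, Matrix.one_apply]
  refine ⟨0, fun b => ?_⟩
  by_cases hμ : μ = 1
  · have h := h2 hμ
    rcases m with _ | m
    · rw [h.2.1, hμ, Matrix.one_apply]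
    · rw [h.1, hJ, hμ]
  · rw [(h1 hμ).2.1, Matrix.smul_apply, hJ]; simp

theorem HVS.hasEigenvalue_directSum {n r : ℕ} {τ : Fin r → Type} [∀ i, Fintype (τ i)]
    [∀ i, DecidableEq (τ i)] {W : ∀ i, HVS n (τ i)} {i : Fin r} {a : τ i} {μ : ℂ}
    (h : ∀ b, (W i).h b a = if b = a then μ else 0) :
    Module.End.HasEigenvalue (Matrix.toLin' (directSum W).h) μ := by
  refine Module.End.hasEigenvalue_of_hasEigenvector (x := Pi.single ⟨i, a⟩ 1) ⟨?_, ?_⟩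
  · rw [Module.End.mem_eigenspace_iff, Matrix.toLin'_apply, Matrix.mulVec_single_one]
    ext ⟨j, b⟩
    change Matrix.blockDiagonal' (fun i => (W i).h) ⟨j, b⟩ ⟨i, a⟩ = _
    by_cases hij : j = i
    · subst hij
      rw [Matrix.blockDiagonal'_apply_eq, h]
      by_cases hb : b = a
      · subst hb; simp
      · have hne : (⟨j, b⟩ : Σ i, τ i) ≠ ⟨j, a⟩ := fun h' => hb (by simpa using h')
        simp [hb, hne]
    · rw [Matrix.blockDiagonal'_apply_ne _ _ _ hij]
      have hne : (⟨j, b⟩ : Σ i, τ i) ≠ ⟨i, a⟩ := fun h' => hij (congrArg Sigma.fst h')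
      simp [hne]
  · intro h0
    have := congrFun h0 ⟨i, a⟩
    simp at this

/-! ### The signature formulas for given H-numbers -/

section Formula

variable {m : ℕ} {T : Matrix (Fin m) (Fin m) ℝ} {hT : T.det ≠ 0} {r : ℕ} {B : Fin r → BlockLabel}
  {W : ∀ i, HVS 1 (B i).Idx} {x : ℝ}

theorem tristramLevine_eq_sum_levineSign (hW : ∀ i, (B i).IsModel 1 (W i))
    (hiso : (variationStructure T hT).Iso (HVS.directSum W)) (hx0 : 0 < x) (hx1 : x < 1) :
    tristramLevine T (expTwoPiI x) = ∑ i, (B i).levineSign x := by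
  have hV := hiso.isUnit_V (isUnit_variationStructure_V T hT)
  have hVi := HVS.isUnit_V_of_directSum hV
  rw [← tristramLevine_conj]
  refine HasSignature.tristramLevine_eq ?_
  rw [← levineForm_variationStructure T hT]
  refine hiso.hasSignature hV ?_
  rw [HVS.levineForm_directSum hVi]
  exact HasSignature.blockDiagonal' fun i => (hW i).hasSignature hx0 hx1 (hVi i)

theorem IsHNumbers.tristramLevine_eq {p : ℂ × ℕ × ℤˣ →₀ ℕ} {q : ℂ × ℕ →₀ ℕ}
    (h : IsHNumbers (variationStructure T hT) p q) (hx0 : 0 < x) (hx1 : x < 1) :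
    ((tristramLevine T (expTwoPiI x) =
        -(cardIn (modTwoSpectrum p) (Set.Ioo x (x + 1)) : ℤ)
          + (cardOut (modTwoSpectrum p) (Set.Icc x (x + 1)) : ℤ)
          + evenTerm p (expTwoPiI x)) ∧
      (¬ Module.End.HasEigenvalue (Matrix.toLin' (variationStructure T hT).h) (expTwoPiI x) →
        tristramLevine T (expTwoPiI x) =
          -(cardIn (modTwoSpectrum p) (Set.Ioo x (x + 1)) : ℤ)
            + (cardOut (modTwoSpectrum p) (Set.Ioo x (x + 1)) : ℤ))) ∧
    ((∀ z ∈ extendedSpectrum p q, z ∉ frontier (strip x)) →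
      tristramLevine T (expTwoPiI x) =
        -(cardIn (extendedSpectrum p q) (strip x) : ℤ)
          + (cardOut (extendedSpectrum p q) (strip x) : ℤ)) := by
  classical
  obtain ⟨r, B, W, hW, hiso, hp, hq⟩ := h
  have hadm : ∀ i, (B i).Admissible := fun i => (hW i).admissible
  have hsp := BlockLabel.modTwoSpectrum_eq_sum hadm hp
  have hformula : tristramLevine T (expTwoPiI x) =
      -(cardIn (modTwoSpectrum p) (Set.Ioo x (x + 1)) : ℤ)
        + (cardOut (modTwoSpectrum p) (Set.Icc x (x + 1)) : ℤ) + evenTerm p (expTwoPiI x) := by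
    rw [tristramLevine_eq_sum_levineSign hW hiso hx0 hx1, hsp, BlockLabel.cardIn_sum,
      BlockLabel.cardOut_sum, BlockLabel.evenTerm_eq_sum hp]
    push_cast
    rw [← Finset.sum_neg_distrib, ← Finset.sum_add_distrib, ← Finset.sum_add_distrib]
    exact Finset.sum_congr rfl fun i _ => BlockLabel.levineSign_eq hx0 hx1 (hadm i)
  -- If no block has μ = ζ, the even term is empty and neither x nor x + 1 is in the spectrum, so
  -- open and closed intervals count alike. Both the eigenvalue condition and the boundary condition
  -- reduce to this case.
  have hregular : (∀ i k u, B i ≠ BlockLabel.circle (expTwoPiI x) k u) →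
      tristramLevine T (expTwoPiI x) =
          -(cardIn (modTwoSpectrum p) (Set.Ioo x (x + 1)) : ℤ)
            + (cardOut (modTwoSpectrum p) (Set.Ioo x (x + 1)) : ℤ) := by
    intro hne
    have heven : evenTerm p (expTwoPiI x) = 0 := by
      rw [BlockLabel.evenTerm_eq_sum hp]
      refine Finset.sum_eq_zero fun i _ => ?_
      have hi := hne i
      generalize B i = b at hi ⊢
      rcases b with ⟨μ, k, u⟩ | ⟨μ, k⟩
      · refine if_neg fun h' => hi k u ?_
        have h1 : μ = expTwoPiI x := h'.1
        rw [h1]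
      · rfl
    have hout : cardOut (modTwoSpectrum p) (Set.Icc x (x + 1)) =
        cardOut (modTwoSpectrum p) (Set.Ioo x (x + 1)) := by
      refine BlockLabel.cardOut_congr fun α hα => ?_
      rw [hsp, Multiset.mem_sum] at hα
      obtain ⟨i, _, hα⟩ := hα
      obtain ⟨h1, h2⟩ := BlockLabel.ne_of_mem_sp hx0 hx1 (hadm i) (hne i) hα
      exact ⟨fun h => ⟨lt_of_le_of_ne h.1 h1.symm, lt_of_le_of_ne h.2 h2⟩,
        fun h => ⟨h.1.le, h.2.le⟩⟩
    rw [hformula, heven, hout, add_zero]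
  refine ⟨⟨hformula, fun heig => hregular fun i k u hi => heig ?_⟩, fun hfr => ?_⟩
  · refine hiso.hasEigenvalue ?_
    have hWi := hW i
    suffices h : ∃ a : (B i).Idx, ∀ b, (W i).h b a = if b = a then expTwoPiI x else 0 by
      obtain ⟨a, ha⟩ := h
      exact HVS.hasEigenvalue_directSum ha
    generalize W i = w at hWi ⊢
    generalize B i = b at hi w hWi ⊢
    subst hi
    exact BlockLabel.hasEigenvalue_circle hWi.2.1 hWi.2.2.1 hWi.2.2.2
  · rw [frontier_strip] at hfr
    have hisp := BlockLabel.ispMult_eq_count hadm hq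
    have hES : extendedSpectrum p q =
        (∑ i, (B i).sp).map (fun α : ℝ => (α : ℂ)) + ∑ i, (B i).isp := by
      rw [extendedSpectrum, hisp, hsp]
    have hne : ∀ i k u, B i ≠ BlockLabel.circle (expTwoPiI x) k u := by
      intro i k u hi
      have hai := hadm i
      rw [hi] at hai
      have hμ := (stripLog_eq_iff hai.1 hx0 hx1.le).2 rfl
      have hmem : ∀ α ∈ (B i).sp, (α : ℂ) ∈ extendedSpectrum p q := by
        intro α hα
        rw [hES, Multiset.mem_add]
        exact Or.inl (Multiset.mem_map_of_mem _
          (Multiset.mem_sum.2 ⟨i, Finset.mem_univ i, hα⟩))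
      -- A block with μ = ζ would put x or x + 1 into the spectrum, since its two multiplicities add
      -- up to k ≥ 1; both points lie on the boundary of the strip.
      rcases BlockLabel.exists_mem_sp_circle (expTwoPiI x) hai.2 u with h | h
      · rw [← hi] at h
        exact hfr _ (hmem _ h) (Or.inl (by simpa using hμ))
      · rw [← hi] at h
        exact hfr _ (hmem _ h) (Or.inr (by simpa using hμ))
    have hbal : cardIn (∑ i, (B i).isp) (strip x) = cardOut (∑ i, (B i).isp) (strip x) := by
      rw [BlockLabel.cardIn_sum, BlockLabel.cardOut_sum]
      refine Finset.sum_congr rfl fun i _ =>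
        BlockLabel.cardIn_isp_eq_cardOut_isp hx0 hx1 (hadm i) fun z hz => ?_
      have hz' : z ∈ extendedSpectrum p q := by
        rw [hES, Multiset.mem_add]
        exact Or.inr (Multiset.mem_sum.2 ⟨i, Finset.mem_univ i, hz⟩)
      exact not_or.1 (hfr z hz')
    have hin : cardIn ((modTwoSpectrum p).map (fun α : ℝ => (α : ℂ))) (strip x) =
        cardIn (modTwoSpectrum p) (Set.Ioo x (x + 1)) := by
      rw [cardIn, cardIn, Multiset.filter_map, Multiset.card_map]
      rfl
    have hout : cardOut ((modTwoSpectrum p).map (fun α : ℝ => (α : ℂ))) (strip x) =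
        cardOut (modTwoSpectrum p) (Set.Ioo x (x + 1)) := by
      rw [cardOut, cardOut, Multiset.filter_map, Multiset.card_map]
      rfl
    rw [hregular hne, hES, BlockLabel.cardIn_add, BlockLabel.cardOut_add, hbal, ← hsp, hin, hout]
    push_cast
    ring

end Formula

/-! ### Existence of a nondegenerate part -/

section NondegPart

theorem SEquivalent.trans {L M N : ℕ} {S : Matrix (Fin L) (Fin L) ℝ} {T : Matrix (Fin M) (Fin M) ℝ}
    {U : Matrix (Fin N) (Fin N) ℝ} (h1 : SEquivalent S T) (h2 : SEquivalent T U) :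
    SEquivalent S U :=
  Relation.EqvGen.trans _ _ _ h1 h2

theorem sEquivalent_gram {N K : ℕ} {κ : Type} [Fintype κ] [DecidableEq κ] (e : κ ≃ Fin K)
    (S : Matrix (Fin N) (Fin N) ℝ) (f : κ → Fin N → ℝ) (hf : LinearIndependent ℝ f) (hK : K = N) :
    SEquivalent S (Matrix.reindex e e (Matrix.of fun i j => f i ⬝ᵥ (S *ᵥ f j))) := by
  subst hK
  have hA : IsUnit (Matrix.of fun i => f (e.symm i)) :=
    Matrix.linearIndependent_rows_iff_isUnit.1 (hf.comp e.symm e.symm.injective)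
  have key : Matrix.reindex e e (Matrix.of fun i j => f i ⬝ᵥ (S *ᵥ f j)) =
      (Matrix.of fun i => f (e.symm i)) * S * (Matrix.of fun i => f (e.symm i))ᵀ := by
    ext i j
    rw [Matrix.mul_assoc]
    simp [Matrix.mul_apply, dotProduct, Matrix.mulVec]
  rw [key]
  exact Relation.EqvGen.rel _ _ (SStep.congr S _ hA)

theorem exists_basis_fin (K : Submodule ℝ (Fin N → ℝ)) :
    ∃ c : Fin (Module.finrank ℝ K) → Fin N → ℝ, LinearIndependent ℝ c ∧
      Submodule.span ℝ (Set.range c) = K := by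
  let b := Module.finBasis ℝ K
  refine ⟨fun i => (b i : Fin N → ℝ), b.linearIndependent.map' K.subtype K.ker_subtype, ?_⟩
  have h : Set.range (fun i => (b i : Fin N → ℝ)) = K.subtype '' Set.range b := by
    rw [← Set.range_comp]; rfl
  rw [h, Submodule.span_image, b.span_eq, Submodule.map_top, Submodule.range_subtype]

/-- In a basis c, w', v, with c spanning the vectors u such that vᵀSu = 0 and uᵀSw' = 0, the Gram
matrix of S is a row enlargement of the Gram matrix of c, which has two rows fewer. -/
theorem exists_sEquivalent_smaller {N : ℕ} (S : Matrix (Fin N) (Fin N) ℝ) {v w : Fin N → ℝ}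
    (hv : S *ᵥ v = 0) (hvw : v ⬝ᵥ (S *ᵥ w) ≠ 0) :
    ∃ (M : ℕ) (A : Matrix (Fin M) (Fin M) ℝ), M < N ∧ SEquivalent S A := by
  -- Scale w so that vᵀSw = 1, then subtract the multiple of v that makes w isotropic; Sv = 0 keeps
  -- the first value.
  obtain ⟨w', hvw', hww'⟩ : ∃ w', v ⬝ᵥ (S *ᵥ w') = 1 ∧ w' ⬝ᵥ (S *ᵥ w') = 0 := by
    set t := v ⬝ᵥ (S *ᵥ w)
    set a := w ⬝ᵥ (S *ᵥ w)
    have h1 : S *ᵥ (t⁻¹ • w - (t⁻¹ * t⁻¹ * a) • v) = t⁻¹ • (S *ᵥ w) := by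
      rw [Matrix.mulVec_sub, Matrix.mulVec_smul, Matrix.mulVec_smul, hv]; simp
    refine ⟨t⁻¹ • w - (t⁻¹ * t⁻¹ * a) • v, ?_, ?_⟩
    · rw [h1, dotProduct_smul, smul_eq_mul]
      exact inv_mul_cancel₀ hvw
    · rw [h1, sub_dotProduct, dotProduct_smul, dotProduct_smul, smul_dotProduct, smul_dotProduct]
      change t⁻¹ • t⁻¹ • a - t⁻¹ • (t⁻¹ * t⁻¹ * a) • t = 0
      simp only [smul_eq_mul]
      field_simp
      ring
  let L : (Fin N → ℝ) →ₗ[ℝ] (Fin 2 → ℝ) := LinearMap.pi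
    ![{ toFun := fun u => v ⬝ᵥ (S *ᵥ u)
        map_add' := fun a b => by rw [Matrix.mulVec_add, dotProduct_add]
        map_smul' := fun c a => by rw [Matrix.mulVec_smul, dotProduct_smul]; rfl },
      { toFun := fun u => u ⬝ᵥ (S *ᵥ w')
        map_add' := fun a b => by rw [add_dotProduct]
        map_smul' := fun c a => by rw [smul_dotProduct]; rfl }]
  have hL0 : ∀ u, L u 0 = v ⬝ᵥ (S *ᵥ u) := fun u => rfl
  have hL1 : ∀ u, L u 1 = u ⬝ᵥ (S *ᵥ w') := fun u => rfl
  have hLw : ∀ a b : ℝ, L (a • w' + b • v) = ![a, b] := by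
    intro a b
    ext i
    fin_cases i
    · change L _ 0 = _
      rw [hL0, Matrix.mulVec_add, Matrix.mulVec_smul, Matrix.mulVec_smul, hv, smul_zero, add_zero,
        dotProduct_smul, hvw']
      simp
    · change L _ 1 = _
      rw [hL1, add_dotProduct, smul_dotProduct, smul_dotProduct, hvw', hww']
      simp
  -- L maps span(w', v) isomorphically onto ℝ², so ker L is a complement of dimension N - 2.
  have hsurj : LinearMap.range L = ⊤ := LinearMap.range_eq_top.2 fun y => ⟨y 0 • w' + y 1 • v, by
    rw [hLw]; ext i; fin_cases i <;> rfl⟩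
  have hdim := L.finrank_range_add_finrank_ker
  rw [hsurj, finrank_top, Module.finrank_fin_fun, Module.finrank_fin_fun] at hdim
  obtain ⟨c, hc, hspan⟩ := exists_basis_fin (LinearMap.ker L)
  have hcK : ∀ i, L (c i) = 0 := fun i => by
    have : c i ∈ LinearMap.ker L := hspan ▸ Submodule.subset_span ⟨i, rfl⟩
    exact this
  have hc0 : ∀ i, v ⬝ᵥ (S *ᵥ c i) = 0 := fun i => by rw [← hL0, hcK]; rfl
  have hc1 : ∀ i, c i ⬝ᵥ (S *ᵥ w') = 0 := fun i => by rw [← hL1, hcK]; rfl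
  have h2 : LinearIndependent ℝ ![w', v] := by
    rw [LinearIndependent.pair_iff]
    intro a b hab
    have h := hLw a b
    rw [hab, map_zero] at h
    exact ⟨(congrFun h 0).symm, (congrFun h 1).symm⟩
  have hli : LinearIndependent ℝ (Sum.elim c ![w', v]) := by
    refine hc.sum_type h2 ?_
    rw [hspan, Submodule.disjoint_def]
    intro y hy hy2
    rw [Matrix.range_cons, Matrix.range_cons, Matrix.range_empty, Set.union_empty,
      Set.singleton_union, Submodule.mem_span_pair] at hy2
    obtain ⟨a, b, rfl⟩ := hy2
    have h : L (a • w' + b • v) = 0 := hy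
    rw [hLw] at h
    have ha : a = 0 := congrFun h 0
    have hb : b = 0 := congrFun h 1
    rw [ha, hb]; simp
  refine ⟨_, Matrix.of fun i j => c i ⬝ᵥ (S *ᵥ c j), by omega, ?_⟩
  have hE := sEquivalent_gram finSumFinEquiv S _ hli (by omega)
  refine hE.trans (Relation.EqvGen.symm _ _ (Relation.EqvGen.rel _ _ ?_))
  convert SStep.rowEnlarge (Matrix.of fun i j => c i ⬝ᵥ (S *ᵥ c j)) (fun j => w' ⬝ᵥ (S *ᵥ c j))
    using 3
  ext i j
  rcases i with i | i <;> rcases j with j | j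
  · simp
  · fin_cases j <;> simp [hc1, hv]
  · fin_cases i <;> simp [hc0]
  · fin_cases i <;> fin_cases j <;> simp [hv, hvw', hww']

/-- Here ker S is orthogonal to everything from both sides, so S is congruent to 0 plus its Gram
matrix on a complement C. A null vector of that matrix would give a vector of C ∩ ker S. -/
theorem exists_isNondegPart_of_ker_le {N : ℕ} (S : Matrix (Fin N) (Fin N) ℝ)
    (h : ∀ v, S *ᵥ v = 0 → ∀ w, v ⬝ᵥ (S *ᵥ w) = 0) :
    ∃ (m : ℕ) (T : Matrix (Fin m) (Fin m) ℝ), IsNondegPart S T := by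
  set K := LinearMap.ker S.mulVecLin
  obtain ⟨C, hC⟩ := K.exists_isCompl
  obtain ⟨k, hk, hkspan⟩ := exists_basis_fin K
  obtain ⟨c, hc, hcspan⟩ := exists_basis_fin C
  have hkK : ∀ i, S *ᵥ k i = 0 := fun i => by
    have : k i ∈ K := hkspan ▸ Submodule.subset_span ⟨i, rfl⟩
    exact this
  have hli : LinearIndependent ℝ (Sum.elim k c) :=
    hk.sum_type hc (by rw [hkspan, hcspan]; exact hC.disjoint)
  have hdim := Submodule.finrank_add_eq_of_isCompl hC
  rw [Module.finrank_fin_fun] at hdim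
  refine ⟨_, Matrix.of fun i j => c i ⬝ᵥ (S *ᵥ c j), ?_,
    Module.finrank ℝ K, ?_⟩
  · intro hdet
    obtain ⟨x, hx0, hx⟩ := Matrix.exists_mulVec_eq_zero_iff.2 hdet
    set y := ∑ j, x j • c j with hy
    have hyC : y ∈ C := by
      rw [← hcspan]
      exact Submodule.sum_mem _ fun j _ => Submodule.smul_mem _ _ (Submodule.subset_span ⟨j, rfl⟩)
    have hcy : ∀ i, c i ⬝ᵥ (S *ᵥ y) = 0 := by
      intro i
      have h1 := congrFun hx i
      rw [hy, ← Matrix.mulVecLin_apply, map_sum, dotProduct_sum]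
      refine Eq.trans ?_ h1
      rw [Matrix.mulVec, dotProduct]
      refine Finset.sum_congr rfl fun j _ => ?_
      rw [map_smul, dotProduct_smul, Matrix.mulVecLin_apply, smul_eq_mul, Matrix.of_apply, mul_comm]
    have hall : ∀ w, w ⬝ᵥ (S *ᵥ y) = 0 := by
      intro w
      have hw : w ∈ K ⊔ C := by rw [hC.sup_eq_top]; trivial
      obtain ⟨a, ha, b, hb, rfl⟩ := Submodule.mem_sup.1 hw
      rw [add_dotProduct, h a ha, zero_add]
      clear hw
      rw [← hcspan] at hb
      induction hb using Submodule.span_induction with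
      | mem _ hmem => obtain ⟨i, rfl⟩ := hmem; exact hcy i
      | zero => rw [zero_dotProduct]
      | add _ _ _ _ h1 h2 => rw [add_dotProduct, h1, h2, add_zero]
      | smul t _ _ h1 => rw [smul_dotProduct, h1, smul_zero]
    have hSy : S *ᵥ y = 0 := dotProduct_self_eq_zero.1 (hall _)
    have hy0 : y = 0 := Submodule.disjoint_def.1 hC.disjoint y hSy hyC
    exact hx0 (funext fun j => Fintype.linearIndependent_iff.1 hc x hy0 j)
  · have hE := sEquivalent_gram finSumFinEquiv S _ hli hdim
    convert hE using 2
    ext i j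
    rcases i with i | i <;> rcases j with j | j
    · simp [hkK]
    · simp [h _ (hkK i)]
    · simp [hkK]
    · simp

theorem exists_isNondegPart {N : ℕ} (S : Matrix (Fin N) (Fin N) ℝ) :
    ∃ (m : ℕ) (T : Matrix (Fin m) (Fin m) ℝ), IsNondegPart S T := by
  induction N using Nat.strong_induction_on with
  | _ N ih =>
    by_cases h : ∀ v, S *ᵥ v = 0 → ∀ w, v ⬝ᵥ (S *ᵥ w) = 0
    · exact exists_isNondegPart_of_ker_le S h
    · push Not at h
      obtain ⟨v, hv, w, hvw⟩ := h
      obtain ⟨M, A, hM, hA⟩ := exists_sEquivalent_smaller S hv hvw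
      obtain ⟨m, T, hT, r, hr⟩ := ih M hM A
      exact ⟨m, T, hT, r, hA.trans hr⟩

end NondegPart

/-! ### Nondegenerate sesquilinear forms and their asymmetry -/

/-- The sesquilinear form `A` is nondegenerate and `h` is its asymmetry (cosquare). -/
structure IsAsymmetry {V : Type} [AddCommGroup V] [Module ℂ V]
    (A : V →ₗ⋆[ℂ] V →ₗ[ℂ] ℂ) (h : Module.End ℂ V) : Prop where
  apply_right : ∀ x y, A x (h y) = starRingEnd ℂ (A y x)
  nondegenerate : ∀ y, (∀ x, A x y = 0) → y = 0

/-- The operator `λ⁻¹ h - 1`, nilpotent on the generalized `λ`-eigenspace of `h`. -/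
def shifted {V : Type} [AddCommGroup V] [Module ℂ V] (h : Module.End ℂ V) (l : ℂ) :
    Module.End ℂ V := l⁻¹ • h - 1

section Asymmetry

variable {V : Type} [AddCommGroup V] [Module ℂ V] {A : V →ₗ⋆[ℂ] V →ₗ[ℂ] ℂ} {h g : Module.End ℂ V}
  {κ l : ℂ}

theorem shifted_apply (x : V) : shifted h l x = l⁻¹ • h x - x := rfl

theorem apply_eq_smul_add_shifted (hl : l ≠ 0) (x : V) : h x = l • (x + shifted h l x) := by
  rw [shifted_apply, add_sub_cancel, smul_smul, mul_inv_cancel₀ hl, one_smul]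

theorem shifted_pow_apply_mem_ker {n : ℕ} (i : ℕ) {x : V} (hx : (shifted h l ^ n) x = 0) :
    (shifted h l ^ n) ((shifted h l ^ i) x) = 0 := by
  rw [← Module.End.mul_apply, ← pow_add, add_comm, pow_add, Module.End.mul_apply, hx, map_zero]

theorem shifted_pow_eq_zero_of_le {i j : ℕ} (hij : i ≤ j) {x : V} (hx : (shifted h l ^ i) x = 0) :
    (shifted h l ^ j) x = 0 := by
  obtain ⟨d, rfl⟩ := Nat.exists_eq_add_of_le hij
  rw [add_comm, pow_add, Module.End.mul_apply, hx, map_zero]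

namespace IsAsymmetry

variable (H : IsAsymmetry A h)
include H

theorem apply_apply (x y : V) : A (h x) (h y) = A x y := by
  rw [H.apply_right, H.apply_right, Complex.conj_conj]

theorem nondegenerate_left (x : V) (hx : ∀ y, A x y = 0) : x = 0 := by
  refine H.nondegenerate x fun y => ?_
  have := H.apply_right x y
  rw [hx] at this
  simpa using this.symm

theorem injective : Function.Injective h := by
  rw [injective_iff_map_eq_zero]
  intro y hy
  refine H.nondegenerate_left y fun x => ?_
  have := H.apply_right x y
  rw [hy, map_zero] at this
  simpa using this.symm

theorem exists_inverse [FiniteDimensional ℂ V] : ∃ g : Module.End ℂ V, g * h = 1 ∧ h * g = 1 := by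
  let e := LinearEquiv.ofInjectiveEndo h H.injective
  refine ⟨e.symm.toLinearMap, ?_, ?_⟩
  · ext x; exact e.symm_apply_apply x
  · ext x; exact e.apply_symm_apply x

theorem apply_left (hg : h * g = 1) (x y : V) : A (h x) y = A x (g y) := by
  have hy : y = h (g y) := by rw [← Module.End.mul_apply, hg]; rfl
  conv_lhs => rw [hy]
  exact H.apply_apply _ _

/-- Up to the invertible factor -l·h⁻¹, the adjoint of `shifted h κ` is `shifted h l` when κ̄l = 1.
This is why A pairs the generalized eigenspaces of κ and l. -/
theorem shifted_left (hgh : g * h = 1) (hhg : h * g = 1) (hκ : starRingEnd ℂ κ * l = 1) (x y : V) :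
    A (shifted h κ x) y = A x (-(l • g (shifted h l y))) := by
  have hl : l ≠ 0 := right_ne_zero_of_mul_eq_one hκ
  have hκ' : starRingEnd ℂ κ⁻¹ = l := by
    rw [map_inv₀]; exact inv_eq_of_mul_eq_one_right hκ
  have hy : g (h y) = y := by rw [← Module.End.mul_apply, hgh]; rfl
  rw [shifted_apply, shifted_apply, map_sub, LinearMap.sub_apply, LinearMap.map_smulₛₗ,
    LinearMap.smul_apply, H.apply_left hhg, hκ', map_sub, map_smul, hy, smul_sub, smul_smul,
    mul_inv_cancel₀ hl, one_smul, neg_sub, map_sub, map_smul]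

theorem shifted_pow_left (hgh : g * h = 1) (hhg : h * g = 1) (hκ : starRingEnd ℂ κ * l = 1)
    (i : ℕ) (x y : V) :
    A ((shifted h κ ^ i) x) y = A x (((-(l • g)) ^ i) ((shifted h l ^ i) y)) := by
  have hcomm : Commute (-(l • g)) (shifted h l) := by
    have : Commute g h := by rw [Commute, SemiconjBy, hgh, hhg]
    rw [shifted]
    exact (((this.smul_right _).sub_right (Commute.one_right _)).smul_left _).neg_left
  have key : ∀ i x y, A ((shifted h κ ^ i) x) y = A x (((-(l • g) * shifted h l) ^ i) y) := by
    intro i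
    induction i with
    | zero => intro x y; rfl
    | succ i ih =>
      intro x y
      rw [pow_succ' (shifted h κ), Module.End.mul_apply, H.shifted_left hgh hhg hκ, pow_succ,
        Module.End.mul_apply, ← ih]
      rfl
  rw [key, hcomm.mul_pow]; rfl

/-- A vector killed by the n-th power for l is orthogonal to the range of the n-th power for κ; if
it were also orthogonal to the kernel, nondegeneracy would make it zero. -/
theorem exists_ne_zero_of_isCompl (hgh : g * h = 1) (hhg : h * g = 1)
    (hκ : starRingEnd ℂ κ * l = 1) {n : ℕ}
    (hc : IsCompl (LinearMap.ker (shifted h κ ^ n)) (LinearMap.range (shifted h κ ^ n))) {z : V}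
    (hz : (shifted h l ^ n) z = 0) (hz0 : z ≠ 0) :
    ∃ y, (shifted h κ ^ n) y = 0 ∧ A y z ≠ 0 := by
  by_contra hcon
  push Not at hcon
  refine hz0 (H.nondegenerate z fun x => ?_)
  have hx : x ∈ LinearMap.ker (shifted h κ ^ n) ⊔ LinearMap.range (shifted h κ ^ n) := by
    rw [hc.sup_eq_top]; trivial
  obtain ⟨a, ha, b, ⟨w, rfl⟩, rfl⟩ := Submodule.mem_sup.1 hx
  rw [map_add, LinearMap.add_apply, hcon a ha, zero_add, H.shifted_pow_left hgh hhg hκ, hz,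
    map_zero, map_zero]

omit H in
-- A Bézout identity between powers of the coprime polynomials X/l - 1 and X/κ - 1, evaluated at h.
theorem exists_shifted_pow_eq (hκ0 : κ ≠ 0) (hl0 : l ≠ 0) (hne : κ ≠ l) {n : ℕ} {x : V}
    (hx : (shifted h l ^ n) x = 0) : ∃ w, (shifted h κ ^ n) w = x := by
  have hcop : IsCoprime (Polynomial.C l⁻¹ * Polynomial.X - 1 : Polynomial ℂ)
      (Polynomial.C κ⁻¹ * Polynomial.X - 1) := by
    refine ⟨Polynomial.C (l / (κ - l)), Polynomial.C (-κ / (κ - l)), ?_⟩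
    have h0 : κ - l ≠ 0 := sub_ne_zero.2 hne
    rw [mul_sub, mul_sub, ← mul_assoc, ← mul_assoc, ← Polynomial.C_mul, ← Polynomial.C_mul]
    have e1 : l / (κ - l) * l⁻¹ = 1 / (κ - l) := by field_simp
    have e2 : -κ / (κ - l) * κ⁻¹ = -(1 / (κ - l)) := by field_simp
    rw [e1, e2, Polynomial.C_neg, mul_one, mul_one]
    have e3 : (1 : Polynomial ℂ) = Polynomial.C (-(l / (κ - l)) - -κ / (κ - l)) := by
      rw [← Polynomial.C_1]; congr 1; field_simp; ring
    rw [e3]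
    simp only [Polynomial.C_sub, Polynomial.C_neg]
    ring
  have hev : ∀ t : ℂ, Polynomial.aeval h (Polynomial.C t⁻¹ * Polynomial.X - 1) = shifted h t := by
    intro t
    simp [shifted, Algebra.smul_def]
  obtain ⟨p, q, hpq⟩ := hcop.pow (m := n) (n := n)
  have h1 := congrArg (Polynomial.aeval h) hpq
  rw [mul_comm q, map_add, map_mul, map_mul, map_pow, map_pow, hev, hev, map_one] at h1
  refine ⟨Polynomial.aeval h q x, ?_⟩
  have h2 := LinearMap.congr_fun h1 x
  rw [LinearMap.add_apply, Module.End.mul_apply, hx, map_zero, zero_add] at h2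
  exact h2

/-- x lies in the range of the n-th power for κ, whose adjoint kills y. So the generalized
eigenspace is isotropic when l is not on the unit circle. -/
theorem apply_eq_zero_of_ne (hgh : g * h = 1) (hhg : h * g = 1) (hκ : starRingEnd ℂ κ * l = 1)
    (hne : κ ≠ l) {n : ℕ} {x y : V} (hx : (shifted h l ^ n) x = 0) (hy : (shifted h l ^ n) y = 0) :
    A x y = 0 := by
  have hκ0 : κ ≠ 0 := by rintro rfl; simp at hκ
  obtain ⟨w, rfl⟩ := exists_shifted_pow_eq hκ0 (right_ne_zero_of_mul_eq_one hκ) hne hx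
  rw [H.shifted_pow_left hgh hhg hκ, hy, map_zero, map_zero]

/-- All powers move to the right argument. Beyond m they kill x; at m the vector is an l-eigenvector
of h, on which each factor -l·h⁻¹ acts as -1. -/
theorem apply_chain (hgh : g * h = 1) (hhg : h * g = 1) (hκ : starRingEnd ℂ κ * l = 1) {m : ℕ}
    {x : V} (hx : (shifted h l ^ (m + 1)) x = 0) (y : V) (i j : ℕ) :
    (m < i + j → A ((shifted h κ ^ i) y) ((shifted h l ^ j) x) = 0) ∧
    (i + j = m → A ((shifted h κ ^ i) y) ((shifted h l ^ j) x) =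
      (-1) ^ i * A y ((shifted h l ^ m) x)) := by
  have hl : l ≠ 0 := right_ne_zero_of_mul_eq_one hκ
  rw [H.shifted_pow_left hgh hhg hκ, ← Module.End.mul_apply (shifted h l ^ i), ← pow_add]
  constructor
  · intro hij
    rw [shifted_pow_eq_zero_of_le hij hx, map_zero, map_zero]
  · intro hij
    rw [hij]
    have hw : (-(l • g)) ((shifted h l ^ m) x) = (-1 : ℂ) • (shifted h l ^ m) x := by
      have h1 : shifted h l ((shifted h l ^ m) x) = 0 := by
        rw [← Module.End.mul_apply, ← pow_succ', hx]
      have h2 := apply_eq_smul_add_shifted (h := h) hl ((shifted h l ^ m) x)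
      rw [h1, add_zero] at h2
      have h3 : g (h ((shifted h l ^ m) x)) = (shifted h l ^ m) x := by
        rw [← Module.End.mul_apply g h, hgh]; rfl
      rw [h2, map_smul] at h3
      rw [LinearMap.neg_apply, LinearMap.smul_apply, h3, neg_one_smul]
    have hp : ∀ i : ℕ, ((-(l • g)) ^ i) ((shifted h l ^ m) x) =
        ((-1 : ℂ) ^ i) • (shifted h l ^ m) x := by
      intro i
      induction i with
      | zero => simp
      | succ i ih => rw [pow_succ, Module.End.mul_apply, hw, map_smul, ih, smul_smul, pow_succ']
    rw [hp, map_smul, smul_eq_mul]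

theorem isAntitriangular_chain (hgh : g * h = 1) (hhg : h * g = 1) (hκ : starRingEnd ℂ κ * l = 1)
    {m : ℕ} {x y : V} (hx : (shifted h l ^ (m + 1)) x = 0) (hy : A y ((shifted h l ^ m) x) ≠ 0) :
    IsAntitriangular (k := m + 1) (Matrix.of fun i j =>
      A ((shifted h κ ^ (m - (i : ℕ))) y) ((shifted h l ^ (m - (j : ℕ))) x)) := by
  refine ⟨fun i j hij => (H.apply_chain hgh hhg hκ hx y _ _).1 (by omega), fun i j hij => ?_⟩
  rw [Matrix.of_apply, (H.apply_chain hgh hhg hκ hx y _ _).2 (by omega)]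
  exact mul_ne_zero (pow_ne_zero _ (by norm_num)) hy

omit H in
-- Polarization of the sesquilinear form A(x, Nᵐy) with N = `shifted h l`: evaluating at x + y and x
-- + iy recovers A(x, Nᵐy); no hermitian symmetry is needed.
theorem exists_apply_self_ne_zero {n m : ℕ} {x y : V} (hx : (shifted h l ^ n) x = 0)
    (hy : (shifted h l ^ n) y = 0) (hxy : A x ((shifted h l ^ m) y) ≠ 0) :
    ∃ w, (shifted h l ^ n) w = 0 ∧ A w ((shifted h l ^ m) w) ≠ 0 := by
  by_contra hcon
  push Not at hcon
  have h1 := hcon x hx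
  have h2 := hcon y hy
  have h3 := hcon (x + y) (by rw [map_add, hx, hy, add_zero])
  have h4 := hcon (x + Complex.I • y) (by rw [map_add, map_smul, hx, hy, smul_zero, add_zero])
  simp only [map_add, LinearMap.add_apply, map_smul, LinearMap.map_smulₛₗ, LinearMap.smul_apply,
    smul_eq_mul, Complex.conj_I, h1, h2, zero_add, add_zero, mul_zero] at h3 h4
  apply hxy
  have h5 : Complex.I * (2 * A x ((shifted h l ^ m) y)) = 0 := by
    linear_combination h4 + Complex.I * h3
  simpa [Complex.I_ne_zero] using h5

end IsAsymmetry

theorem exists_nilpotency_order {n : ℕ} {v : V} (hv : (shifted h l ^ n) v = 0) (hv0 : v ≠ 0) :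
    ∃ m, (∀ y, (shifted h l ^ n) y = 0 → (shifted h l ^ (m + 1)) y = 0) ∧
      ∃ y, (shifted h l ^ n) y = 0 ∧ (shifted h l ^ m) y ≠ 0 := by
  classical
  have hex : ∃ k, ∀ y, (shifted h l ^ n) y = 0 → (shifted h l ^ k) y = 0 := ⟨n, fun y hy => hy⟩
  have h0 : Nat.find hex ≠ 0 := by
    intro h0
    have := Nat.find_spec hex v hv
    rw [h0] at this
    exact hv0 this
  obtain ⟨m, hm⟩ := Nat.exists_eq_succ_of_ne_zero h0
  refine ⟨m, ?_, ?_⟩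
  · have := Nat.find_spec hex
    rwa [hm] at this
  · have := Nat.find_min hex (m := m) (by omega)
    push Not at this
    exact this

theorem apply_chain_zero (hl : l ≠ 0) {m : ℕ} {x : V} (hx : (shifted h l ^ (m + 1)) x = 0) :
    h ((shifted h l ^ m) x) = l • (shifted h l ^ m) x := by
  rw [apply_eq_smul_add_shifted (h := h) hl ((shifted h l ^ m) x), ← Module.End.mul_apply,
    ← pow_succ', hx, add_zero]

theorem apply_chain_succ (hl : l ≠ 0) {m : ℕ} (x : V) (j : ℕ) (hj : j < m) :
    h ((shifted h l ^ (m - (j + 1))) x) =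
      l • ((shifted h l ^ (m - (j + 1))) x + (shifted h l ^ (m - j)) x) := by
  rw [apply_eq_smul_add_shifted (h := h) hl ((shifted h l ^ (m - (j + 1))) x),
    ← Module.End.mul_apply, ← pow_succ']
  congr 4
  omega

end Asymmetry

/-! ### The variation structure of a nondegenerate sesquilinear form -/

/-- The variation structure with `V⁻¹ = G`. -/
def HVS.ofForm {ι : Type} [Fintype ι] [DecidableEq ι] (G : Matrix ι ι ℂ) (hG : IsUnit G) :
    HVS 1 ι where
  b := Gᴴ - G
  h := G⁻¹ * Gᴴ
  V := G⁻¹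
  b_hermitian := by
    rw [Matrix.conjTranspose_sub, Matrix.conjTranspose_conjTranspose, pow_one, neg_one_smul,
      neg_sub]
  h_isUnit := (Matrix.isUnit_nonsing_inv_iff.2 hG).mul ((Matrix.isUnit_conjTranspose _).2 hG)
  h_orthogonal := by
    have hd := (Matrix.isUnit_iff_isUnit_det _).1 hG
    have hd' := (Matrix.isUnit_iff_isUnit_det _).1 ((Matrix.isUnit_conjTranspose _).2 hG)
    have e1 : (G⁻¹ * Gᴴ)ᴴ * Gᴴ = G := by
      rw [Matrix.conjTranspose_mul, Matrix.conjTranspose_conjTranspose,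
        Matrix.conjTranspose_nonsing_inv, Matrix.mul_assoc, Matrix.nonsing_inv_mul _ hd',
        Matrix.mul_one]
    have e2 : G * (G⁻¹ * Gᴴ) = Gᴴ := by
      rw [← Matrix.mul_assoc, Matrix.mul_nonsing_inv _ hd, Matrix.one_mul]
    rw [Matrix.mul_sub, Matrix.sub_mul, e1, e2, Matrix.mul_assoc, e2, e1]
  V_conj := by
    have hd' := (Matrix.isUnit_iff_isUnit_det _).1 ((Matrix.isUnit_conjTranspose _).2 hG)
    have hd := (Matrix.isUnit_iff_isUnit_det _).1 hG
    rw [pow_one, neg_one_smul, neg_neg, Matrix.conjTranspose_mul,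
      Matrix.conjTranspose_conjTranspose, ← Matrix.mul_assoc, Matrix.nonsing_inv_mul _ hd,
      Matrix.one_mul]
  V_mul_b := by
    have hd := (Matrix.isUnit_iff_isUnit_det _).1 hG
    rw [Matrix.mul_sub, Matrix.nonsing_inv_mul _ hd]

theorem HVS.ofForm_inv_V {ι : Type} [Fintype ι] [DecidableEq ι] (G : Matrix ι ι ℂ)
    (hG : IsUnit G) : (HVS.ofForm G hG).V⁻¹ = G :=
  Matrix.nonsing_inv_nonsing_inv _ ((Matrix.isUnit_iff_isUnit_det _).1 hG)

theorem HVS.isUnit_ofForm_V {ι : Type} [Fintype ι] [DecidableEq ι] (G : Matrix ι ι ℂ)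
    (hG : IsUnit G) : IsUnit (HVS.ofForm G hG).V :=
  Matrix.isUnit_nonsing_inv_iff.2 hG

/-! ### Recognizing 𝒲^k_λ(u) with λ ≠ 1 from the form -/

section CircleModel

variable {m : ℕ} {l : ℂ}

/-- Skew-hermitian symmetry together with the alternating antidiagonal makes z·I^(m+1) real for the
corner entry z; having modulus 1, it is ±1. -/
theorem exists_unit_upper_right {b : Matrix (Fin (m + 1)) (Fin (m + 1)) ℂ} (hb : bᴴ = -b)
    (hJ : (jordanOne (m + 1))ᴴ * b * jordanOne (m + 1) = b) (hn : ‖b 0 (Fin.last m)‖ = 1) :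
    ∃ u : ℤˣ, b 0 (Fin.last m) =
      ((u : ℤ) : ℂ) * Complex.I ^ (-((1 : ℕ) : ℤ) ^ 2 - (m + 1 : ℤ) + 1) := by
  set z := b 0 (Fin.last m) with hz
  have h1 := congrFun (congrFun hb 0) (Fin.last m)
  rw [Matrix.conjTranspose_apply, apply_antidiagonal_of_isometry hJ (Fin.last m) 0 (by simp),
    Matrix.neg_apply, ← hz, Fin.val_last, Complex.star_def, map_mul, map_pow, map_neg,
    map_one] at h1
  have hI : Complex.I ^ (-((1 : ℕ) : ℤ) ^ 2 - (m + 1 : ℤ) + 1) = (Complex.I ^ (m + 1))⁻¹ := by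
    rw [← zpow_natCast, ← zpow_neg]
    congr 1; push_cast; ring
  have hI0 : Complex.I ^ (m + 1) ≠ 0 := pow_ne_zero _ Complex.I_ne_zero
  have hconj : starRingEnd ℂ (z * Complex.I ^ (m + 1)) = z * Complex.I ^ (m + 1) := by
    rw [map_mul, map_pow, Complex.conj_I, neg_pow, pow_succ (-1 : ℂ)]
    linear_combination (-Complex.I ^ (m + 1)) * h1
  obtain ⟨t, ht⟩ := Complex.conj_eq_iff_real.1 hconj
  have htn : |t| = 1 := by
    have h2 := congrArg norm ht
    rw [norm_mul, hn, norm_pow, Complex.norm_I, one_pow, mul_one, Complex.norm_real,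
      Real.norm_eq_abs] at h2
    exact h2.symm
  have hzt : z = t * (Complex.I ^ (m + 1))⁻¹ := by
    rw [← ht, mul_assoc, mul_inv_cancel₀ hI0, mul_one]
  rw [hI, hzt]
  rcases (abs_eq zero_le_one).1 htn with h | h
  · exact ⟨1, by rw [h]; simp⟩
  · exact ⟨-1, by rw [h]; simp⟩

variable {G : Matrix (Fin (m + 1)) (Fin (m + 1)) ℂ} (hG : IsAntitriangular G)
  (hGJ : Gᴴ = l • (G * jordanOne (m + 1)))
include hG hGJ

theorem ofForm_h : (HVS.ofForm G hG.isUnit).h = l • jordanOne (m + 1) := by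
  have hd := (Matrix.isUnit_iff_isUnit_det _).1 hG.isUnit
  change G⁻¹ * Gᴴ = _
  rw [hGJ, Matrix.mul_smul, ← Matrix.mul_assoc, Matrix.nonsing_inv_mul _ hd, Matrix.one_mul]

theorem ofForm_b_col_zero (i : Fin (m + 1)) :
    (HVS.ofForm G hG.isUnit).b i 0 = (l - 1) * G i 0 := by
  change (Gᴴ - G) i 0 = _
  rw [hGJ, Matrix.sub_apply, Matrix.smul_apply, mul_jordanOne_zero, smul_eq_mul]
  ring

theorem ofForm_b_col_succ (i : Fin (m + 1)) (j : Fin m) :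
    (HVS.ofForm G hG.isUnit).b i j.succ = (l - 1) * G i j.succ + l * G i j.castSucc := by
  change (Gᴴ - G) i j.succ = _
  rw [hGJ, Matrix.sub_apply, Matrix.smul_apply, mul_jordanOne_succ, smul_eq_mul]
  ring

theorem ofForm_isometry (hl : ‖l‖ = 1) :
    (jordanOne (m + 1))ᴴ * (HVS.ofForm G hG.isUnit).b * jordanOne (m + 1) =
      (HVS.ofForm G hG.isUnit).b := by
  have h := (HVS.ofForm G hG.isUnit).h_orthogonal
  rw [ofForm_h hG hGJ, Matrix.conjTranspose_smul, Matrix.smul_mul, Matrix.smul_mul,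
    Matrix.mul_smul, smul_smul, Complex.star_def, Complex.conj_mul', hl] at h
  simpa using h

/-- On the antidiagonal b = Gᴴ - G is (l - 1)G, so the prescribed modulus of G gives the corner of b
modulus 1. -/
theorem ofForm_isNondegBlock (hl : ‖l‖ = 1) (hl1 : l ≠ 1)
    (hn : ‖G 0 (Fin.last m)‖ = ‖l - 1‖⁻¹) :
    ∃ u : ℤˣ, IsNondegBlock 1 l u (m + 1) (HVS.ofForm G hG.isUnit) := by
  have hl0 : l - 1 ≠ 0 := sub_ne_zero.2 hl1
  set W := HVS.ofForm G hG.isUnit with hW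
  have hanti : ∀ i j : Fin (m + 1), (i : ℕ) + j + 1 ≤ m + 1 → W.b i j = (l - 1) * G i j := by
    intro i j hij
    induction j using Fin.cases with
    | zero => exact ofForm_b_col_zero hG hGJ i
    | succ j =>
      rw [hW, ofForm_b_col_succ hG hGJ, hG.1 i j.castSucc (by simp at hij ⊢; omega), mul_zero,
        add_zero]
  have hbu : IsUnit W.b := by
    refine IsAntitriangular.isUnit ⟨fun i j hij => ?_, fun i j hij => ?_⟩
    · rw [hanti i j hij.le, hG.1 i j hij, mul_zero]
    · rw [hanti i j hij.le]
      exact mul_ne_zero hl0 (hG.2 i j hij)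
  have hbh : W.bᴴ = -W.b := by
    have := W.b_hermitian
    simpa using this
  have hJ := ofForm_isometry hG hGJ hl
  obtain ⟨u, hu⟩ := exists_unit_upper_right hbh hJ (by
    rw [hanti 0 (Fin.last m) (by simp), norm_mul, hn, mul_inv_cancel₀ (norm_ne_zero_iff.2 hl0)])
  refine ⟨u, ⟨hbu, W.b_hermitian, hJ, hu⟩, ofForm_h hG hGJ, ?_⟩
  have h := W.V_mul_b
  rw [ofForm_h hG hGJ] at h
  rw [← h, Matrix.mul_assoc, Matrix.mul_nonsing_inv _ ((Matrix.isUnit_iff_isUnit_det _).1 hbu),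
    Matrix.mul_one]

end CircleModel

/-! ### Recognizing 𝒲^k_1(u) from the form -/

section DegenModel

theorem ofForm_isDegenBlock_one {G : Matrix (Fin 1) (Fin 1) ℂ} (hG : IsAntitriangular G)
    (hGJ : Gᴴ = (1 : ℂ) • (G * jordanOne 1)) (hn : ‖G 0 0‖ = 1) :
    ∃ u : ℤˣ, IsDegenBlock 1 u 1 (HVS.ofForm G hG.isUnit) := by
  have hJ : jordanOne 1 = 1 := by ext i j; fin_cases i; fin_cases j; simp [jordanOne]
  have hreal : starRingEnd ℂ (G 0 0) = G 0 0 := by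
    have := congrFun (congrFun hGJ 0) 0
    rw [hJ] at this
    simpa using this
  obtain ⟨t, ht⟩ := Complex.conj_eq_iff_real.1 hreal
  have htn : |t| = 1 := by
    rw [ht, Complex.norm_real, Real.norm_eq_abs] at hn
    exact hn
  have hb : (HVS.ofForm G hG.isUnit).b = 0 := by
    change Gᴴ - G = 0
    rw [hGJ, hJ, Matrix.mul_one, one_smul, sub_self]
  have hh : (HVS.ofForm G hG.isUnit).h = 1 := by
    rw [ofForm_h (m := 0) hG hGJ, hJ, one_smul]
  have hV : G⁻¹ 0 0 * t = 1 := by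
    have h := congrFun (congrFun (Matrix.nonsing_inv_mul _
      ((Matrix.isUnit_iff_isUnit_det _).1 hG.isUnit)) 0) 0
    rw [Matrix.mul_apply, Fin.sum_univ_one, ht, Matrix.one_apply_eq] at h
    exact h
  have hI : Complex.I ^ (1 ^ 2 + 1) = -1 := by norm_num
  -- V is the inverse of t = ±1, while the model has V = -u; hence u = -t.
  rcases (abs_eq zero_le_one).1 htn with h | h
  · refine ⟨-1, hb, hh, ?_⟩
    change G⁻¹ 0 0 = _
    rw [hI]
    rw [h] at hV
    simpa using hV
  · refine ⟨1, hb, hh, ?_⟩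
    change G⁻¹ 0 0 = _
    rw [hI]
    rw [h] at hV
    push_cast at hV ⊢
    linear_combination -hV

theorem submatrix_succ_isometry {m : ℕ} {b : Matrix (Fin (m + 2)) (Fin (m + 2)) ℂ}
    (hr : ∀ j, b 0 j = 0) (hc : ∀ i, b i 0 = 0)
    (hJ : (jordanOne (m + 2))ᴴ * b * jordanOne (m + 2) = b) :
    (jordanOne (m + 1))ᴴ * b.submatrix Fin.succ Fin.succ * jordanOne (m + 1) =
      b.submatrix Fin.succ Fin.succ := by
  have h1 : ∀ i j, ((jordanOne (m + 1))ᴴ * b.submatrix Fin.succ Fin.succ) i j =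
      ((jordanOne (m + 2))ᴴ * b) i.succ j.succ := by
    intro i j
    rw [conjTranspose_jordanOne_mul_succ]
    induction i using Fin.cases with
    | zero => rw [conjTranspose_jordanOne_mul_zero]; simp [hr]
    | succ i => rw [conjTranspose_jordanOne_mul_succ]; rfl
  have h2 : ∀ i, ((jordanOne (m + 2))ᴴ * b) i 0 = 0 := by
    intro i
    rw [Matrix.mul_apply]
    exact Finset.sum_eq_zero fun a _ => by rw [hc, mul_zero]
  ext i j
  rw [Matrix.submatrix_apply]
  conv_rhs => rw [← hJ, mul_jordanOne_succ]
  induction j using Fin.cases with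
  | zero => rw [mul_jordanOne_zero, h1]; simp [h2]
  | succ j => rw [mul_jordanOne_succ, h1, h1]; rfl

/-- For λ = 1 the form b is G shifted by one column. Its first row and column vanish, and the
antidiagonal of the remaining block consists of antidiagonal entries of G. -/
theorem ofForm_isDegenBlock {m : ℕ} {G : Matrix (Fin (m + 2)) (Fin (m + 2)) ℂ}
    (hG : IsAntitriangular G) (hGJ : Gᴴ = (1 : ℂ) • (G * jordanOne (m + 2)))
    (hn : ∀ i j : Fin (m + 2), (i : ℕ) + j = m + 1 → ‖G i j‖ = 1) :
    ∃ u : ℤˣ, IsDegenBlock 1 u (m + 2) (HVS.ofForm G hG.isUnit) := by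
  set W := HVS.ofForm G hG.isUnit with hW
  have hc : ∀ i, W.b i 0 = 0 := fun i => by
    rw [hW, ofForm_b_col_zero hG hGJ, sub_self, zero_mul]
  have hs : ∀ i j, W.b i (Fin.succ j) = G i j.castSucc := fun i j => by
    rw [hW, ofForm_b_col_succ hG hGJ, sub_self, zero_mul, zero_add, one_mul]
  have hr : ∀ j, W.b 0 j = 0 := by
    intro j
    induction j using Fin.cases with
    | zero => exact hc 0
    | succ j => rw [hs, hG.1 _ _ (by simp; omega)]
  have hbh : W.bᴴ = -W.b := by
    have := W.b_hermitian
    simpa using this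
  have hJ := submatrix_succ_isometry hr hc (ofForm_isometry hG hGJ (by simp))
  have hbu : IsUnit (W.b.submatrix Fin.succ Fin.succ) := by
    refine IsAntitriangular.isUnit ⟨fun i j hij => ?_, fun i j hij => ?_⟩
    · rw [Matrix.submatrix_apply, hs, hG.1 _ _ (by simp; omega)]
    · rw [Matrix.submatrix_apply, hs]
      exact hG.2 _ _ (by simp; omega)
  have hbh' : (W.b.submatrix Fin.succ Fin.succ)ᴴ = -W.b.submatrix Fin.succ Fin.succ := by
    rw [Matrix.conjTranspose_submatrix, hbh]; rfl
  obtain ⟨u, hu⟩ := exists_unit_upper_right hbh' hJ (by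
    rw [Matrix.submatrix_apply, hs]
    exact hn _ _ (by simp; omega))
  refine ⟨u, ?_, hr, hc, hbu, by simpa using hbh', hJ, hu⟩
  rw [hW, ofForm_h hG hGJ, one_smul]

end DegenModel

theorem exists_isModel_circle {m : ℕ} {l : ℂ} {G : Matrix (Fin (m + 1)) (Fin (m + 1)) ℂ}
    (hG : IsAntitriangular G) (hGJ : Gᴴ = l • (G * jordanOne (m + 1))) (hl : ‖l‖ = 1)
    (hn : ∀ i j : Fin (m + 1), (i : ℕ) + j = m → ‖G i j‖ = if l = 1 then 1 else ‖l - 1‖⁻¹) :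
    ∃ u : ℤˣ, (BlockLabel.circle l (m + 1) u).IsModel 1 (HVS.ofForm G hG.isUnit) := by
  by_cases hl1 : l = 1
  · subst hl1
    have h : ∃ u : ℤˣ, IsDegenBlock 1 u (m + 1) (HVS.ofForm G hG.isUnit) := by
      rcases m with _ | m
      · exact ofForm_isDegenBlock_one hG hGJ (by simpa using hn 0 0 rfl)
      · exact ofForm_isDegenBlock hG hGJ (fun i j hij => by simpa using hn i j hij)
    obtain ⟨u, hu⟩ := h
    exact ⟨u, hl, by omega, fun h => absurd rfl h, fun _ => hu⟩
  · obtain ⟨u, hu⟩ := ofForm_isNondegBlock hG hGJ hl hl1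
      (by rw [hn 0 (Fin.last m) (by simp), if_neg hl1])
    exact ⟨u, hl, by omega, fun _ => hu, fun h => absurd h hl1⟩

/-! ### The model 𝒱^{2k}_λ -/

theorem isUnit_jordanOne (k : ℕ) : IsUnit (jordanOne k) := by
  rw [Matrix.isUnit_iff_isUnit_det, Matrix.det_of_isUpperTriangular]
  · simp [jordanOne]
  · intro i j hij
    have hij' : j < i := hij
    have h1 : ¬ (j = i ∨ (j : ℕ) = i + 1) := by
      rintro (h | h)
      · exact hij'.ne h
      · have : (j : ℕ) < i := hij'
        omega
    simp [jordanOne, h1]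

theorem isUnit_smul_jordanOne_sub_one {l : ℂ} (hl : l ≠ 1) (k : ℕ) :
    IsUnit (l • jordanOne k - 1) := by
  rw [Matrix.isUnit_iff_isUnit_det, Matrix.det_of_isUpperTriangular]
  · simp [jordanOne, sub_eq_zero, hl]
  · intro i j hij
    have hij' : j < i := hij
    have h1 : ¬ (j = i ∨ (j : ℕ) = i + 1) := by
      rintro (h | h)
      · exact hij'.ne h
      · have : (j : ℕ) < i := hij'
        omega
    simp [jordanOne, h1, Matrix.one_apply_ne hij'.ne']

/-- The inverse of the variation operator of `𝒱^{2k}_λ`. -/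
def pairForm (l : ℂ) (k : ℕ) : Matrix (Fin k ⊕ Fin k) (Fin k ⊕ Fin k) ℂ :=
  Matrix.fromBlocks 0 (-(l • jordanOne k - 1)⁻¹ * (l • jordanOne k))ᴴ (-(l • jordanOne k - 1)⁻¹) 0

/-- With K = lJ and Q = -(K - 1)⁻¹ everything follows from QK - Q = -1: it makes b = Gᴴ - G the
standard matrix and identifies the inverse of G with the prescribed V. Then h is read off from Vb =
h - 1. -/
theorem exists_isModel_pair {l : ℂ} {k : ℕ} (hk : 1 ≤ k) (hl0 : l ≠ 0) (hl1 : ‖l‖ < 1) :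
    ∃ hG : IsUnit (pairForm l k),
      (BlockLabel.pair l k).IsModel 1 (HVS.ofForm (pairForm l k) hG) := by
  have hl : l ≠ 1 := by rintro rfl; simp at hl1
  suffices h : ∃ hG : IsUnit (pairForm l k),
      BlockLabel.IsPairBlock 1 l k (HVS.ofForm (pairForm l k) hG) by
    obtain ⟨hG, h⟩ := h
    exact ⟨hG, norm_pos_iff.2 hl0, hl1, hk, h⟩
  obtain ⟨K, hK⟩ : ∃ K, K = l • jordanOne k := ⟨_, rfl⟩
  obtain ⟨Q, hQ⟩ : ∃ Q, Q = -(K - 1)⁻¹ := ⟨_, rfl⟩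
  obtain ⟨Z, hZ⟩ : ∃ Z, Z = l⁻¹ • (jordanOne k)⁻¹ := ⟨_, rfl⟩
  have hXd : IsUnit (K - 1).det := by
    rw [hK]
    exact (Matrix.isUnit_iff_isUnit_det _).1 (isUnit_smul_jordanOne_sub_one hl k)
  have hJd := (Matrix.isUnit_iff_isUnit_det _).1 (isUnit_jordanOne k)
  have hKZ : K * Z = 1 := by
    rw [hK, hZ, Matrix.smul_mul, Matrix.mul_smul, smul_smul, Matrix.mul_nonsing_inv _ hJd,
      mul_inv_cancel₀ hl0, one_smul]
  have hZH : (starRingEnd ℂ l)⁻¹ • ((jordanOne k)ᴴ)⁻¹ = Zᴴ := by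
    rw [hZ, Matrix.conjTranspose_smul, Matrix.conjTranspose_nonsing_inv, star_inv₀]
    rfl
  have hQX : Q * (K - 1) = -1 := by
    rw [hQ, Matrix.neg_mul, Matrix.nonsing_inv_mul _ hXd]
  have hQK : Q * K - Q = -1 := by
    rw [← hQX, Matrix.mul_sub, Matrix.mul_one]
  have hQKH : Qᴴ - (Q * K)ᴴ = 1 := by
    rw [← Matrix.conjTranspose_sub, ← neg_sub, hQK, neg_neg, Matrix.conjTranspose_one]
  have hYQ : (Zᴴ - 1) * (Q * K)ᴴ = 1 := by
    have h : Q * K * (Z - 1) = 1 := by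
      rw [Matrix.mul_sub, Matrix.mul_assoc, hKZ, Matrix.mul_one, Matrix.mul_one, ← neg_sub, hQK,
        neg_neg]
    have := congrArg Matrix.conjTranspose h
    rwa [Matrix.conjTranspose_mul, Matrix.conjTranspose_sub, Matrix.conjTranspose_one] at this
  have hpF : pairForm l k = Matrix.fromBlocks 0 (Q * K)ᴴ Q 0 := by
    rw [pairForm, ← hK, ← hQ]
  have hinv1 : pairForm l k * Matrix.fromBlocks 0 (-(K - 1)) (Zᴴ - 1) 0 = 1 := by
    have hQY := mul_eq_one_comm.1 hYQ
    rw [hpF, Matrix.fromBlocks_multiply, hQY, Matrix.mul_neg, Matrix.mul_neg, hQX,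
      ← Matrix.fromBlocks_one]
    simp
  have hG : IsUnit (pairForm l k) := IsUnit.of_mul_eq_one _ hinv1
  have hV : (HVS.ofForm (pairForm l k) hG).V = Matrix.fromBlocks 0 (-(K - 1)) (Zᴴ - 1) 0 :=
    Matrix.inv_eq_right_inv hinv1
  have hb : (HVS.ofForm (pairForm l k) hG).b = Matrix.fromBlocks 0 1 (-1) 0 := by
    change (pairForm l k)ᴴ - pairForm l k = _
    rw [hpF, Matrix.fromBlocks_conjTranspose, sub_eq_add_neg, Matrix.fromBlocks_neg,
      Matrix.fromBlocks_add, Matrix.conjTranspose_conjTranspose, ← sub_eq_add_neg (Q * K),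
      ← sub_eq_add_neg Qᴴ, hQK, hQKH]
    simp
  refine ⟨hG, ?_, ?_, ?_⟩
  · rw [hb]; simp
  · have h := (HVS.ofForm (pairForm l k) hG).V_mul_b
    rw [hb, hV, Matrix.fromBlocks_multiply] at h
    rw [eq_add_of_sub_eq h.symm, ← Matrix.fromBlocks_one, Matrix.fromBlocks_add, hZH, ← hK]
    simp
  · rw [hV, hZH, ← hK]; simp

/-! ### Splitting off indecomposable structures -/

/-- Vectors of `V` indexed by the coordinates of a variation structure. -/
structure Frame (V : Type) where
  /-- the label of the structure -/
  label : BlockLabel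
  /-- the structure -/
  block : HVS 1 label.Idx
  /-- the vectors -/
  vec : label.Idx → V

/-- The block of the frame is a model, and its vectors have Gram matrix `V⁻¹`. -/
structure Frame.IsModelOf {V : Type} [AddCommGroup V] [Module ℂ V] (F : Frame V)
    (A : V →ₗ⋆[ℂ] V →ₗ[ℂ] ℂ) : Prop where
  isModel : F.label.IsModel 1 F.block
  isUnit_V : IsUnit F.block.V
  gram : ∀ a b, A (F.vec a) (F.vec b) = F.block.V⁻¹ a b

section Split

variable {V : Type} [AddCommGroup V] [Module ℂ V] {A : V →ₗ⋆[ℂ] V →ₗ[ℂ] ℂ} {h g : Module.End ℂ V}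
  {κ l : ℂ}

theorem apply_chain_mem_span (hl : l ≠ 0) {m : ℕ} {x : V} (hx : (shifted h l ^ (m + 1)) x = 0)
    (j : Fin (m + 1)) : h ((shifted h l ^ (m - (j : ℕ))) x) ∈
      Submodule.span ℂ (Set.range fun j : Fin (m + 1) => (shifted h l ^ (m - (j : ℕ))) x) := by
  have hmem : ∀ j : Fin (m + 1), (shifted h l ^ (m - (j : ℕ))) x ∈
      Submodule.span ℂ (Set.range fun j : Fin (m + 1) => (shifted h l ^ (m - (j : ℕ))) x) :=
    fun j => Submodule.subset_span ⟨j, rfl⟩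
  induction j using Fin.cases with
  | zero =>
    have := apply_chain_zero hl hx
    rw [Fin.val_zero, Nat.sub_zero, this]
    exact Submodule.smul_mem _ _ (by simpa using hmem 0)
  | succ j =>
    rw [Fin.val_succ, apply_chain_succ hl x j j.isLt]
    refine Submodule.smul_mem _ _ (Submodule.add_mem _ ?_ ?_)
    · simpa using hmem j.succ
    · simpa using hmem j.castSucc

/-- The reversed chain e_j = N^(m-j)x, where N = `shifted h l`, satisfies Ne₀ = 0 and Ne_{j+1} =
e_j, so h has matrix lJ in it. -/
theorem sum_apply_chain (hl : l ≠ 0) {m : ℕ} {x : V} (hx : (shifted h l ^ (m + 1)) x = 0)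
    {ι : Type} (φ : ι → V →ₗ[ℂ] ℂ) (i : ι) (j : Fin (m + 1)) :
    φ i (h ((shifted h l ^ (m - (j : ℕ))) x)) = (l • ((Matrix.of fun i (j : Fin (m + 1)) =>
      φ i ((shifted h l ^ (m - (j : ℕ))) x)) * jordanOne (m + 1))) i j := by
  rw [Matrix.smul_apply]
  induction j using Fin.cases with
  | zero =>
    rw [mul_jordanOne_zero, Fin.val_zero, Nat.sub_zero, apply_chain_zero hl hx, map_smul]
    rfl
  | succ j =>
    rw [mul_jordanOne_succ, Fin.val_succ, apply_chain_succ hl x j j.isLt, map_smul, map_add]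
    rfl

theorem IsAsymmetry.exists_frame_circle (H : IsAsymmetry A h) (hgh : g * h = 1) (hhg : h * g = 1)
    (hl : ‖l‖ = 1) {m : ℕ} {x : V} (hx : (shifted h l ^ (m + 1)) x = 0)
    (hxx : A x ((shifted h l ^ m) x) ≠ 0) :
    ∃ F : Frame V, F.IsModelOf A ∧ Nonempty F.label.Idx ∧
      ∀ a, h (F.vec a) ∈ Submodule.span ℂ (Set.range F.vec) := by
  have hκ : starRingEnd ℂ l * l = 1 := by rw [Complex.conj_mul', hl]; simp
  have hl0 : l ≠ 0 := right_ne_zero_of_mul_eq_one hκ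
  -- The antidiagonal of b is (l - 1)G for l ≠ 1 and consists of entries of G for l = 1; ρ is the
  -- modulus of G that makes its entries unimodular.
  set ρ : ℝ := if l = 1 then 1 else ‖l - 1‖⁻¹ with hρ
  have hρ0 : 0 < ρ := by
    rw [hρ]
    split_ifs with h1
    · exact one_pos
    · exact inv_pos.2 (norm_pos_iff.2 (sub_ne_zero.2 h1))
  obtain ⟨y, hy, hyy⟩ : ∃ y, (shifted h l ^ (m + 1)) y = 0 ∧ ‖A y ((shifted h l ^ m) y)‖ = ρ := by
    set β := A x ((shifted h l ^ m) x)
    have hβ : 0 < ‖β‖ := norm_pos_iff.2 hxx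
    -- Scaling x by a real factor multiplies A(x, Nᵐx) by the square of that factor, so only the
    -- modulus can be normalized; the surviving sign is u.
    refine ⟨((Real.sqrt (ρ / ‖β‖) : ℝ) : ℂ) • x, by rw [map_smul, hx, smul_zero], ?_⟩
    rw [map_smul (shifted h l ^ m), LinearMap.map_smulₛₗ A, LinearMap.smul_apply, map_smul (A x),
      smul_eq_mul, smul_eq_mul, Complex.conj_ofReal, norm_mul, norm_mul, Complex.norm_real, Real.norm_eq_abs,
      abs_of_nonneg (Real.sqrt_nonneg _), ← mul_assoc, Real.mul_self_sqrt (by positivity)]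
    exact div_mul_cancel₀ _ hβ.ne'
  have hyne : A y ((shifted h l ^ m) y) ≠ 0 := norm_pos_iff.1 (hyy ▸ hρ0)
  have hG := H.isAntitriangular_chain hgh hhg hκ hy hyne
  set G : Matrix (Fin (m + 1)) (Fin (m + 1)) ℂ := Matrix.of fun i j =>
      A ((shifted h l ^ (m - (i : ℕ))) y) ((shifted h l ^ (m - (j : ℕ))) y) with hGdef
  have hGJ : Gᴴ = l • (G * jordanOne (m + 1)) := by
    ext i j
    rw [Matrix.conjTranspose_apply]
    refine Eq.trans ?_ (sum_apply_chain hl0 hy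
      (fun i : Fin (m + 1) => A ((shifted h l ^ (m - (i : ℕ))) y)) i j)
    exact (H.apply_right _ _).symm
  obtain ⟨u, hu⟩ := exists_isModel_circle hG hGJ hl (fun i j hij => by
    rw [← hρ, ← hyy, hGdef, Matrix.of_apply, (H.apply_chain hgh hhg hκ hy y _ _).2 (by omega)]
    simp)
  refine ⟨⟨BlockLabel.circle l (m + 1) u, HVS.ofForm G hG.isUnit,
    fun j : Fin (m + 1) => (shifted h l ^ (m - (j : ℕ))) y⟩,
    ⟨hu, HVS.isUnit_ofForm_V G hG.isUnit, fun a b => ?_⟩, ⟨(0 : Fin (m + 1))⟩,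
    apply_chain_mem_span hl0 hy⟩
  exact (congrFun (congrFun (HVS.ofForm_inv_V G hG.isUnit) a) b).symm

theorem mem_span_of_isUnit {ι : Type} [Fintype ι] [DecidableEq ι] {R : Matrix ι ι ℂ}
    (hR : IsUnit R) (f : ι → V) (a : ι) :
    f a ∈ Submodule.span ℂ (Set.range fun i => ∑ j, R i j • f j) := by
  obtain ⟨S, hS⟩ := hR.exists_left_inv
  have h1 : f a = ∑ i, S a i • ∑ j, R i j • f j := by
    simp only [Finset.smul_sum, smul_smul]
    rw [Finset.sum_comm]
    simp only [← Finset.sum_smul, ← Matrix.mul_apply, hS]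
    simp [Matrix.one_apply]
  rw [h1]
  exact Submodule.sum_mem _ fun i _ => Submodule.smul_mem _ _ (Submodule.subset_span ⟨i, rfl⟩)

/-- The chains for l and κ are isotropic and dual to each other. Changing the basis of the κ-chain
alone brings A(f', e) to the block of the model; the block A(e, f') is then determined by the
asymmetry. -/
theorem IsAsymmetry.exists_frame_pair (H : IsAsymmetry A h) (hgh : g * h = 1) (hhg : h * g = 1)
    (hκ : starRingEnd ℂ κ * l = 1) (hl : ‖l‖ < 1) {n m : ℕ} {x y : V}
    (hxn : (shifted h l ^ n) x = 0) (hyn : (shifted h κ ^ n) y = 0)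
    (hx : (shifted h l ^ (m + 1)) x = 0) (hy : (shifted h κ ^ (m + 1)) y = 0)
    (hyx : A y ((shifted h l ^ m) x) ≠ 0) :
    ∃ F : Frame V, F.IsModelOf A ∧ Nonempty F.label.Idx ∧
      ∀ a, h (F.vec a) ∈ Submodule.span ℂ (Set.range F.vec) := by
  have hl0 : l ≠ 0 := right_ne_zero_of_mul_eq_one hκ
  have hκ0 : κ ≠ 0 := by rintro rfl; simp at hκ
  have hκ' : starRingEnd ℂ l * κ = 1 := by
    have := congrArg (starRingEnd ℂ) hκ
    rw [map_mul, Complex.conj_conj, map_one] at this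
    rwa [mul_comm]
  have hne : κ ≠ l := by
    rintro rfl
    rw [Complex.conj_mul'] at hκ
    have h1 : ‖κ‖ ^ 2 = 1 := by exact_mod_cast hκ
    nlinarith [norm_nonneg κ]
  have hl1 : l ≠ 1 := by rintro rfl; simp at hl
  set e : Fin (m + 1) → V := fun j => (shifted h l ^ (m - (j : ℕ))) x with he
  set f : Fin (m + 1) → V := fun j => (shifted h κ ^ (m - (j : ℕ))) y with hf
  set G' : Matrix (Fin (m + 1)) (Fin (m + 1)) ℂ := Matrix.of fun i j => A (f i) (e j) with hG'
  have hG'u : IsUnit G' := (H.isAntitriangular_chain hgh hhg hκ hx hyx).isUnit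
  set Q : Matrix (Fin (m + 1)) (Fin (m + 1)) ℂ := -(l • jordanOne (m + 1) - 1)⁻¹ with hQ
  have hQu : IsUnit Q := (Matrix.isUnit_nonsing_inv_iff.2
    (isUnit_smul_jordanOne_sub_one hl1 (m + 1))).neg
  set R := Q * G'⁻¹ with hR
  have hRu : IsUnit R := hQu.mul (Matrix.isUnit_nonsing_inv_iff.2 hG'u)
  -- A is conjugate-linear in its first argument, so the change of basis has to use the conjugates
  -- of the entries of R.
  set R' : Matrix (Fin (m + 1)) (Fin (m + 1)) ℂ := R.map (starRingEnd ℂ) with hR'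
  have hR'u : IsUnit R' := hRu.map (starRingEnd ℂ).mapMatrix
  set f' : Fin (m + 1) → V := fun i => ∑ a, R' i a • f a with hf'
  have hf'e : ∀ i j, A (f' i) (e j) = Q i j := by
    intro i j
    have hRG : R * G' = Q := by
      rw [hR, Matrix.mul_assoc, Matrix.nonsing_inv_mul _ ((Matrix.isUnit_iff_isUnit_det _).1 hG'u),
        Matrix.mul_one]
    rw [← hRG, Matrix.mul_apply, hf', map_sum, LinearMap.sum_apply]
    refine Finset.sum_congr rfl fun a _ => ?_
    rw [LinearMap.map_smulₛₗ, LinearMap.smul_apply, hR', Matrix.map_apply, Complex.conj_conj]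
    rfl
  have hef' : ∀ i j, A (e i) (f' j) = (Q * (l • jordanOne (m + 1)))ᴴ i j := by
    intro i j
    have h1 := sum_apply_chain hl0 hx (fun i : Fin (m + 1) => A (f' i)) j i
    have h2 : (Matrix.of fun (i : Fin (m + 1)) (j : Fin (m + 1)) =>
        A (f' i) ((shifted h l ^ (m - (j : ℕ))) x)) = Q := by
      ext i j; exact hf'e i j
    rw [h2, H.apply_right] at h1
    rw [Matrix.conjTranspose_apply, Matrix.mul_smul, ← h1, Complex.star_def, Complex.conj_conj]
  have hen : ∀ i, (shifted h l ^ n) (e i) = 0 := fun i => shifted_pow_apply_mem_ker _ hxn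
  have hfn : ∀ i, (shifted h κ ^ n) (f i) = 0 := fun i => shifted_pow_apply_mem_ker _ hyn
  have hf'n : ∀ i, (shifted h κ ^ n) (f' i) = 0 := fun i => by
    rw [hf', map_sum]
    exact Finset.sum_eq_zero fun a _ => by rw [map_smul, hfn, smul_zero]
  obtain ⟨hG, hmodel⟩ := exists_isModel_pair (k := m + 1) (by omega) hl0 hl
  refine ⟨⟨BlockLabel.pair l (m + 1), HVS.ofForm (pairForm l (m + 1)) hG,
    (Sum.elim e f' : Fin (m + 1) ⊕ Fin (m + 1) → V)⟩,
    ⟨hmodel, HVS.isUnit_ofForm_V _ hG, fun a b => ?_⟩, ⟨(Sum.inl (0 : Fin (m + 1)) :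
      Fin (m + 1) ⊕ Fin (m + 1))⟩, ?_⟩
  · refine Eq.trans ?_ (congrFun (congrFun (HVS.ofForm_inv_V _ hG) a) b).symm
    change A (Sum.elim e f' a) (Sum.elim e f' b) = _
    rcases a with a | a <;> rcases b with b | b
    · exact H.apply_eq_zero_of_ne hgh hhg hκ hne (hen a) (hen b)
    · exact hef' a b
    · exact hf'e a b
    · exact H.apply_eq_zero_of_ne hgh hhg hκ' hne.symm (hf'n a) (hf'n b)
  · have hE : Submodule.span ℂ (Set.range e) ≤ Submodule.span ℂ (Set.range (Sum.elim e f')) :=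
      Submodule.span_mono (by rintro _ ⟨i, rfl⟩; exact ⟨Sum.inl i, rfl⟩)
    have hF' : Submodule.span ℂ (Set.range f') ≤ Submodule.span ℂ (Set.range (Sum.elim e f')) :=
      Submodule.span_mono (by rintro _ ⟨i, rfl⟩; exact ⟨Sum.inr i, rfl⟩)
    have hF : Submodule.span ℂ (Set.range f) ≤ Submodule.span ℂ (Set.range f') := by
      rw [Submodule.span_le]
      rintro _ ⟨i, rfl⟩
      exact mem_span_of_isUnit hR'u f i
    intro a
    change h (Sum.elim e f' a) ∈ Submodule.span ℂ (Set.range (Sum.elim e f'))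
    rcases a with a | a
    · exact hE (apply_chain_mem_span hl0 hx a)
    · refine hF' (hF ?_)
      change h (∑ b, R' a b • f b) ∈ _
      rw [map_sum]
      refine Submodule.sum_mem _ fun b _ => ?_
      rw [map_smul]
      exact Submodule.smul_mem _ _ (apply_chain_mem_span hκ0 hy b)

/-- The maximal nilpotency order m + 1 on the generalized l-eigenspace makes the top of a chain pair
nontrivially with some y. If |l| = 1 then κ = l and polarization gives one self-dual chain;
otherwise x and y start dual chains. -/
theorem IsAsymmetry.exists_frame_of_generalized_eigenvector (H : IsAsymmetry A h)
    (hgh : g * h = 1) (hhg : h * g = 1) (hκ : starRingEnd ℂ κ * l = 1) (hl : ‖l‖ ≤ 1) {n : ℕ}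
    (hcκ : IsCompl (LinearMap.ker (shifted h κ ^ n)) (LinearMap.range (shifted h κ ^ n)))
    (hcl : IsCompl (LinearMap.ker (shifted h l ^ n)) (LinearMap.range (shifted h l ^ n)))
    {v : V} (hv : (shifted h l ^ n) v = 0) (hv0 : v ≠ 0) :
    ∃ F : Frame V, F.IsModelOf A ∧ Nonempty F.label.Idx ∧
      ∀ a, h (F.vec a) ∈ Submodule.span ℂ (Set.range F.vec) := by
  obtain ⟨m, hm, x, hxn, hx⟩ := exists_nilpotency_order hv hv0
  obtain ⟨y, hyn, hyx⟩ := H.exists_ne_zero_of_isCompl hgh hhg hκ hcκ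
    (shifted_pow_apply_mem_ker m hxn) hx
  rcases hl.lt_or_eq with hl | hl
  · refine H.exists_frame_pair hgh hhg hκ hl hxn hyn (hm x hxn) ?_ hyx
    -- The κ-chain is not longer: a nonzero vector N_κ^(m+1)y would pair with some b in the
    -- generalized l-eigenspace, and by the asymmetry and adjunction that value is computed from
    -- N_l^(m+1)(hb) = 0. Here N_κ and N_l are the shifted operators.
    by_contra hy0
    have hκ' : starRingEnd ℂ l * κ = 1 := by
      have := congrArg (starRingEnd ℂ) hκ
      rw [map_mul, Complex.conj_conj, map_one] at this
      rwa [mul_comm]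
    obtain ⟨b, hb, hbne⟩ := H.exists_ne_zero_of_isCompl hgh hhg hκ' hcl
      (shifted_pow_apply_mem_ker (m + 1) hyn) hy0
    have hhb : (shifted h l ^ n) (h b) = 0 := by
      rw [apply_eq_smul_add_shifted (right_ne_zero_of_mul_eq_one hκ) b, map_smul, map_add, hb]
      have := shifted_pow_apply_mem_ker 1 hb
      rw [pow_one] at this
      rw [this, add_zero, smul_zero]
    have h1 := H.apply_right ((shifted h κ ^ (m + 1)) y) b
    rw [H.shifted_pow_left hgh hhg hκ, hm _ hhb, map_zero, map_zero] at h1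
    exact hbne (by simpa using h1.symm)
  · have hκl : κ = l := by
      have h1 : starRingEnd ℂ l * l = 1 := by rw [Complex.conj_mul', hl]; simp
      exact (starRingEnd ℂ).injective
        (mul_right_cancel₀ (right_ne_zero_of_mul_eq_one hκ) (hκ.trans h1.symm))
    subst hκl
    obtain ⟨w, hw, hww⟩ := IsAsymmetry.exists_apply_self_ne_zero hyn hxn hyx
    exact H.exists_frame_circle hgh hhg hl (hm w hw) hww

theorem IsAsymmetry.exists_frame [FiniteDimensional ℂ V] [Nontrivial V] (H : IsAsymmetry A h) :
    ∃ F : Frame V, F.IsModelOf A ∧ Nonempty F.label.Idx ∧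
      ∀ a, h (F.vec a) ∈ Submodule.span ℂ (Set.range F.vec) := by
  obtain ⟨g, hgh, hhg⟩ := H.exists_inverse
  obtain ⟨μ, hμ⟩ := Module.End.exists_eigenvalue h
  obtain ⟨v, hv, hv0⟩ := hμ.exists_hasEigenvector
  rw [Module.End.mem_eigenspace_iff] at hv
  have hμ0 : μ ≠ 0 := by
    rintro rfl
    rw [zero_smul] at hv
    exact hv0 (H.injective (by rw [hv, map_zero]))
  set κ := (starRingEnd ℂ μ)⁻¹ with hκdef
  have hcμ0 : starRingEnd ℂ μ ≠ 0 := (map_ne_zero _).2 hμ0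
  have hκ : starRingEnd ℂ κ * μ = 1 := by
    rw [hκdef, map_inv₀, Complex.conj_conj, inv_mul_cancel₀ hμ0]
  have hκ' : starRingEnd ℂ μ * κ = 1 := mul_inv_cancel₀ hcμ0
  -- Fitting decompositions for κ and μ hold for all large exponents, so one n serves both.
  obtain ⟨n, hn1, hn2, hn⟩ := ((shifted h κ).eventually_isCompl_ker_pow_range_pow.and
    ((shifted h μ).eventually_isCompl_ker_pow_range_pow.and
      (Filter.eventually_ge_atTop 1))).exists
  have hvn : (shifted h μ ^ n) v = 0 := by
    refine shifted_pow_eq_zero_of_le hn ?_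
    rw [pow_one, shifted_apply, hv, smul_smul, inv_mul_cancel₀ hμ0, one_smul, sub_self]
  rcases le_total ‖μ‖ 1 with hle | hle
  · exact H.exists_frame_of_generalized_eigenvector hgh hhg hκ hle hn1 hn2 hvn hv0
  · obtain ⟨y, hy, hyv⟩ := H.exists_ne_zero_of_isCompl hgh hhg hκ hn1 hvn hv0
    refine H.exists_frame_of_generalized_eigenvector hgh hhg hκ' ?_ hn2 hn1 hy ?_
    · rw [hκdef, norm_inv, Complex.norm_conj]
      exact inv_le_one_of_one_le₀ hle
    · rintro rfl
      simp at hyv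

end Split

/-! ### Decomposition of a nondegenerate sesquilinear form -/

section Decomposition

variable {V : Type} [AddCommGroup V] [Module ℂ V]

/-- The right orthogonal complement of the vectors of a frame. -/
def Frame.complement (F : Frame V) (A : V →ₗ⋆[ℂ] V →ₗ[ℂ] ℂ) : Submodule ℂ V :=
  ⨅ a, LinearMap.ker (A (F.vec a))

theorem Frame.mem_complement {F : Frame V} {A : V →ₗ⋆[ℂ] V →ₗ[ℂ] ℂ} {z : V} :
    z ∈ F.complement A ↔ ∀ a, A (F.vec a) z = 0 := by
  simp [Frame.complement]

variable {F : Frame V} {A : V →ₗ⋆[ℂ] V →ₗ[ℂ] ℂ} {h : Module.End ℂ V}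

theorem Frame.apply_eq_zero_of_mem_span {w z : V} (hz : z ∈ F.complement A)
    (hw : w ∈ Submodule.span ℂ (Set.range F.vec)) : A w z = 0 := by
  induction hw using Submodule.span_induction with
  | mem x hx => obtain ⟨a, rfl⟩ := hx; exact Frame.mem_complement.1 hz a
  | zero => rw [map_zero, LinearMap.zero_apply]
  | add x y _ _ hx hy => rw [map_add, LinearMap.add_apply, hx, hy, add_zero]
  | smul c x _ hx => rw [LinearMap.map_smulₛₗ, LinearMap.smul_apply, hx, smul_zero]

/-- h is onto on the invariant span, so w = hw' and A(z, hw') is the conjugate of A(w', z) = 0.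
Right orthogonality thus implies left orthogonality, although A is not hermitian. -/
theorem IsAsymmetry.apply_eq_zero_of_mem_complement [FiniteDimensional ℂ V] (H : IsAsymmetry A h)
    (hinv : ∀ a, h (F.vec a) ∈ Submodule.span ℂ (Set.range F.vec)) {w z : V}
    (hz : z ∈ F.complement A) (hw : w ∈ Submodule.span ℂ (Set.range F.vec)) : A z w = 0 := by
  have hmaps : ∀ w ∈ Submodule.span ℂ (Set.range F.vec),
      h w ∈ Submodule.span ℂ (Set.range F.vec) := by
    intro w hw
    have h1 : Submodule.span ℂ (Set.range F.vec) ≤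
        (Submodule.span ℂ (Set.range F.vec)).comap h :=
      Submodule.span_le.2 (by rintro _ ⟨a, rfl⟩; exact hinv a)
    exact h1 hw
  have hsurj : Function.Surjective (h.restrict hmaps) :=
    LinearMap.surjective_of_injective fun x y hxy =>
      Subtype.ext (H.injective (congrArg Subtype.val hxy))
  obtain ⟨⟨w', hw'⟩, hww⟩ := hsurj ⟨w, hw⟩
  have hww' : h w' = w := congrArg Subtype.val hww
  rw [← hww', H.apply_right, F.apply_eq_zero_of_mem_span hz hw', map_zero]

theorem Frame.IsModelOf.isUnit_inv_V (hF : F.IsModelOf A) : IsUnit F.block.V⁻¹ :=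
  Matrix.isUnit_nonsing_inv_iff.2 hF.isUnit_V

/-- The Gram matrix of the frame is V⁻¹, so applying V to the values of A(·, z) on the frame gives
the coordinates of the projection. -/
theorem Frame.IsModelOf.exists_mem_span_sub_mem_complement (hF : F.IsModelOf A) (z : V) :
    ∃ w ∈ Submodule.span ℂ (Set.range F.vec), z - w ∈ F.complement A := by
  set t : F.label.Idx → ℂ := fun a => A (F.vec a) z with ht
  refine ⟨∑ j, (F.block.V *ᵥ t) j • F.vec j, Submodule.sum_mem _ fun j _ =>
    Submodule.smul_mem _ _ (Submodule.subset_span ⟨j, rfl⟩), Frame.mem_complement.2 fun a => ?_⟩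
  have h1 : A (F.vec a) (∑ j, (F.block.V *ᵥ t) j • F.vec j) = (F.block.V⁻¹ *ᵥ (F.block.V *ᵥ t)) a := by
    rw [map_sum]
    refine Finset.sum_congr rfl fun j _ => ?_
    rw [map_smul, hF.gram, smul_eq_mul, mul_comm]
  rw [map_sub, h1, Matrix.mulVec_mulVec,
    Matrix.nonsing_inv_mul _ ((Matrix.isUnit_iff_isUnit_det _).1 hF.isUnit_V), Matrix.one_mulVec,
    ht, sub_self]

theorem Frame.IsModelOf.complement_ne_top (hF : F.IsModelOf A) (hne : Nonempty F.label.Idx) :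
    F.complement A ≠ ⊤ := by
  intro htop
  have h0 : F.block.V⁻¹ = 0 := by
    ext a b
    rw [← hF.gram]
    exact Frame.mem_complement.1 (htop ▸ Submodule.mem_top : F.vec b ∈ F.complement A) a
  have := hF.isUnit_inv_V
  rw [h0] at this
  exact not_isUnit_zero this

theorem IsAsymmetry.apply_mem_complement [FiniteDimensional ℂ V] (H : IsAsymmetry A h)
    (hinv : ∀ a, h (F.vec a) ∈ Submodule.span ℂ (Set.range F.vec)) :
    ∀ z ∈ F.complement A, h z ∈ F.complement A := fun z hz => by
  refine Frame.mem_complement.2 fun a => ?_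
  rw [H.apply_right, H.apply_eq_zero_of_mem_complement hinv hz (Submodule.subset_span ⟨a, rfl⟩),
    map_zero]

theorem IsAsymmetry.restrict_complement [FiniteDimensional ℂ V] (H : IsAsymmetry A h)
    (hF : F.IsModelOf A)
    (hinv : ∀ a, h (F.vec a) ∈ Submodule.span ℂ (Set.range F.vec)) :
    IsAsymmetry (A.domRestrict₁₂ (F.complement A) (F.complement A))
      (h.restrict (H.apply_mem_complement hinv)) where
  apply_right x y := H.apply_right x y
  nondegenerate y hy := by
    refine Subtype.ext (H.nondegenerate y fun z => ?_)
    obtain ⟨w, hw, hzw⟩ := hF.exists_mem_span_sub_mem_complement z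
    have h1 : A (z - w) y = 0 := hy ⟨z - w, hzw⟩
    rw [map_sub, LinearMap.sub_apply, F.apply_eq_zero_of_mem_span y.2 hw, sub_zero] at h1
    exact h1

/-- The image of a frame under a map. -/
def Frame.map {W : Type} (F : Frame W) (f : W → V) : Frame V := ⟨F.label, F.block, f ∘ F.vec⟩

theorem IsAsymmetry.exists_orthogonal_frames (n : ℕ) : ∀ {V : Type} [AddCommGroup V] [Module ℂ V]
    [FiniteDimensional ℂ V] {A : V →ₗ⋆[ℂ] V →ₗ[ℂ] ℂ} {h : Module.End ℂ V} (_ : IsAsymmetry A h)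
    (_ : Module.finrank ℂ V = n),
    ∃ (r : ℕ) (P : Fin r → Frame V), (∀ i, (P i).IsModelOf A) ∧
      (∀ i j, i ≠ j → ∀ a b, A ((P i).vec a) ((P j).vec b) = 0) ∧
      Submodule.span ℂ (⋃ i, Set.range (P i).vec) = ⊤ := by
  induction n using Nat.strong_induction_on with
  | _ n ih =>
  intro V _ _ _ A h H hn
  rcases subsingleton_or_nontrivial V with hV | hV
  · exact ⟨0, Fin.elim0, fun i => i.elim0, fun i => i.elim0, Subsingleton.elim _ _⟩
  obtain ⟨F, hF, hne, hinv⟩ := H.exists_frame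
  obtain ⟨r, P, hP, horth, hspan⟩ := ih _
    (hn ▸ Submodule.finrank_lt (hF.complement_ne_top hne)) (H.restrict_complement hF hinv) rfl
  refine ⟨r + 1, Fin.cons F fun i => (P i).map (F.complement A).subtype, ?_, ?_, ?_⟩
  · refine Fin.cases hF fun i => ?_
    exact ⟨(hP i).isModel, (hP i).isUnit_V, (hP i).gram⟩
  · intro i j
    induction i using Fin.cases with
    | zero =>
      induction j using Fin.cases with
      | zero => exact fun hij => absurd rfl hij
      | succ j => exact fun _ a b => Frame.mem_complement.1 ((P j).vec b).2 a
    | succ i =>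
      induction j using Fin.cases with
      | zero =>
        intro _ a b
        exact H.apply_eq_zero_of_mem_complement hinv ((P i).vec a).2
          (Submodule.subset_span ⟨b, rfl⟩)
      | succ j => exact fun hij a b => horth i j (fun e => hij (congrArg _ e)) a b
  · set U := Submodule.span ℂ (⋃ i, Set.range
      (Fin.cons (α := fun _ => Frame V) F (fun i => (P i).map (F.complement A).subtype) i).vec) with hU
    have h1 : Submodule.span ℂ (Set.range F.vec) ≤ U :=
      Submodule.span_mono (Set.subset_iUnion_of_subset 0 subset_rfl)
    have h2 : F.complement A ≤ U := by
      rw [← Submodule.map_subtype_top (F.complement A), ← hspan, Submodule.map_span,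
        Set.image_iUnion]
      refine Submodule.span_mono (Set.iUnion_subset fun i => ?_)
      rw [← Set.range_comp]
      exact Set.subset_iUnion_of_subset i.succ subset_rfl
    refine eq_top_iff.2 fun z _ => ?_
    obtain ⟨w, hw, hzw⟩ := hF.exists_mem_span_sub_mem_complement z
    rw [← sub_add_cancel z w]
    exact U.add_mem (h2 hzw) (h1 hw)

end Decomposition

/-! ### Existence of H-numbers -/

section Existence

theorem exists_circleCount {r : ℕ} (B : Fin r → BlockLabel) : ∃ p : ℂ × ℕ × ℤˣ →₀ ℕ,
    ∀ μ k u, p (μ, k, u) = Nat.card {i : Fin r // B i = BlockLabel.circle μ k u} := by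
  classical
  refine ⟨∑ i, BlockLabel.onCircle (fun x => Finsupp.single x 1) (B i), fun μ k u => ?_⟩
  rw [Finsupp.finsetSum_apply, Nat.card_eq_fintype_card, Fintype.card_subtype,
    Finset.card_filter]
  refine Finset.sum_congr rfl fun i _ => ?_
  rcases B i with ⟨μ', k', u'⟩ | ⟨μ', k'⟩
  · simp [BlockLabel.onCircle, Finsupp.single_apply]
  · simp [BlockLabel.onCircle]

theorem exists_pairCount {r : ℕ} (B : Fin r → BlockLabel) : ∃ q : ℂ × ℕ →₀ ℕ,
    ∀ μ k, q (μ, k) = Nat.card {i : Fin r // B i = BlockLabel.pair μ k} := by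
  classical
  refine ⟨∑ i, BlockLabel.onPair (fun x => Finsupp.single x 1) (B i), fun μ k => ?_⟩
  rw [Finsupp.finsetSum_apply, Nat.card_eq_fintype_card, Fintype.card_subtype,
    Finset.card_filter]
  refine Finset.sum_congr rfl fun i _ => ?_
  rcases B i with ⟨μ', k', u'⟩ | ⟨μ', k'⟩
  · simp [BlockLabel.onPair]
  · simp [BlockLabel.onPair, Finsupp.single_apply]

variable {ι κ : Type} [Fintype ι] [DecidableEq ι] [Fintype κ] [DecidableEq κ]

theorem HVS.h_eq {W : HVS 1 ι} (hV : IsUnit W.V) : W.h = W.V * (W.V⁻¹)ᴴ := by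
  rw [HVS.conjTranspose_inv_V hV, ← Matrix.mul_assoc,
    Matrix.mul_nonsing_inv _ ((Matrix.isUnit_iff_isUnit_det _).1 hV), Matrix.one_mul]

theorem HVS.b_eq {W : HVS 1 ι} (hV : IsUnit W.V) : W.b = (W.V⁻¹)ᴴ - W.V⁻¹ := by
  rw [← HVS.inv_V_mul hV, HVS.conjTranspose_inv_V hV, Matrix.mul_sub, Matrix.mul_one]

/-- Variation structures with invertible `V` are isomorphic as soon as the forms `V⁻¹` are. -/
theorem HVS.Iso.of_inv_V {X : HVS 1 ι} {Y : HVS 1 κ} (hX : IsUnit X.V) (hY : IsUnit Y.V)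
    {φ : Matrix κ ι ℂ} {ψ : Matrix ι κ ℂ} (h1 : ψ * φ = 1) (h2 : φ * ψ = 1)
    (hV : X.V⁻¹ = φᴴ * Y.V⁻¹ * φ) : X.Iso Y := by
  have hdX := (Matrix.isUnit_iff_isUnit_det _).1 hX
  have hdY := (Matrix.isUnit_iff_isUnit_det _).1 hY
  have h4 : φᴴ * ψᴴ = 1 := by
    rw [← Matrix.conjTranspose_mul, h1, Matrix.conjTranspose_one]
  have h3 : ψᴴ * φᴴ = 1 := by
    rw [← Matrix.conjTranspose_mul, h2, Matrix.conjTranspose_one]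
  have hXV : X.V = ψ * Y.V * ψᴴ := by
    rw [← Matrix.nonsing_inv_nonsing_inv _ hdX]
    refine Matrix.inv_eq_left_inv ?_
    calc ψ * Y.V * ψᴴ * X.V⁻¹ = ψ * (Y.V * ((ψᴴ * φᴴ) * Y.V⁻¹)) * φ := by
          rw [hV]; simp only [Matrix.mul_assoc]
      _ = 1 := by rw [h3, Matrix.one_mul, Matrix.mul_nonsing_inv _ hdY, Matrix.mul_one, h1]
  have hXVc : (X.V⁻¹)ᴴ = φᴴ * (Y.V⁻¹)ᴴ * φ := by
    rw [hV, Matrix.conjTranspose_mul, Matrix.conjTranspose_mul, Matrix.conjTranspose_conjTranspose,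
      Matrix.mul_assoc]
  refine ⟨φ, ψ, h1, h2, ?_, ?_, hXV⟩
  · rw [HVS.b_eq hX, HVS.b_eq hY, hXVc, hV, Matrix.mul_sub, Matrix.sub_mul]
  · rw [HVS.h_eq hX, HVS.h_eq hY, hXVc, hXV]
    calc ψ * Y.V * ψᴴ * (φᴴ * (Y.V⁻¹)ᴴ * φ) = ψ * Y.V * (ψᴴ * φᴴ) * (Y.V⁻¹)ᴴ * φ := by
          simp only [Matrix.mul_assoc]
      _ = _ := by rw [h3, Matrix.mul_one]; simp only [Matrix.mul_assoc]

/-- The sesquilinear form with a given matrix. -/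
def sesqForm (G : Matrix ι ι ℂ) : (ι → ℂ) →ₗ⋆[ℂ] (ι → ℂ) →ₗ[ℂ] ℂ :=
  LinearMap.mk₂'ₛₗ (starRingEnd ℂ) (RingHom.id ℂ) (fun x y => star x ⬝ᵥ (G *ᵥ y))
    (fun x x' y => by rw [star_add, add_dotProduct])
    (fun c x y => by rw [star_smul, smul_dotProduct]; rfl)
    (fun x y y' => by rw [Matrix.mulVec_add, dotProduct_add])
    (fun c x y => by rw [Matrix.mulVec_smul, dotProduct_smul]; rfl)

theorem sesqForm_apply (G : Matrix ι ι ℂ) (x y : ι → ℂ) :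
    sesqForm G x y = star x ⬝ᵥ (G *ᵥ y) := rfl

open scoped ComplexOrder in
theorem HVS.isAsymmetry {W : HVS 1 ι} (hV : IsUnit W.V) :
    IsAsymmetry (sesqForm W.V⁻¹) (Matrix.toLin' W.h) where
  apply_right x y := by
    rw [sesqForm_apply, sesqForm_apply, Matrix.toLin'_apply, Matrix.mulVec_mulVec,
      ← HVS.conjTranspose_inv_V hV, starRingEnd_apply, ← Matrix.star_dotProduct_star, star_star,
      Matrix.star_mulVec, Matrix.dotProduct_mulVec, dotProduct_comm, dotProduct_comm]
  nondegenerate y hy := by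
    have h1 : W.V⁻¹ *ᵥ y = 0 := by
      -- Testing against V⁻¹y itself turns the vanishing into the squared norm of V⁻¹y.
      have := hy (W.V⁻¹ *ᵥ y)
      rw [sesqForm_apply] at this
      exact dotProduct_star_self_eq_zero.1 this
    have h2 := congrArg (W.V *ᵥ ·) h1
    simpa [Matrix.mulVec_mulVec, Matrix.mul_nonsing_inv _
      ((Matrix.isUnit_iff_isUnit_det _).1 hV)] using h2

/-- Every variation structure with invertible `V` has H-numbers. -/
theorem HVS.exists_isHNumbers {X : HVS 1 ι} (hX : IsUnit X.V) :
    ∃ (p : ℂ × ℕ × ℤˣ →₀ ℕ) (q : ℂ × ℕ →₀ ℕ), IsHNumbers X p q := by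
  obtain ⟨r, P, hP, horth, hspan⟩ := IsAsymmetry.exists_orthogonal_frames _ (HVS.isAsymmetry hX) rfl
  obtain ⟨p, hp⟩ := exists_circleCount fun i => (P i).label
  obtain ⟨q, hq⟩ := exists_pairCount fun i => (P i).label
  refine ⟨p, q, r, fun i => (P i).label, fun i => (P i).block, fun i => (hP i).isModel, ?_, hp, hq⟩
  set Φ : Matrix ι (Σ i, (P i).label.Idx) ℂ := Matrix.of fun s x => (P x.1).vec x.2 s with hΦ
  set Y := HVS.directSum fun i => (P i).block with hYdef
  have hinv : (Matrix.blockDiagonal' fun i => ((P i).block.V)⁻¹) * Y.V = 1 := by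
    change _ * Matrix.blockDiagonal' (fun i => (P i).block.V) = 1
    rw [← Matrix.blockDiagonal'_mul, ← Matrix.blockDiagonal'_one]
    congr 1; funext i
    exact Matrix.nonsing_inv_mul _ ((Matrix.isUnit_iff_isUnit_det _).1 (hP i).isUnit_V)
  have hY : IsUnit Y.V := IsUnit.of_mul_eq_one_right _ hinv
  have hYinv : Y.V⁻¹ = Matrix.blockDiagonal' fun i => ((P i).block.V)⁻¹ :=
    Matrix.inv_eq_left_inv hinv
  have hgram : Φᴴ * X.V⁻¹ * Φ = Y.V⁻¹ := by
    ext ⟨i, a⟩ ⟨j, b⟩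
    have h1 : (Φᴴ * X.V⁻¹ * Φ) ⟨i, a⟩ ⟨j, b⟩ = sesqForm X.V⁻¹ ((P i).vec a) ((P j).vec b) := by
      rw [Matrix.mul_assoc]
      rfl
    rw [h1, hYinv]
    by_cases hij : i = j
    · subst hij
      rw [(hP i).gram, Matrix.blockDiagonal'_apply_eq]
    · rw [horth i j hij, Matrix.blockDiagonal'_apply_ne _ _ _ hij]
  have hleft : (Y.V * Φᴴ * X.V⁻¹) * Φ = 1 := by
    rw [Matrix.mul_assoc, Matrix.mul_assoc, ← Matrix.mul_assoc Φᴴ, hgram,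
      Matrix.mul_nonsing_inv _ ((Matrix.isUnit_iff_isUnit_det _).1 hY)]
  -- The Gram matrix gives only a left inverse of Φ; that the frames span makes it two-sided,
  -- without comparing the sizes of the index types.
  have hsurj : ∀ v : ι → ℂ, ∃ c, Φ *ᵥ c = v := by
    intro v
    have hle : Submodule.span ℂ (⋃ i, Set.range (P i).vec) ≤ LinearMap.range Φ.mulVecLin := by
      rw [Submodule.span_le]
      refine Set.iUnion_subset fun i => ?_
      rintro _ ⟨a, rfl⟩
      refine ⟨Pi.single ⟨i, a⟩ 1, ?_⟩
      rw [Matrix.mulVecLin_apply, Matrix.mulVec_single_one]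
      rfl
    rw [hspan] at hle
    obtain ⟨c, hc⟩ := hle (Submodule.mem_top (x := v))
    exact ⟨c, hc⟩
  have hright : Φ * (Y.V * Φᴴ * X.V⁻¹) = 1 := by
    refine Matrix.ext_of_mulVec_single fun s => ?_
    obtain ⟨c, hc⟩ := hsurj (Pi.single s 1)
    rw [← hc, Matrix.one_mulVec, ← Matrix.mulVec_mulVec, Matrix.mulVec_mulVec c, hleft,
      Matrix.one_mulVec]
  refine HVS.Iso.of_inv_V hX hY hright hleft ?_
  have hrightH : (Y.V * Φᴴ * X.V⁻¹)ᴴ * Φᴴ = 1 := by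
    rw [← Matrix.conjTranspose_mul, hright, Matrix.conjTranspose_one]
  calc X.V⁻¹ = ((Y.V * Φᴴ * X.V⁻¹)ᴴ * Φᴴ) * X.V⁻¹ * (Φ * (Y.V * Φᴴ * X.V⁻¹)) := by
        rw [hrightH, hright, Matrix.one_mul, Matrix.mul_one]
    _ = (Y.V * Φᴴ * X.V⁻¹)ᴴ * (Φᴴ * X.V⁻¹ * Φ) * (Y.V * Φᴴ * X.V⁻¹) := by
        simp only [Matrix.mul_assoc]
    _ = _ := by rw [hgram]

end Existence

end

/-- For every real square matrix `S` (in particular for every Seifert matrix of an oriented link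
in the 3-sphere): a nondegenerate part `T` exists, its variation structure has H-numbers, and for
every choice of these the Tristram--Levine signature is given by the (extended) spectrum. -/
theorem corollary4p9 {N : ℕ} (S : Matrix (Fin N) (Fin N) ℝ) :
    (∃ (m : ℕ) (T : Matrix (Fin m) (Fin m) ℝ), IsNondegPart S T) ∧
    ∀ (m : ℕ) (T : Matrix (Fin m) (Fin m) ℝ) (hT : IsNondegPart S T),
      (∃ (p : ℂ × ℕ × ℤˣ →₀ ℕ) (q : ℂ × ℕ →₀ ℕ), IsHNumbers (variationStructure T hT.1) p q) ∧
      ∀ (p : ℂ × ℕ × ℤˣ →₀ ℕ) (q : ℂ × ℕ →₀ ℕ), IsHNumbers (variationStructure T hT.1) p q →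
        ∀ x : ℝ, 0 < x → x < 1 →
          ((tristramLevine S (expTwoPiI x) =
              -(cardIn (modTwoSpectrum p) (Set.Ioo x (x + 1)) : ℤ)
                + (cardOut (modTwoSpectrum p) (Set.Icc x (x + 1)) : ℤ)
                + evenTerm p (expTwoPiI x)) ∧
            (¬ Module.End.HasEigenvalue (Matrix.toLin' (variationStructure T hT.1).h)
                (expTwoPiI x) →
              tristramLevine S (expTwoPiI x) =
                -(cardIn (modTwoSpectrum p) (Set.Ioo x (x + 1)) : ℤ)
                  + (cardOut (modTwoSpectrum p) (Set.Ioo x (x + 1)) : ℤ))) ∧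
          ((∀ z ∈ extendedSpectrum p q, z ∉ frontier (strip x)) →
            tristramLevine S (expTwoPiI x) =
              -(cardIn (extendedSpectrum p q) (strip x) : ℤ)
                + (cardOut (extendedSpectrum p q) (strip x) : ℤ)) := by
  refine ⟨exists_isNondegPart S, fun m T hT =>
    ⟨HVS.exists_isHNumbers (isUnit_variationStructure_V T hT.1), fun p q hpq x hx0 hx1 => ?_⟩⟩
  rw [hT.tristramLevine_eq (expTwoPiI_ne_one hx0 hx1)]
  exact hpq.tristramLevine_eq hx0 hx1
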